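/- Let $S=\mathbb R\cup B\subset\mathbb C$, where $\mathbb R$ is the real axis and $B=\{z\in\mathbb C:\operatorname{Re} z\in\mathbb Z,\ \operatorname{Im} z\in[0,1]\}$; this is the universal covering of the space $\sigma$ (a circle with a segment attached to it at one of the segment's endpoints), with deck transformations $z\mapsto z+k$, $k\in\mathbb Z$. Let $\mathcal L_1(S)$ be the class of continuous maps $F:S\to S$ with $F(z+1)=F(z)+1$ for all $z\in S$ (the degree $1$ liftings of continuous self-maps of $\sigma$). For $F\in\mathcal L_1(S)$ and $z\in S$ put $\rho_F(z)=\lim_{n\to\infty}\frac{\operatorname{Re}(F^n(z))-\operatorname{Re}(z)}{n}$ if the limit exists, and let $\operatorname{Rot}_{\mathbb R}(F)\subset\mathbb R$ be the set of all $\rho_F(x)$ with $x\in\mathbb R$ for which the limit exists. A point $z\in S$ is periodic (mod 1) of period $n\ge 1$ if $n$ is the least positive integer with $F^n(z)\in z+\mathbb Z$; let $\operatorname{Per}(F)$ be the set of periods of all periodic (mod 1) points of $F$. Write $\mathbb N=\{1,2,3,\dots\}$. **Theorem.** Let $F\in\mathcal L_1(S)$. If $\operatorname{Int}(\operatorname{Rot}_{\mathbb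 R}(F))\cap\mathbb Z\neq\emptyset$, then $\operatorname{Per}(F)$ is equal to either $\mathbb N$, or $\mathbb N\setminus\{1\}$, or $\mathbb N\setminus\{2\}$. Moreover, there exist maps $F_0,F_1,F_2\in\mathcal L_1(S)$ with $0\in\operatorname{Int}(\operatorname{Rot}_{\mathbb R}(F_i))$ for $i=0,1,2$ such that $\operatorname{Per}(F_0)=\mathbb N$, $\operatorname{Per}(F_1)=\mathbb N\setminus\{1\}$ and $\operatorname{Per}(F_2)=\mathbb N\setminus\{2\}$. -/

import Mathlib

open Filter Topology

namespace SigmaMap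

/-- The universal covering `S = ℝ ∪ B ⊆ ℂ` of the space `σ`, where `B` is the set of branches:
the complex numbers with integer real part and imaginary part in `[0, 1]`. -/
def S : Set ℂ :=
  {z : ℂ | z.im = 0} ∪ {z : ℂ | (∃ m : ℤ, z.re = (m : ℝ)) ∧ z.im ∈ Set.Icc (0 : ℝ) 1}

theorem add_int_mem_S {z : ℂ} (hz : z ∈ S) (k : ℤ) : z + (k : ℂ) ∈ S := by
  rcases hz with hz | ⟨⟨m, hm⟩, hz⟩
  · left
    simpa using hz
  · right
    refine ⟨⟨m + k, ?_⟩, ?_⟩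
    · simp [hm]
    · simpa using hz

/-- The deck transformation `z ↦ z + k` of `S`. -/
def translate (k : ℤ) (z : S) : S := ⟨(z : ℂ) + (k : ℂ), add_int_mem_S z.2 k⟩

/-- The class of continuous maps of degree `d` from `S` into itself:
`F (z + 1) = F z + d` for all `z ∈ S`. -/
def IsLifting (d : ℤ) (F : S → S) : Prop :=
  Continuous F ∧ ∀ z : S, F (translate 1 z) = translate d (F z)

/-- `z` has a rotation number under `F`, and this number is `α`. -/
def HasRotationNumber (F : S → S) (z : S) (α : ℝ) : Prop :=
  Tendsto (fun n : ℕ => (((F^[n] z : S) : ℂ).re - (z : ℂ).re) / (n : ℝ)) atTop (𝓝 α)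

/-- The rotation set `Rot_ℝ(F)`: the rotation numbers of the points of the real line in `S`. -/
def rotR (F : S → S) : Set ℝ :=
  {α : ℝ | ∃ z : S, (z : ℂ).im = 0 ∧ HasRotationNumber F z α}

/-- `z` is periodic (mod 1) for `F`, and its period (mod 1) is `n`: `n` is the least positive
integer with `F^n(z) ∈ z + ℤ`. -/
def HasPeriodMod1 (F : S → S) (z : S) (n : ℕ) : Prop :=
  IsLeast {i : ℕ | 0 < i ∧ ∃ k : ℤ, F^[i] z = translate k z} n

/-- The set `Per(F)` of the periods of all periodic (mod 1) points of `F`. -/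
def Per (F : S → S) : Set ℕ := {n : ℕ | ∃ z : S, HasPeriodMod1 F z n}

/-- The set of positive integers. -/
def posNat : Set ℕ := {n : ℕ | 0 < n}

end SigmaMap

/-!
# Periods of maps of degree one on the circle with a segment attached

After subtracting an integer, the interior point of the rotation set is `0`, so that some real point
has an orbit that is unbounded to the right, and another one an orbit that is unbounded to the left
(`Up F` and `Up (reflect F)`). Such maps have all periods except possibly `1`, or all periods except
possibly `2` (`ManyPeriods`, `manyPeriods_of_up_of_down`), which leaves three possibilities for the
set of periods.

Periodic points come from loops of coverings between arcs of `S`. An arc never contains an integer in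
its interior, where `S` branches, so that it has a coordinate that is defined on all of `S`, and
coverings can be handled with the intermediate value theorem. A loop whose first arc is disjoint from
the others modulo `1` yields a point whose period is the length of the loop
(`mem_Per_of_chain_of_disj`), and if another arc of the loop covers itself, then all larger periods
occur as well (`mem_Per_of_self`). The task is thus to find short loops through an arc that covers
itself: loops of length `2`, or loops of length `3` and a fixed point.

If all real points move in the same direction, then an orbit that escapes in the other direction has
to use the branches. Either a point of a branch is mapped above a certain height larger than its own,
and the branch carries a horseshoe (`mem_Per_of_climb`, `mem_Per_of_climb_of_hub`), or a real point
is mapped so high that the part of the branch below its image goes around the circuit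
(`mem_Per_of_wrap`).

Otherwise there are fixed points on the real axis (`Frame`). An orbit escaping to the right has to
leave a region on the left of a certain fixed point `zp`, and `Frame.exit` lists the ways to do so;
each of them is a covering relation. The mirror image of this applies to orbits escaping to the left,
and in `Frame.many_of_turn` and `Frame.many_of_eq_zero` every way of leaving to the right is combined
with every way of leaving to the left into a loop.

In the examples, an arc that covers its own translates by `-1`, `0` and `1` under an iterate of the
map makes `0` an interior point of the rotation set (`zero_mem_interior_rotR`). By the first part,
only the periods `1` and `2` then have to be decided by hand.
-/

namespace SigmaMap

/-! ### The space `S` and its deck transformations -/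

/-- The real part of a point of `S`. -/
def re (z : S) : ℝ := (z : ℂ).re

/-- The imaginary part of a point of `S`: its height on the branch that carries it. -/
def im (z : S) : ℝ := (z : ℂ).im

@[fun_prop]
theorem continuous_re : Continuous re := Complex.continuous_re.comp continuous_subtype_val

@[fun_prop]
theorem continuous_im : Continuous im := Complex.continuous_im.comp continuous_subtype_val

theorem ext_re_im {z w : S} (h₁ : re z = re w) (h₂ : im z = im w) : z = w :=
  Subtype.ext (Complex.ext h₁ h₂)

theorem im_nonneg (z : S) : 0 ≤ im z := by
  rcases z.2 with h | ⟨-, h⟩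
  · exact le_of_eq (show (0 : ℝ) = im z from h.symm)
  · exact h.1

theorem im_le_one (z : S) : im z ≤ 1 := by
  rcases z.2 with h | ⟨-, h⟩
  · have : im z = 0 := h
    linarith
  · exact h.2

theorem exists_re_eq_of_im_pos {z : S} (h : 0 < im z) : ∃ m : ℤ, re z = m := by
  rcases z.2 with h' | ⟨h', -⟩
  · have : im z = 0 := h'
    linarith
  · exact h'

/-- A point whose real part lies strictly between two consecutive integers is real. -/
theorem im_eq_zero_of_re {z : S} {m : ℤ} (h₁ : (m : ℝ) < re z) (h₂ : re z < m + 1) :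
    im z = 0 := by
  by_contra h
  obtain ⟨k, hk⟩ := exists_re_eq_of_im_pos (lt_of_le_of_ne (im_nonneg z) (Ne.symm h))
  rw [hk] at h₁ h₂
  have a : m < k := by exact_mod_cast h₁
  have b : k < m + 1 := by exact_mod_cast h₂
  omega

/-- The point of `S` with real part `x` and imaginary part `y`. -/
def mk (x y : ℝ) (h : y = 0 ∨ (∃ m : ℤ, x = m) ∧ y ∈ Set.Icc (0 : ℝ) 1) : S :=
  ⟨⟨x, y⟩, h⟩

/-- The inclusion of the real axis into `S`. -/
def real (x : ℝ) : S := mk x 0 (Or.inl rfl)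

/-- The point of height `t` on the branch over `0`, the height being truncated to `[0, 1]`. -/
def br (t : ℝ) : S :=
  mk 0 (max 0 (min 1 t)) (Or.inr ⟨⟨0, by simp⟩, le_max_left _ _, max_le zero_le_one (min_le_left _ _)⟩)

@[simp] theorem re_real (x : ℝ) : re (real x) = x := rfl
@[simp] theorem im_real (x : ℝ) : im (real x) = 0 := rfl
@[simp] theorem re_br (t : ℝ) : re (br t) = 0 := rfl
theorem im_br {t : ℝ} (h₀ : 0 ≤ t) (h₁ : t ≤ 1) : im (br t) = t := by
  show max 0 (min 1 t) = t
  rw [min_eq_right h₁, max_eq_right h₀]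

@[fun_prop]
theorem continuous_real : Continuous real := by
  refine Continuous.subtype_mk ?_ _
  have : (fun x : ℝ => (⟨x, 0⟩ : ℂ)) = fun x : ℝ => (x : ℂ) := rfl
  rw [this]
  exact Complex.continuous_ofReal

theorem continuous_mk {X : Type*} [TopologicalSpace X] {f g : X → ℝ} (hf : Continuous f)
    (hg : Continuous g)
    (h : ∀ x, g x = 0 ∨ (∃ m : ℤ, f x = m) ∧ g x ∈ Set.Icc (0 : ℝ) 1) :
    Continuous fun x => mk (f x) (g x) (h x) := by
  refine Continuous.subtype_mk ?_ _
  have : (fun x => (⟨f x, g x⟩ : ℂ)) = fun x => (f x : ℂ) + (g x : ℂ) * Complex.I := by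
    funext x
    exact Complex.mk_eq_add_mul_I _ _
  rw [this]
  fun_prop

@[fun_prop]
theorem continuous_br : Continuous br :=
  continuous_mk (f := fun _ => 0) continuous_const (by fun_prop) _

theorem br_zero : br 0 = real 0 := ext_re_im rfl (im_br le_rfl zero_le_one)

theorem eq_real {z : S} (h : im z = 0) : z = real (re z) := ext_re_im rfl h

@[simp] theorem re_translate (k : ℤ) (z : S) : re (translate k z) = re z + k := by
  simp [re, translate]

@[simp] theorem im_translate (k : ℤ) (z : S) : im (translate k z) = im z := by
  simp [im, translate]

@[fun_prop]
theorem continuous_translate (k : ℤ) : Continuous (translate k) :=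
  Continuous.subtype_mk (continuous_subtype_val.add continuous_const) _

@[simp] theorem translate_zero (z : S) : translate 0 z = z := ext_re_im (by simp) (by simp)

@[simp] theorem translate_translate (k l : ℤ) (z : S) :
    translate k (translate l z) = translate (l + k) z :=
  ext_re_im (by simp; ring) (by simp)

theorem translate_real (k : ℤ) (x : ℝ) : translate k (real x) = real (x + k) :=
  ext_re_im (by simp) (by simp)

theorem eq_translate_br {z : S} {m : ℤ} (h : re z = m) : z = translate m (br (im z)) :=
  ext_re_im (by simp [h]) (by simp [im_br (im_nonneg z) (im_le_one z)])

theorem translate_injective (k : ℤ) {z w : S} (h : translate k z = translate k w) : z = w := by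
  have := congrArg (translate (-k)) h
  simpa using this

theorem eq_translate_neg {k : ℤ} {z w : S} (h : z = translate k w) : w = translate (-k) z := by
  rw [h]; simp

/-! ### Liftings -/

section Lifting

variable {F : S → S}

theorem IsLifting.apply_translate (hF : IsLifting 1 F) (k : ℤ) (z : S) :
    F (translate k z) = translate k (F z) := by
  have hn : ∀ (n : ℕ) (z : S), F (translate (n : ℤ) z) = translate (n : ℤ) (F z) := by
    intro n
    induction n with
    | zero => intro z; simp
    | succ n ih =>
      intro z
      have h := hF.2 (translate (n : ℤ) z)
      rw [ih] at h
      simpa using h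
  obtain ⟨n, rfl | rfl⟩ := k.eq_nat_or_neg
  · exact hn n z
  · have h := hn n (translate (-(n : ℤ)) z)
    simp only [translate_translate, neg_add_cancel, translate_zero] at h
    rw [h]
    simp

theorem IsLifting.iterate_translate (hF : IsLifting 1 F) (n : ℕ) (k : ℤ) (z : S) :
    F^[n] (translate k z) = translate k (F^[n] z) := by
  induction n generalizing z with
  | zero => rfl
  | succ n ih => rw [Function.iterate_succ_apply, hF.apply_translate, ih,
      Function.iterate_succ_apply]

theorem IsLifting.apply_real_add (hF : IsLifting 1 F) (k : ℤ) (x : ℝ) :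
    F (real (x + k)) = translate k (F (real x)) := by
  rw [← translate_real, hF.apply_translate]

theorem IsLifting.re_real_add (hF : IsLifting 1 F) (k : ℤ) (x : ℝ) :
    re (F (real (x + k))) = re (F (real x)) + k := by
  rw [hF.apply_real_add, re_translate]

theorem IsLifting.im_real_add (hF : IsLifting 1 F) (k : ℤ) (x : ℝ) :
    im (F (real (x + k))) = im (F (real x)) := by
  rw [hF.apply_real_add, im_translate]

end Lifting

/-! ### Coordinates on `S` -/

/-- A coordinate that straightens the cell `[m, m + 1]`: it is the real part on the real axis, and
it leaves the interval `[m, m + 1]` along the branches over `m` and `m + 1`. -/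
def kap (m : ℤ) (z : S) : ℝ := re z + im z * max (-1) (min 1 (2 * (re z - m) - 1))

/-- A coordinate that straightens the branch over `j`: it is the height on this branch, and it is
negative off the branch. -/
def eta (j : ℤ) (z : S) : ℝ := im z * max 0 (1 - |re z - j|) - |re z - j|

@[fun_prop]
theorem continuous_kap (m : ℤ) : Continuous (kap m) := by unfold kap; fun_prop

@[fun_prop]
theorem continuous_eta (j : ℤ) : Continuous (eta j) := by unfold eta; fun_prop

theorem kap_of_im {z : S} (m : ℤ) (h : im z = 0) : kap m z = re z := by simp [kap, h]

@[simp] theorem kap_real (m : ℤ) (x : ℝ) : kap m (real x) = x := by simp [kap]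

theorem kap_of_le {m j : ℤ} {z : S} (h : re z = j) (hj : j ≤ m) : kap m z = j - im z := by
  have : (j : ℝ) ≤ m := by exact_mod_cast hj
  rw [kap, h, min_eq_right (by linarith), max_eq_left (by linarith)]
  ring

theorem kap_of_lt {m j : ℤ} {z : S} (h : re z = j) (hj : m < j) : kap m z = j + im z := by
  have : (m : ℝ) + 1 ≤ j := by exact_mod_cast hj
  rw [kap, h, min_eq_left (by linarith), max_eq_right (by linarith)]
  ring

/-- Points off the real axis lie outside the interval `[m, m + 1]` of the coordinate `kap m`. -/
theorem im_eq_zero_of_kap {m : ℤ} {z : S} (h₁ : (m : ℝ) ≤ kap m z) (h₂ : kap m z ≤ m + 1) :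
    im z = 0 := by
  by_contra h
  have hz : 0 < im z := lt_of_le_of_ne (im_nonneg z) (Ne.symm h)
  obtain ⟨j, hj⟩ := exists_re_eq_of_im_pos hz
  rcases le_or_gt j m with hm | hm
  · rw [kap_of_le hj hm] at h₁
    have : (j : ℝ) ≤ m := by exact_mod_cast hm
    linarith
  · rw [kap_of_lt hj hm] at h₂
    have : (m : ℝ) + 1 ≤ j := by exact_mod_cast hm
    linarith

theorem eq_real_kap {m : ℤ} {z : S} (h₁ : (m : ℝ) ≤ kap m z) (h₂ : kap m z ≤ m + 1) :
    real (kap m z) = z := by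
  have h := im_eq_zero_of_kap h₁ h₂
  rw [kap_of_im m h]
  exact (eq_real h).symm

theorem kap_le_of_re_le {m : ℤ} {z : S} {a : ℝ} (ha : a < m + 1) (h : re z ≤ a) :
    kap m z ≤ a := by
  rcases (im_nonneg z).eq_or_lt with hz | hz
  · rwa [kap_of_im m hz.symm]
  · obtain ⟨j, hj⟩ := exists_re_eq_of_im_pos hz
    have : (j : ℝ) < (m + 1 : ℤ) := by push_cast; linarith
    rw [kap_of_le hj (by have : j < m + 1 := (by exact_mod_cast this); omega)]
    linarith

theorem le_kap_of_le_re {m : ℤ} {z : S} {b : ℝ} (hb : m < b) (h : b ≤ re z) :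
    b ≤ kap m z := by
  rcases (im_nonneg z).eq_or_lt with hz | hz
  · rwa [kap_of_im m hz.symm]
  · obtain ⟨j, hj⟩ := exists_re_eq_of_im_pos hz
    have : (m : ℝ) < j := by linarith
    rw [kap_of_lt hj (by exact_mod_cast this)]
    linarith

theorem eta_of_re {j : ℤ} {z : S} (h : re z = j) : eta j z = im z := by simp [eta, h]

theorem eta_neg_of_re_ne {j : ℤ} {z : S} (h : re z ≠ j) : eta j z < 0 := by
  have h0 : 0 < |re z - j| := abs_pos.2 (sub_ne_zero.2 h)
  rcases (im_nonneg z).eq_or_lt with hz | hz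
  · simp only [eta, ← hz]; linarith
  · obtain ⟨i, hi⟩ := exists_re_eq_of_im_pos hz
    have : (1 : ℝ) ≤ |re z - j| := by
      rw [hi] at h ⊢
      have hij : i ≠ j := by exact_mod_cast h
      exact_mod_cast Int.one_le_abs (sub_ne_zero.2 hij)
    rw [eta, max_eq_left (by linarith)]
    linarith

theorem re_of_eta_nonneg {j : ℤ} {z : S} (h : 0 ≤ eta j z) : re z = j := by
  by_contra h'
  exact absurd (eta_neg_of_re_ne h') (not_lt.2 h)

theorem im_of_eta_nonneg {j : ℤ} {z : S} (h : 0 ≤ eta j z) : im z = eta j z :=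
  (eta_of_re (re_of_eta_nonneg h)).symm

theorem eta_le_im (j : ℤ) (z : S) : eta j z ≤ im z := by
  by_cases h : re z = j
  · exact (eta_of_re h).le
  · exact (eta_neg_of_re_ne h).le.trans (im_nonneg z)

theorem eta_nonpos_of_im {j : ℤ} {z : S} (h : im z = 0) : eta j z ≤ 0 := h ▸ eta_le_im j z

theorem eta_translate (j k : ℤ) (z : S) : eta j (translate k z) = eta (j - k) z := by
  have : re z + k - j = re z - ((j - k : ℤ) : ℝ) := by push_cast; ring
  simp only [eta, re_translate, im_translate, this]

theorem br_eta {z : S} (h : 0 ≤ eta 0 z) : br (eta 0 z) = z := by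
  have hr := re_of_eta_nonneg h
  have hi := im_of_eta_nonneg h
  refine ext_re_im (by simp [hr]) ?_
  rw [← hi, im_br (im_nonneg z) (im_le_one z)]

/-! ### Arcs, coverings and loops -/

/-- An arc of `S`: a parametrization `e` of a subset of `S` by `[a, b]`, together with a continuous
coordinate `c` on the whole of `S` that takes values in `[a, b]` on the arc only. -/
structure Arc where
  /-- the coordinate -/
  c : S → ℝ
  /-- the parametrization -/
  e : ℝ → S
  /-- the initial parameter -/
  a : ℝ
  /-- the final parameter -/
  b : ℝ
  cont_c : Continuous c
  cont_e : Continuous e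
  a_le_b : a ≤ b
  e_c : ∀ z, a ≤ c z → c z ≤ b → e (c z) = z

/-- The real arc `[a, b]` inside the cell `[m, m + 1]`. -/
def Arc.re (m : ℤ) (a b : ℝ) (h₁ : m ≤ a) (h₂ : a ≤ b) (h₃ : b ≤ m + 1) : Arc where
  c := kap m
  e := real
  a := a
  b := b
  cont_c := continuous_kap m
  cont_e := continuous_real
  a_le_b := h₂
  e_c _ h h' := eq_real_kap (h₁.trans h) (h'.trans h₃)

/-- The arc of the points of heights `[a, b]` on the branch over `0`. -/
def Arc.br (a b : ℝ) (h₁ : 0 ≤ a) (h₂ : a ≤ b) : Arc where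
  c := eta 0
  e := SigmaMap.br
  a := a
  b := b
  cont_c := continuous_eta 0
  cont_e := continuous_br
  a_le_b := h₂
  e_c _ h _ := br_eta (h₁.trans h)

/-- `X.Has z` means that some integer translate of `z` lies on the arc `X`. -/
def Arc.Has (X : Arc) (z : S) : Prop := ∃ k : ℤ, ∃ x ∈ Set.Icc X.a X.b, translate k z = X.e x

/-- The arcs `X` and `Y` are disjoint modulo the deck transformations. -/
def Arc.Disj (X Y : Arc) : Prop := ∀ z, X.Has z → Y.Has z → False

theorem Arc.has_translate {X : Arc} {k : ℤ} {z : S} : X.Has (translate k z) ↔ X.Has z := by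
  constructor
  · rintro ⟨l, x, hx, h⟩
    exact ⟨k + l, x, hx, by rw [← h, translate_translate]⟩
  · rintro ⟨l, x, hx, h⟩
    exact ⟨l - k, x, hx, by rw [← h, translate_translate]; congr 1; ring⟩

theorem Arc.has_re {m : ℤ} {a b : ℝ} {h₁ h₂ h₃} {z : S} (h : (Arc.re m a b h₁ h₂ h₃).Has z) :
    im z = 0 ∧ ∃ k : ℤ, a ≤ SigmaMap.re z + k ∧ SigmaMap.re z + k ≤ b := by
  obtain ⟨k, x, hx, h⟩ := h
  have h' := congrArg SigmaMap.re h
  have h'' := congrArg SigmaMap.im h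
  simp only [Arc.re, re_translate, re_real, im_translate, im_real] at h' h''
  exact ⟨h'', k, h' ▸ hx⟩

theorem Arc.has_br {a b : ℝ} {h₁ h₂} (hb : b ≤ 1) {z : S} (h : (Arc.br a b h₁ h₂).Has z) :
    a ≤ im z ∧ im z ≤ b := by
  obtain ⟨k, x, hx, h⟩ := h
  have h'' := congrArg SigmaMap.im h
  simp only [Arc.br, im_translate] at h''
  rw [h'', im_br (h₁.trans hx.1) (hx.2.trans hb)]
  exact hx

theorem Arc.disj_re_br {m : ℤ} {a b : ℝ} {h₁ h₂ h₃} {s t : ℝ} {h₄ h₅} (hs : 0 < s) (ht : t ≤ 1) :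
    (Arc.re m a b h₁ h₂ h₃).Disj (Arc.br s t h₄ h₅) := by
  intro z h h'
  have := (Arc.has_re h).1
  have := (Arc.has_br ht h').1
  linarith

theorem Arc.disj_br_br {s t : ℝ} {h₄ h₅} {s' t' : ℝ} {h₄' h₅'} (ht : t < s') (ht' : t' ≤ 1) :
    (Arc.br s t h₄ h₅).Disj (Arc.br s' t' h₄' h₅') := by
  intro z h h'
  have := (Arc.has_br (by linarith) h).2
  have := (Arc.has_br ht' h').1
  linarith

/-- Real arcs `[a, b]` and `[a', b']` with `b < a'` and `b' < a + 1` have no common point modulo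
`1`. -/
theorem Arc.disj_re_re {m : ℤ} {a b : ℝ} {h₁ h₂ h₃} {m' : ℤ} {a' b' : ℝ} {h₁' h₂' h₃'}
    (h : b < a') (h' : b' < a + 1) :
    (Arc.re m a b h₁ h₂ h₃).Disj (Arc.re m' a' b' h₁' h₂' h₃') := by
  intro z hz hz'
  obtain ⟨-, k, hk⟩ := Arc.has_re hz
  obtain ⟨-, l, hl⟩ := Arc.has_re hz'
  have e1 : (k : ℝ) < l := by linarith
  have e2 : (l : ℝ) < k + 1 := by linarith
  have e1 : k < l := by exact_mod_cast e1
  have e2 : l < k + 1 := by exact_mod_cast e2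
  omega

theorem Arc.Disj.symm {X Y : Arc} (h : X.Disj Y) : Y.Disj X := fun z h₁ h₂ => h z h₂ h₁

/-- `X` covers `Y` under `F`: some points of `X` are mapped, up to a common deck transformation, to
either side of `Y`. -/
def Covers (F : S → S) (X Y : Arc) : Prop :=
  ∃ k : ℤ, ∃ x ∈ Set.Icc X.a X.b, ∃ y ∈ Set.Icc X.a X.b,
    Y.c (translate (-k) (F (X.e x))) ≤ Y.a ∧ Y.b ≤ Y.c (translate (-k) (F (X.e y)))

/-- Consecutive arcs of the list `X :: l ++ [Y]` cover each other. -/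
def Chain (F : S → S) : Arc → List Arc → Arc → Prop
  | X, [], Y => Covers F X Y
  | X, Z :: l, Y => Covers F X Z ∧ Chain F Z l Y

/-- The points `z, F z, F (F z), …` lie, modulo `1`, in the successive arcs of the list. -/
def Follows (F : S → S) : List Arc → S → Prop
  | [], _ => True
  | X :: l, z => X.Has z ∧ Follows F l (F z)

theorem follows_translate {F : S → S} (hF : IsLifting 1 F) (l : List Arc) (k : ℤ) (z : S) :
    Follows F l (translate k z) ↔ Follows F l z := by
  induction l generalizing z with
  | nil => simp [Follows]
  | cons X l ih => simp only [Follows, Arc.has_translate, hF.apply_translate, ih]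

theorem Chain.append {F : S → S} {X Z Y : Arc} {l l' : List Arc} (h : Chain F X l Z)
    (h' : Chain F Z l' Y) : Chain F X (l ++ Z :: l') Y := by
  induction l generalizing X with
  | nil => exact ⟨h, h'⟩
  | cons W l ih => exact ⟨h.1, ih h.2⟩

theorem Chain.replicate {F : S → S} {X Z Y : Arc} {l : List Arc} (h₁ : Covers F X Y)
    (h₂ : Covers F Y Y) (h₃ : Chain F Y l Z) (j : ℕ) :
    Chain F X (List.replicate (j + 1) Y ++ l) Z := by
  induction j generalizing X with
  | zero => exact ⟨h₁, h₃⟩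
  | succ j ih =>
    rw [List.replicate_succ]
    exact ⟨h₁, ih h₂⟩

/-- A continuous function on an interval that takes the values `c` and `d` maps some subinterval
between them, endpoints to endpoints. -/
theorem exists_uIcc_between {g : ℝ → ℝ} {x y c d : ℝ} (hg : Continuous g) (hx : g x = c)
    (hy : g y = d) : ∃ u ∈ Set.uIcc x y, ∃ v ∈ Set.uIcc x y, g u = c ∧ g v = d ∧
      ∀ w ∈ Set.uIcc u v, g w ∈ Set.uIcc c d := by
  -- the increasing case, from which the others follow by reflecting the line
  have key : ∀ (g : ℝ → ℝ) (x y c d : ℝ), Continuous g → g x = c → g y = d → x ≤ y → c ≤ d →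
      ∃ u ∈ Set.Icc x y, ∃ v ∈ Set.Icc x y, u ≤ v ∧ g u = c ∧ g v = d ∧
      ∀ w ∈ Set.Icc u v, g w ∈ Set.Icc c d := by
    intro g x y c d hg hx hy hxy hcd
    obtain ⟨v, ⟨hv, hvd⟩, hvmin⟩ := (isCompact_Icc.inter_right
      (isClosed_singleton.preimage hg : IsClosed (g ⁻¹' {d}))).exists_isLeast
      (⟨y, ⟨hxy, le_rfl⟩, hy⟩ : (Set.Icc x y ∩ g ⁻¹' {d}).Nonempty)
    obtain ⟨u, ⟨hu, huc⟩, humax⟩ := (isCompact_Icc.inter_right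
      (isClosed_singleton.preimage hg : IsClosed (g ⁻¹' {c}))).exists_isGreatest
      (⟨x, ⟨le_rfl, hv.1⟩, hx⟩ : (Set.Icc x v ∩ g ⁻¹' {c}).Nonempty)
    refine ⟨u, ⟨hu.1, hu.2.trans hv.2⟩, v, hv, hu.2, huc, hvd, fun w hw => ⟨?_, ?_⟩⟩
    · by_contra! h
      obtain ⟨w', hw', h'⟩ := intermediate_value_Icc hw.2 hg.continuousOn
        (⟨h.le, by rw [hvd]; exact hcd⟩ : c ∈ Set.Icc (g w) (g v))
      have := humax ⟨⟨hu.1.trans (hw.1.trans hw'.1), hw'.2⟩, h'⟩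
      have : w = u := le_antisymm (hw'.1.trans this) hw.1
      rw [this] at h
      exact h.ne huc
    · by_contra! h
      obtain ⟨w', hw', h'⟩ := intermediate_value_Icc hw.1 hg.continuousOn
        (⟨by rw [huc]; exact hcd, h.le⟩ : d ∈ Set.Icc (g u) (g w))
      have := hvmin ⟨⟨hu.1.trans hw'.1, (hw'.2.trans hw.2).trans hv.2⟩, h'⟩
      have : w = v := le_antisymm hw.2 (this.trans hw'.2)
      rw [this] at h
      exact h.ne' hvd
  have key₂ : ∀ (g : ℝ → ℝ) (x y c d : ℝ), Continuous g → g x = c → g y = d → x ≤ y →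
      ∃ u ∈ Set.Icc x y, ∃ v ∈ Set.Icc x y, u ≤ v ∧ g u = c ∧ g v = d ∧
      ∀ w ∈ Set.Icc u v, g w ∈ Set.uIcc c d := by
    intro g x y c d hg hx hy hxy
    rcases le_total c d with h | h
    · rw [Set.uIcc_of_le h]
      exact key g x y c d hg hx hy hxy h
    · obtain ⟨u, hu, v, hv, huv, h1, h2, h3⟩ := key (fun t => -g t) x y (-c) (-d) hg.neg
        (by simp [hx]) (by simp [hy]) hxy (by linarith)
      refine ⟨u, hu, v, hv, huv, by linarith, by linarith, fun w hw => ?_⟩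
      have := h3 w hw
      rw [Set.uIcc_of_ge h]
      exact ⟨by linarith [this.2], by linarith [this.1]⟩
  rcases le_total x y with h | h
  · obtain ⟨u, hu, v, hv, huv, h1, h2, h3⟩ := key₂ g x y c d hg hx hy h
    rw [Set.uIcc_of_le h]
    exact ⟨u, hu, v, hv, h1, h2, by rwa [Set.uIcc_of_le huv]⟩
  · obtain ⟨u, hu, v, hv, huv, h1, h2, h3⟩ := key₂ g y x d c hg hy hx h
    rw [Set.uIcc_of_ge h, Set.uIcc_comm c d]
    exact ⟨v, hv, u, hu, h2, h1, by rwa [Set.uIcc_of_ge huv]⟩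

/-- If `X` covers `Y`, then a subinterval of `X` is mapped exactly onto any subinterval of `Y`. -/
theorem Covers.exists_uIcc {F : S → S} (hF : IsLifting 1 F) {X Y : Arc} (h : Covers F X Y)
    {c d : ℝ} (hc : c ∈ Set.Icc Y.a Y.b) (hd : d ∈ Set.Icc Y.a Y.b) :
    ∃ k : ℤ, ∃ u ∈ Set.Icc X.a X.b, ∃ v ∈ Set.Icc X.a X.b, ∃ g : ℝ → ℝ, Continuous g ∧ g u = c ∧
      g v = d ∧ ∀ w ∈ Set.uIcc u v, g w ∈ Set.uIcc c d ∧ F (X.e w) = translate k (Y.e (g w)) := by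
  obtain ⟨k, x, hx, y, hy, h1, h2⟩ := h
  have hgc : Continuous fun w => Y.c (translate (-k) (F (X.e w))) :=
    Y.cont_c.comp ((continuous_translate _).comp (hF.1.comp X.cont_e))
  set g : ℝ → ℝ := fun w => Y.c (translate (-k) (F (X.e w))) with hg
  have ivt : ∀ c ∈ Set.Icc Y.a Y.b, ∃ x ∈ Set.Icc X.a X.b, g x = c := by
    intro c hc
    obtain ⟨w, hw, h⟩ := intermediate_value_uIcc (hgc.continuousOn (s := Set.uIcc x y))
      (Set.Icc_subset_uIcc ⟨h1.trans hc.1, hc.2.trans h2⟩)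
    exact ⟨w, Set.uIcc_subset_Icc hx hy hw, h⟩
  obtain ⟨x', hx', ex⟩ := ivt c hc
  obtain ⟨y', hy', ey⟩ := ivt d hd
  obtain ⟨u, hu, v, hv, eu, ev, h⟩ := exists_uIcc_between hgc ex ey
  refine ⟨k, u, Set.uIcc_subset_Icc hx' hy' hu, v, Set.uIcc_subset_Icc hx' hy' hv, g, hgc, eu, ev,
    fun w hw => ⟨h w hw, ?_⟩⟩
  have := Set.uIcc_subset_Icc hc hd (h w hw)
  rw [Y.e_c _ this.1 this.2]
  simp

theorem Chain.exists_uIcc {F : S → S} (hF : IsLifting 1 F) {X Y : Arc} {l : List Arc}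
    (h : Chain F X l Y) :
    ∃ k : ℤ, ∃ u ∈ Set.Icc X.a X.b, ∃ v ∈ Set.Icc X.a X.b, ∃ g : ℝ → ℝ,
      ContinuousOn g (Set.uIcc u v) ∧ g u = Y.a ∧ g v = Y.b ∧
      ∀ w ∈ Set.uIcc u v, Follows F (X :: l) (X.e w) ∧
        F^[l.length + 1] (X.e w) = translate k (Y.e (g w)) := by
  induction l generalizing X with
  | nil =>
    obtain ⟨k, u, hu, v, hv, g, hg, eu, ev, h⟩ := Covers.exists_uIcc hF h
      (Set.left_mem_Icc.2 Y.a_le_b) (Set.right_mem_Icc.2 Y.a_le_b)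
    refine ⟨k, u, hu, v, hv, g, hg.continuousOn, eu, ev, fun w hw => ⟨⟨⟨0, w,
      Set.uIcc_subset_Icc hu hv hw, by simp⟩, trivial⟩, (h w hw).2⟩⟩
  | cons Z l ih =>
    obtain ⟨k', u', hu', v', hv', g', hg', eu', ev', h'⟩ := ih h.2
    obtain ⟨k, u, hu, v, hv, g, hg, eu, ev, h⟩ := Covers.exists_uIcc hF h.1 hu' hv'
    refine ⟨k + k', u, hu, v, hv, g' ∘ g, hg'.comp hg.continuousOn fun w hw => (h w hw).1,
      by simp [eu, eu'], by simp [ev, ev'], fun w hw => ?_⟩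
    obtain ⟨h1, h2⟩ := h w hw
    obtain ⟨h3, h4⟩ := h' _ h1
    refine ⟨⟨⟨0, w, Set.uIcc_subset_Icc hu hv hw, by simp⟩, ?_⟩, ?_⟩
    · rw [h2, follows_translate hF]
      exact h3
    · rw [List.length_cons, Function.iterate_succ_apply, h2, hF.iterate_translate, h4,
        translate_translate]
      simp [add_comm]

/-- A loop of coverings is followed by a periodic (mod 1) point. -/
theorem Chain.exists_periodic {F : S → S} (hF : IsLifting 1 F) {X : Arc} {l : List Arc}
    (h : Chain F X l X) : ∃ z, Follows F (X :: l) z ∧ ∃ k, F^[l.length + 1] z = translate k z := by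
  obtain ⟨k, u, hu, v, hv, g, hg, eu, ev, h⟩ := h.exists_uIcc hF
  have hc : ContinuousOn (fun w => g w - w) (Set.uIcc u v) := hg.sub continuousOn_id
  obtain ⟨w, hw, e⟩ := intermediate_value_uIcc hc (Set.Icc_subset_uIcc
    (⟨by simp only [eu]; linarith [hu.1], by simp only [ev]; linarith [hv.2]⟩ :
      (0 : ℝ) ∈ Set.Icc (g u - u) (g v - v)))
  have e : g w = w := by simpa [sub_eq_zero] using e
  refine ⟨X.e w, (h w hw).1, k, ?_⟩
  rw [(h w hw).2, e]

theorem Follows.has_of_mem {F : S → S} {l : List Arc} {z : S} (h : Follows F l z) {i : ℕ}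
    (hi : i < l.length) : (l[i]).Has (F^[i] z) := by
  induction l generalizing i z with
  | nil => simp at hi
  | cons X l ih =>
    cases i with
    | zero => exact h.1
    | succ i =>
      rw [Function.iterate_succ_apply]
      simpa using ih h.2 (by simpa using hi)

/-- The existence of a loop whose first arc cannot be revisited by a periodic point yields a point
whose period is the length of the loop. -/
theorem mem_Per_of_chain {F : S → S} (hF : IsLifting 1 F) {X : Arc} {l : List Arc}
    (h : Chain F X l X) (hX : ∀ z, Follows F (X :: l) z → ∀ Y ∈ l, ¬ Y.Has z) :
    l.length + 1 ∈ Per F := by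
  obtain ⟨z, hz, k, hk⟩ := h.exists_periodic hF
  refine ⟨z, ⟨by omega, k, hk⟩, ?_⟩
  rintro i ⟨hi, k', hk'⟩
  by_contra! hlt
  have h1 : i - 1 < l.length := by omega
  have h2 := hz.2.has_of_mem h1
  rw [← Function.iterate_succ_apply, Nat.succ_eq_add_one, Nat.sub_add_cancel hi, hk',
    Arc.has_translate] at h2
  exact hX z hz _ (List.getElem_mem h1) h2

theorem mem_Per_of_chain_of_disj {F : S → S} (hF : IsLifting 1 F) {X : Arc} {l : List Arc}
    (h : Chain F X l X) (hX : ∀ Y ∈ l, X.Disj Y) : l.length + 1 ∈ Per F :=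
  mem_Per_of_chain hF h fun z hz Y hY => hX Y hY z hz.1

theorem one_mem_Per {F : S → S} (hF : IsLifting 1 F) {X : Arc} (h : Covers F X X) : 1 ∈ Per F :=
  mem_Per_of_chain_of_disj hF (l := []) h (by simp)

/-- Loops through an arc `Y` that covers itself, with `r` further arcs, have all lengths
`≥ r + 2`. -/
theorem mem_Per_of_self {F : S → S} (hF : IsLifting 1 F) {X Y : Arc} {l : List Arc}
    (h₁ : Covers F X Y) (h₂ : Covers F Y Y) (h₃ : Chain F Y l X) (hY : X.Disj Y)
    (hl : ∀ Z ∈ l, X.Disj Z) {n : ℕ} (hn : l.length + 2 ≤ n) : n ∈ Per F := by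
  obtain ⟨j, rfl⟩ := Nat.exists_eq_add_of_le hn
  have := mem_Per_of_chain_of_disj hF (Chain.replicate h₁ h₂ h₃ j) (by
    intro Z hZ
    rcases List.mem_append.1 hZ with h | h
    · rw [List.eq_of_mem_replicate h]; exact hY
    · exact hl Z h)
  simpa [add_comm, add_left_comm, add_assoc] using this

/-- The same for loops in which other arcs precede the self-covering arc. -/
theorem mem_Per_of_self_append {F : S → S} (hF : IsLifting 1 F) {X Z Y : Arc} {l' l : List Arc}
    (h₀ : Chain F X l' Z) (h₁ : Covers F Z Y) (h₂ : Covers F Y Y) (h₃ : Chain F Y l X)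
    (hZ : X.Disj Z) (hl' : ∀ W ∈ l', X.Disj W)
    (hY : X.Disj Y) (hl : ∀ W ∈ l, X.Disj W) {n : ℕ} (hn : l'.length + l.length + 3 ≤ n) :
    n ∈ Per F := by
  obtain ⟨j, rfl⟩ := Nat.exists_eq_add_of_le hn
  have := mem_Per_of_chain_of_disj hF (h₀.append (Chain.replicate h₁ h₂ h₃ j)) (by
    intro W hW
    rcases List.mem_append.1 hW with h | h
    · exact hl' W h
    rcases List.mem_cons.1 h with h | h
    · rw [h]; exact hZ
    rcases List.mem_append.1 h with h | h
    · rw [List.eq_of_mem_replicate h]; exact hY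
    · exact hl W h)
  convert this using 1
  simp
  ring

/-! ### Criteria for coverings -/

section Criteria

variable {F : S → S} {m : ℤ} {a b : ℝ} {h₁ : (m : ℝ) ≤ a} {h₂ : a ≤ b} {h₃ : b ≤ m + 1}
  {m' : ℤ} {a' b' : ℝ} {h₁' : (m' : ℝ) ≤ a'} {h₂' : a' ≤ b'} {h₃' : b' ≤ m' + 1}
  {s t : ℝ} {h₄ : 0 ≤ s} {h₅ : s ≤ t} {s' t' : ℝ} {h₄' : 0 ≤ s'} {h₅' : s' ≤ t'} {x y : ℝ}

theorem covers_re {X : Arc} (hab : a < b) (k : ℤ) (hx : x ∈ Set.Icc X.a X.b)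
    (hy : y ∈ Set.Icc X.a X.b) (hxa : re (F (X.e x)) ≤ a + k) (hyb : b + k ≤ re (F (X.e y))) :
    Covers F X (Arc.re m a b h₁ h₂ h₃) := by
  refine ⟨k, x, hx, y, hy, ?_, ?_⟩
  · show kap m _ ≤ a
    exact kap_le_of_re_le (by linarith) (by simp; linarith)
  · show b ≤ kap m _
    exact le_kap_of_le_re (by linarith) (by simp; linarith)

theorem covers_br {X : Arc} (k : ℤ) (hx : x ∈ Set.Icc X.a X.b) (hy : y ∈ Set.Icc X.a X.b)
    (hxa : eta k (F (X.e x)) ≤ s) (hyb : t ≤ eta k (F (X.e y))) :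
    Covers F X (Arc.br s t h₄ h₅) := by
  refine ⟨k, x, hx, y, hy, ?_, ?_⟩
  · simpa [Arc.br, eta_translate] using hxa
  · simpa [Arc.br, eta_translate] using hyb

theorem covers_re_re (hab : a' < b') (k : ℤ) (hx : a ≤ x) (hx' : x ≤ b) (hy : a ≤ y) (hy' : y ≤ b)
    (hxa : re (F (real x)) ≤ a' + k) (hyb : b' + k ≤ re (F (real y))) :
    Covers F (Arc.re m a b h₁ h₂ h₃) (Arc.re m' a' b' h₁' h₂' h₃') :=
  covers_re hab k ⟨hx, hx'⟩ ⟨hy, hy'⟩ hxa hyb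

theorem covers_br_re (hab : a' < b') (k : ℤ) (hx : s ≤ x) (hx' : x ≤ t) (hy : s ≤ y) (hy' : y ≤ t)
    (hxa : re (F (br x)) ≤ a' + k) (hyb : b' + k ≤ re (F (br y))) :
    Covers F (Arc.br s t h₄ h₅) (Arc.re m' a' b' h₁' h₂' h₃') :=
  covers_re hab k ⟨hx, hx'⟩ ⟨hy, hy'⟩ hxa hyb

theorem covers_re_br (k : ℤ) (hx : a ≤ x) (hx' : x ≤ b) (hy : a ≤ y) (hy' : y ≤ b)
    (hxa : eta k (F (real x)) ≤ s) (hyb : t ≤ eta k (F (real y))) :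
    Covers F (Arc.re m a b h₁ h₂ h₃) (Arc.br s t h₄ h₅) :=
  covers_br k ⟨hx, hx'⟩ ⟨hy, hy'⟩ hxa hyb

theorem covers_br_br (k : ℤ) (hx : s ≤ x) (hx' : x ≤ t) (hy : s ≤ y) (hy' : y ≤ t)
    (hxa : eta k (F (br x)) ≤ s') (hyb : t' ≤ eta k (F (br y))) :
    Covers F (Arc.br s t h₄ h₅) (Arc.br s' t' h₄' h₅') :=
  covers_br k ⟨hx, hx'⟩ ⟨hy, hy'⟩ hxa hyb

end Criteria

variable {F : S → S}

/-! ### Branches that cover themselves -/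

/-- If a point of height `b₁ < b` is mapped above the height `b`, while the points of heights `0`
and `b` are not mapped into the interior of the same branch, then the branch carries a
horseshoe. -/
theorem mem_Per_of_climb (hF : IsLifting 1 F) {b₁ b : ℝ} {j : ℤ} (h₀ : 0 ≤ b₁) (h₁ : b₁ < b)
    (hb : b ≤ 1) (hb₁ : b ≤ eta j (F (br b₁))) (hbj : eta j (F (br b)) ≤ 0)
    (h0j : eta j (F (br 0)) ≤ 0) {n : ℕ} (hn : 2 ≤ n) : n ∈ Per F := by
  have hpos : 0 < b₁ := by
    rcases h₀.eq_or_lt with h | h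
    · rw [← h] at hb₁ h₁; linarith
    · exact h
  have hc : Continuous fun t => eta j (F (br t)) :=
    (continuous_eta j).comp (hF.1.comp continuous_br)
  obtain ⟨d, hd, hdb⟩ := intermediate_value_Icc' h₁.le hc.continuousOn
    (⟨by linarith, by linarith⟩ : b₁ ∈ Set.Icc (eta j (F (br b))) (eta j (F (br b₁))))
  simp only at hdb
  have hdb₁ : b₁ < d := by
    refine lt_of_le_of_ne hd.1 fun h => ?_
    rw [← h] at hdb; linarith
  refine mem_Per_of_self hF (X := Arc.br d b (by linarith) hd.2) (Y := Arc.br 0 b₁ le_rfl h₀)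
    (l := []) ?_ ?_ ?_ (Arc.disj_br_br hdb₁ hb).symm (by simp) (by simpa using hn)
  · exact covers_br_br j (x := b) (y := d) hd.2 le_rfl le_rfl hd.2 hbj hdb.ge
  · exact covers_br_br j (x := 0) (y := b₁) le_rfl h₀ h₀ le_rfl h0j (by linarith)
  · exact covers_br_br j (x := 0) (y := b₁) le_rfl h₀ h₀ le_rfl (by linarith) (by linarith)

/-- The variant in which the point of height `0` may be mapped into the interior of the branch; a
real arc `G` that covers itself, together with the part of the branch below the image of the point
of height `0`, then replaces the missing part of the horseshoe. -/
theorem mem_Per_of_climb_of_hub (hF : IsLifting 1 F) {b₁ b : ℝ} {j : ℤ} (h₀ : 0 ≤ b₁) (h₁ : b₁ < b)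
    (hb : b ≤ 1) (hb₁ : b ≤ eta j (F (br b₁))) (hbj : eta j (F (br b)) < 0)
    {m : ℤ} {p q : ℝ} {hp hpq hq} (hGG : Covers F (Arc.re m p q hp hpq hq) (Arc.re m p q hp hpq hq))
    (hGB : ∀ s t hs hst, t ≤ eta j (F (br 0)) →
      Covers F (Arc.re m p q hp hpq hq) (Arc.br s t hs hst))
    (hBG : ∀ s hs hst, re (F (br s)) = j → Covers F (Arc.br s b hs hst) (Arc.re m p q hp hpq hq))
    {n : ℕ} (hn : 3 ≤ n) : n ∈ Per F := by
  have hc : Continuous fun t => eta j (F (br t)) :=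
    (continuous_eta j).comp (hF.1.comp continuous_br)
  -- `s` is the first height above `b₁` at which the image leaves the interior of the branch
  obtain ⟨s, ⟨hs, hs0⟩, hsmin⟩ := (isCompact_Icc.inter_right
    (isClosed_Iic.preimage hc : IsClosed ((fun t => eta j (F (br t))) ⁻¹' Set.Iic 0))).exists_isLeast
    (⟨b, ⟨h₁.le, le_rfl⟩, hbj.le⟩ :
      (Set.Icc b₁ b ∩ (fun t => eta j (F (br t))) ⁻¹' Set.Iic 0).Nonempty)
  simp only [Set.mem_preimage, Set.mem_Iic] at hs0
  have hs0' : eta j (F (br s)) = 0 := by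
    refine le_antisymm hs0 ?_
    by_contra! h
    obtain ⟨s', hs', e⟩ := intermediate_value_Icc' hs.1 hc.continuousOn
      (⟨h.le, by linarith⟩ : (0 : ℝ) ∈ Set.Icc (eta j (F (br s))) (eta j (F (br b₁))))
    have := hsmin ⟨⟨hs'.1, hs'.2.trans hs.2⟩, e.le⟩
    have : s' = s := le_antisymm hs'.2 this
    rw [this] at e
    exact h.ne e
  have hsb : s < b := by
    refine lt_of_le_of_ne hs.2 fun h => ?_
    rw [h] at hs0'; linarith
  obtain ⟨y, hy, hys⟩ := intermediate_value_Icc' hs.1 hc.continuousOn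
    (⟨by linarith [hs.1], by linarith⟩ : s ∈ Set.Icc (eta j (F (br s))) (eta j (F (br b₁))))
  simp only at hys
  have hyb : b₁ < y := by
    refine lt_of_le_of_ne hy.1 fun h => ?_
    rw [← h] at hys; linarith
  have hsy : y < s := by
    refine lt_of_le_of_ne hy.2 fun h => ?_
    rw [h] at hys; linarith
  rcases le_or_gt (eta j (F (br 0))) b₁ with hw | hw
  · refine mem_Per_of_self hF (X := Arc.br 0 b₁ le_rfl h₀) (Y := Arc.br y s (by linarith) hy.2)
      (l := []) ?_ ?_ ?_ (Arc.disj_br_br hyb (by linarith)) (by simp) (by simp; omega)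
    · exact covers_br_br j (x := 0) (y := b₁) le_rfl h₀ h₀ le_rfl (by linarith) (by linarith)
    · exact covers_br_br j (x := s) (y := y) hy.2 le_rfl le_rfl hy.2 (by linarith) (by linarith)
    · exact covers_br_br j (x := s) (y := y) hy.2 le_rfl le_rfl hy.2 (by linarith) (by linarith)
  have hTG := hBG s (by linarith) hsb.le (re_of_eta_nonneg hs0'.ge)
  rcases le_or_gt y (eta j (F (br 0))) with hwy | hwy
  · refine mem_Per_of_self hF (X := Arc.br s b (by linarith) hsb.le)
      (l := [Arc.br b₁ y h₀ hyb.le]) hTG hGG ⟨hGB _ _ _ _ hwy, ?_⟩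
      (Arc.disj_re_br (by linarith) hb).symm ?_ (by simpa using hn)
    · exact covers_br_br j (x := y) (y := b₁) hyb.le le_rfl le_rfl hyb.le (by linarith)
        (by linarith)
    · simp only [List.mem_singleton, forall_eq]
      exact (Arc.disj_br_br hsy hb).symm
  · refine mem_Per_of_self hF (X := Arc.br s b (by linarith) hsb.le)
      (l := [Arc.br 0 b₁ le_rfl h₀]) hTG hGG ⟨hGB _ _ _ _ hw.le, ?_⟩
      (Arc.disj_re_br (by linarith) hb).symm ?_ (by simpa using hn)
    · exact covers_br_br j (x := 0) (y := b₁) le_rfl h₀ h₀ le_rfl (by linarith)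
        (by linarith)
    · simp only [List.mem_singleton, forall_eq]
      exact (Arc.disj_br_br (by linarith) hb).symm

theorem one_mem_Per_of_climb (hF : IsLifting 1 F) {b₁ b : ℝ} {j : ℤ} (h₀ : 0 ≤ b₁) (h₁ : b₁ < b)
    (hb₁ : b ≤ eta j (F (br b₁))) (hbj : eta j (F (br b)) ≤ 0) : 1 ∈ Per F :=
  one_mem_Per hF (X := Arc.br b₁ b h₀ h₁.le)
    (covers_br_br j (x := b) (y := b₁) h₁.le le_rfl le_rfl h₁.le (by linarith) hb₁)

/-! ### Branches that cover a whole turn of the circuit -/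

/-- The list `X, Y, X, Y, …` of `r` pairs. -/
def alternate (X Y : Arc) : ℕ → List Arc
  | 0 => []
  | r + 1 => X :: Y :: alternate X Y r

theorem length_alternate (X Y : Arc) (r : ℕ) : (alternate X Y r).length = 2 * r := by
  induction r with
  | zero => rfl
  | succ r ih => simp [alternate, ih]; ring

theorem mem_alternate {X Y Z : Arc} {r : ℕ} (h : Z ∈ alternate X Y r) : Z = X ∨ Z = Y := by
  induction r with
  | zero => simp [alternate] at h
  | succ r ih =>
    simp only [alternate, List.mem_cons] at h
    tauto

theorem chain_alternate {X Y Z : Arc} (hYX : Covers F Y X) (hXY : Covers F X Y)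
    (hYZ : Covers F Y Z) (r : ℕ) : Chain F Y (alternate X Y r) Z := by
  induction r with
  | zero => exact hYZ
  | succ r ih => exact ⟨hYX, hXY, ih⟩

/-- If some real point is mapped onto a branch above the height `b`, and the part of the branch
below `b` covers a cell `[c, c + 1]`, then all periods `n ≥ 2` occur.  Near the real point there are
two real arcs covering the branch, and an arc of the cell leads back to one of them. -/
theorem mem_Per_of_wrap (hF : IsLifting 1 F) {b : ℝ} (hb : b ≤ 1) {x : ℝ}
    (hx : b ≤ im (F (real x))) {c : ℤ} {s₁ s₂ : ℝ} (h₁ : 0 < s₁) (h₁' : s₁ ≤ b) (h₂ : 0 < s₂)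
    (h₂' : s₂ ≤ b) (hs₁ : re (F (br s₁)) ≤ c) (hs₂ : (c : ℝ) + 1 ≤ re (F (br s₂)))
    {n : ℕ} (hn : 2 ≤ n) : n ∈ Per F := by
  have hkc : Continuous fun t => kap c (F (br t)) :=
    (continuous_kap c).comp (hF.1.comp continuous_br)
  -- the two heights may be chosen so that their images are exactly `c` and `c + 1`
  obtain ⟨σ, τ, hσ, hστ, hτ, u, w, hu, hw, hu', hw', hFτ⟩ : ∃ σ τ, 0 < σ ∧ σ < τ ∧ τ ≤ b ∧
      ∃ u w, u ∈ Set.Icc σ τ ∧ w ∈ Set.Icc σ τ ∧ F (br u) = real c ∧ F (br w) = real (c + 1) ∧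
      ∃ i : ℤ, F (br τ) = real i := by
    have k1 : kap c (F (br s₁)) ≤ c := kap_le_of_re_le (by linarith) hs₁
    have k2 : (c : ℝ) + 1 ≤ kap c (F (br s₂)) := le_kap_of_le_re (by linarith) hs₂
    have hsub : Set.Icc (c : ℝ) (c + 1) ⊆ (fun t => kap c (F (br t))) '' Set.uIcc s₁ s₂ :=
      (Set.Icc_subset_uIcc.trans' (Set.Icc_subset_Icc k1 k2)).trans
        (intermediate_value_uIcc hkc.continuousOn)
    have hpos : ∀ t ∈ Set.uIcc s₁ s₂, 0 < t ∧ t ≤ b := fun t ht =>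
      ⟨lt_of_lt_of_le (lt_min h₁ h₂) ht.1, ht.2.trans (max_le h₁' h₂')⟩
    obtain ⟨u, hu, eu⟩ := hsub ⟨le_rfl, by linarith⟩
    obtain ⟨w, hw, ew⟩ := hsub ⟨by linarith, le_rfl⟩
    simp only at eu ew
    have eu' : F (br u) = real c := by
      have := eq_real_kap (m := c) (z := F (br u)) (by rw [eu]) (by rw [eu]; linarith)
      rw [← this, eu]
    have ew' : F (br w) = real (c + 1) := by
      have := eq_real_kap (m := c) (z := F (br w)) (by rw [ew]; linarith) (by rw [ew])
      rw [← this, ew]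
    have hne : u ≠ w := by
      rintro rfl
      rw [eu] at ew; linarith
    rcases lt_or_gt_of_ne hne with h | h
    · exact ⟨u, w, (hpos u hu).1, h, (hpos w hw).2, u, w, ⟨le_rfl, h.le⟩, ⟨h.le, le_rfl⟩, eu', ew',
        c + 1, by rw [ew']; push_cast; rfl⟩
    · exact ⟨w, u, (hpos w hw).1, h, (hpos u hu).2, u, w, ⟨h.le, le_rfl⟩, ⟨le_rfl, h.le⟩, eu', ew',
        c, eu'⟩
  obtain ⟨i₀, hFτ⟩ := hFτ
  have hτ1 : τ ≤ 1 := hτ.trans hb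
  set B : Arc := Arc.br σ τ hσ.le hστ.le with hB
  have hBre : ∀ (m : ℤ) (a a' : ℝ) (h h' h''), a < a' → Covers F B (Arc.re m a a' h h' h'') := by
    intro m a a' h h' h'' haa
    refine covers_br_re haa (c - m) hu.1 hu.2 hw.1 hw.2 ?_ ?_
    · rw [hu']; push_cast; simp; linarith
    · rw [hw']; push_cast; simp; linarith
  have hdisj : ∀ (m : ℤ) (a a' : ℝ) (h h' h''), B.Disj (Arc.re m a a' h h' h'') := fun _ _ _ _ _ _ =>
    (Arc.disj_re_br hσ hτ1).symm
  obtain ⟨k, hk⟩ := exists_re_eq_of_im_pos (by linarith : 0 < im (F (real x)))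
  have hec : Continuous fun y => eta k (F (real y)) :=
    (continuous_eta k).comp (hF.1.comp continuous_real)
  have hxe : τ ≤ eta k (F (real x)) := by rw [eta_of_re hk]; linarith
  have hclosed : IsClosed ((fun y => eta k (F (real y))) ⁻¹' Set.Iic 0) :=
    isClosed_Iic.preimage hec
  have hsub : re (F (real (x - 1))) = k - 1 := by
    have := hF.re_real_add (-1) x
    push_cast at this
    rw [← sub_eq_add_neg, ← sub_eq_add_neg] at this
    rw [this, hk]
  have hadd : re (F (real (x + 1))) = k + 1 := by
    have := hF.re_real_add 1 x
    push_cast at this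
    rw [this, hk]
  -- the nearest points on either side of `x` that are mapped to the base of the branch
  obtain ⟨x', ⟨hx', hx'0⟩, hmax⟩ := (isCompact_Icc.inter_right hclosed).exists_isGreatest
    (⟨x - 1, ⟨le_rfl, by linarith⟩, (eta_neg_of_re_ne (by rw [hsub]; linarith)).le⟩ :
      (Set.Icc (x - 1) x ∩ (fun y => eta k (F (real y))) ⁻¹' Set.Iic 0).Nonempty)
  obtain ⟨x'', ⟨hx'', hx''0⟩, hmin⟩ := (isCompact_Icc.inter_right hclosed).exists_isLeast
    (⟨x + 1, ⟨by linarith, le_rfl⟩, (eta_neg_of_re_ne (by rw [hadd]; linarith)).le⟩ :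
      (Set.Icc x (x + 1) ∩ (fun y => eta k (F (real y))) ⁻¹' Set.Iic 0).Nonempty)
  simp only [Set.mem_preimage, Set.mem_Iic] at hx'0 hx''0
  have hx'e : eta k (F (real x')) = 0 := by
    refine le_antisymm hx'0 ?_
    obtain ⟨y, hy, e⟩ := intermediate_value_Icc hx'.2 hec.continuousOn
      (⟨hx'0, by linarith⟩ : (0 : ℝ) ∈ Set.Icc (eta k (F (real x'))) (eta k (F (real x))))
    have h3 := hmax ⟨⟨hx'.1.trans hy.1, hy.2⟩, e.le⟩
    rw [← le_antisymm h3 hy.1]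
    exact e.ge
  have hx''e : eta k (F (real x'')) = 0 := by
    refine le_antisymm hx''0 ?_
    obtain ⟨y, hy, e⟩ := intermediate_value_Icc' hx''.1 hec.continuousOn
      (⟨hx''0, by linarith⟩ : (0 : ℝ) ∈ Set.Icc (eta k (F (real x''))) (eta k (F (real x))))
    have h3 := hmin ⟨⟨hy.1, hy.2.trans hx''.2⟩, e.le⟩
    rw [← le_antisymm hy.2 h3]
    exact e.ge
  have hre : ∀ y, x' ≤ y → y ≤ x'' → re (F (real y)) = k := by
    intro y h h'
    apply re_of_eta_nonneg
    by_contra! hneg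
    rcases le_total y x with hyx | hyx
    · have := hmax ⟨⟨hx'.1.trans h, hyx⟩, hneg.le⟩
      rw [le_antisymm this h, hx'e] at hneg
      exact hneg.false
    · have := hmin ⟨⟨hyx, h'.trans hx''.2⟩, hneg.le⟩
      rw [le_antisymm h' this, hx''e] at hneg
      exact hneg.false
  have hx'x : x' < x := by
    refine lt_of_le_of_ne hx'.2 fun h => ?_
    rw [h] at hx'e; linarith
  have hxx'' : x < x'' := by
    refine lt_of_le_of_ne hx''.1 fun h => ?_
    rw [← h] at hx''e; linarith
  have hlen : x'' < x' + 1 := by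
    by_contra! h
    have h1 := hre (x' + 1) (by linarith) h
    have h2 := hF.re_real_add 1 x'
    rw [Int.cast_one, h1, hre x' le_rfl (by linarith)] at h2
    norm_num at h2
  have hJ₁ : ∀ (m : ℤ) (h h''), Covers F (Arc.re m x' x h hx'x.le h'') B := fun m h h'' =>
    covers_re_br k (x := x') (y := x) le_rfl hx'x.le hx'x.le le_rfl (by linarith) hxe
  have hJ₂ : ∀ (m : ℤ) (h h''), Covers F (Arc.re m x x'' h hxx''.le h'') B := fun m h h'' =>
    covers_re_br k (x := x'') (y := x) hxx''.le le_rfl le_rfl hxx''.le (by linarith) hxe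
  -- a real arc that covers itself and leads to the branch yields all periods
  have key : ∀ (m : ℤ) (a a' : ℝ) (h h' h'') (d d' : ℝ) (g g' g''), a < a' → d < d' →
      Covers F (Arc.re m a a' h h' h'') (Arc.re m a a' h h' h'') →
      Covers F (Arc.re m a a' h h' h'') (Arc.re m d d' g g' g'') →
      Covers F (Arc.re m d d' g g' g'') B → n ∈ Per F := by
    intro m a a' h h' h'' d d' g g' g'' ha hd c1 c2 c3
    rcases hn.eq_or_lt with rfl | hn
    · exact mem_Per_of_chain_of_disj hF (X := B) (l := [Arc.re m d d' g g' g''])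
        ⟨hBre _ _ _ _ _ _ hd, c3⟩ (by simpa using hdisj _ _ _ _ _ _)
    · exact mem_Per_of_self hF (X := B) (l := [Arc.re m d d' g g' g''])
        (hBre _ _ _ _ _ _ ha) c1 ⟨c2, c3⟩ (hdisj _ _ _ _ _ _) (by simpa using hdisj _ _ _ _ _ _)
        (by simp; omega)
  set m : ℤ := ⌊x⌋ with hm
  have hmx : (m : ℝ) ≤ x := Int.floor_le x
  have hxm : x < m + 1 := Int.lt_floor_add_one x
  have hm1 : re (F (real (m + 1))) = re (F (real m)) + 1 := by
    have := hF.re_real_add 1 m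
    push_cast at this
    exact this
  have hFx' := hre x' le_rfl (by linarith)
  have hFx'' := hre x'' (by linarith) le_rfl
  rcases lt_or_ge x' m with hA | hA
  · have hFm := hre m hA.le (by linarith)
    have h' : x'' < m + 1 := by linarith
    refine key m x'' (m + 1) (by linarith) h'.le le_rfl x x'' hmx hxx''.le h'.le h' hxx'' ?_ ?_
      (hJ₂ _ _ _)
    · refine covers_re_re h' (k - m) (x := x'') (y := m + 1) le_rfl h'.le h'.le le_rfl ?_ ?_
      · push_cast; linarith
      · push_cast; linarith
    · refine covers_re_re hxx'' (k - m) (x := x'') (y := m + 1) le_rfl h'.le h'.le le_rfl ?_ ?_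
      · push_cast; linarith
      · push_cast; linarith
  rcases lt_or_ge ((m : ℝ) + 1) x'' with hB' | hB'
  · have hFm := hre (m + 1) (by linarith) hB'.le
    have h' : (m : ℝ) < x' := by linarith
    refine key m m x' le_rfl h'.le (by linarith) x' x hA hx'x.le hxm.le h' hx'x ?_ ?_ (hJ₁ _ _ _)
    · refine covers_re_re h' (k - 1 - m) (x := m) (y := x') le_rfl h'.le h'.le le_rfl ?_ ?_
      · push_cast; linarith
      · push_cast; linarith
    · refine covers_re_re hx'x (k - 1 - m) (x := m) (y := x') le_rfl h'.le h'.le le_rfl ?_ ?_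
      · push_cast; linarith
      · push_cast; linarith
  rcases le_or_gt (re (F (real m))) (k - 1) with hC | hC
  · have h' : (m : ℝ) < x' := by
      refine lt_of_le_of_ne hA fun h => ?_
      rw [h, hFx'] at hC; linarith
    refine key m m x' le_rfl h'.le (by linarith) x' x hA hx'x.le hxm.le h' hx'x ?_ ?_ (hJ₁ _ _ _)
    · refine covers_re_re h' (k - 1 - m) (x := m) (y := x') le_rfl h'.le h'.le le_rfl ?_ ?_
      · push_cast; linarith
      · push_cast; linarith
    · refine covers_re_re hx'x (k - 1 - m) (x := m) (y := x') le_rfl h'.le h'.le le_rfl ?_ ?_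
      · push_cast; linarith
      · push_cast; linarith
  rcases le_or_gt (k : ℝ) (re (F (real m))) with hD | hD
  · have h' : x'' < m + 1 := by
      refine lt_of_le_of_ne hB' fun h => ?_
      rw [← h, hFx''] at hm1; linarith
    refine key m x'' (m + 1) (by linarith) h'.le le_rfl x x'' hmx hxx''.le h'.le h' hxx'' ?_ ?_
      (hJ₂ _ _ _)
    · refine covers_re_re h' (k - m) (x := x'') (y := m + 1) le_rfl h'.le h'.le le_rfl ?_ ?_
      · push_cast; linarith
      · push_cast; linarith
    · refine covers_re_re hxx'' (k - m) (x := x'') (y := m + 1) le_rfl h'.le h'.le le_rfl ?_ ?_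
      · push_cast; linarith
      · push_cast; linarith
  -- now neither of the arcs `[m, x']` and `[x'', m + 1]` needs to cover itself
  have hmx' : (m : ℝ) < x' := by
    refine lt_of_le_of_ne hA fun h => ?_
    rw [h, hFx'] at hD; linarith
  have hx''m : x'' < m + 1 := by
    refine lt_of_le_of_ne hB' fun h => ?_
    rw [← h, hFx''] at hm1; linarith
  set J₁ := Arc.re m x' x hA hx'x.le hxm.le with hJ₁def
  set J₂ := Arc.re m x x'' hmx hxx''.le hB' with hJ₂def
  have hBJ₁ : Covers F B J₁ := hBre _ _ _ _ _ _ hx'x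
  have hBJ₂ : Covers F B J₂ := hBre _ _ _ _ _ _ hxx''
  obtain ⟨r, hr⟩ := Nat.even_or_odd' n
  rcases hr with rfl | rfl
  · have hmem := mem_Per_of_chain hF (X := J₁) (l := B :: alternate J₂ B (r - 1))
      ⟨hJ₁ _ _ _, chain_alternate hBJ₂ (hJ₂ _ _ _) hBJ₁ _⟩ ?_
    · rw [List.length_cons, length_alternate] at hmem
      convert hmem using 1
      omega
    intro z hz Y hY hYz
    rcases List.mem_cons.1 hY with rfl | hY
    · exact (hdisj _ _ _ _ _ _).symm z hz.1 hYz
    have hr : r - 1 ≠ 0 := by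
      intro h; rw [h] at hY; simp [alternate] at hY
    rcases mem_alternate hY with rfl | rfl
    · -- the common endpoint `x` of `J₁` and `J₂` is mapped to an integer by `F^2`
      obtain ⟨hz0, i, hi, hi'⟩ := Arc.has_re hz.1
      obtain ⟨-, l, hl, hl'⟩ := Arc.has_re hYz
      have e1 : (l : ℝ) < i + 1 := by linarith
      have e2 : (i : ℝ) < l + 1 := by linarith
      have e1 : l < i + 1 := by exact_mod_cast e1
      have e2 : i < l + 1 := by exact_mod_cast e2
      obtain rfl : i = l := by omega
      have hzx : real x = translate i z := by
        refine ext_re_im ?_ (by simp [hz0])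
        rw [re_translate]; exact le_antisymm hl hi'
      have hFz : translate i (F z) = F (real x) := by rw [hzx, hF.apply_translate]
      have h2 := (Arc.has_br hτ1 hz.2.1).2
      have h3 : im (F z) = im (F (real x)) := by rw [← hFz, im_translate]
      have h4 : im (F (real x)) = τ := le_antisymm (h3 ▸ h2) (hτ.trans hx)
      have h5 : F (real x) = translate k (br τ) := by rw [eq_translate_br hk, h4]
      obtain ⟨r', hr'⟩ := Nat.exists_eq_succ_of_ne_zero hr
      rw [hr'] at hz
      have h6 : J₂.Has (F (F z)) := hz.2.2.1
      have h7 : F (F z) = translate (-i) (translate k (real i₀)) := by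
        rw [← hFτ, ← hF.apply_translate k, ← hF.apply_translate (-i), ← h5, ← hFz]
        simp
      rw [h7, Arc.has_translate, Arc.has_translate] at h6
      obtain ⟨-, q, hq, hq'⟩ := Arc.has_re h6
      rw [re_real] at hq hq'
      have e1 : (m : ℝ) < i₀ + q := by linarith
      have e2 : (i₀ + q : ℝ) < m + 1 := by linarith
      have e1 : m < i₀ + q := by exact_mod_cast e1
      have e2 : i₀ + q < m + 1 := by exact_mod_cast e2
      omega
    · exact (hdisj _ _ _ _ _ _).symm z hz.1 hYz
  · have hodd : ∀ (K J : Arc), Covers F K J → Covers F J B → Covers F B J → Covers F B K →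
        K.Disj J → K.Disj B → 2 * r + 1 ∈ Per F := by
      intro K J c1 c2 c3 c4 d1 d2
      have hmem := mem_Per_of_chain_of_disj hF (X := K) (l := J :: B :: alternate J B (r - 1))
        ⟨c1, c2, chain_alternate c3 c2 c4 _⟩ ?_
      · simp only [List.length_cons, length_alternate] at hmem
        convert hmem using 1
        omega
      · intro Y hY
        simp only [List.mem_cons] at hY
        rcases hY with rfl | rfl | hY
        · exact d1
        · exact d2
        · rcases mem_alternate hY with rfl | rfl
          · exact d1
          · exact d2
    rcases le_total (re (F (real m))) (x + (k - 1 - m)) with he | he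
    · refine hodd (Arc.re m m x' le_rfl hmx'.le (by linarith)) J₂ ?_ (hJ₂ _ _ _) hBJ₂
        (hBre _ _ _ _ _ _ hmx') (Arc.disj_re_re hx'x hx''m) (hdisj _ _ _ _ _ _).symm
      refine covers_re_re hxx'' (k - 1 - m) (x := m) (y := x') le_rfl hmx'.le hmx'.le le_rfl ?_ ?_
      · push_cast; linarith
      · push_cast; linarith
    · refine hodd (Arc.re m x'' (m + 1) (by linarith) hx''m.le le_rfl) J₁ ?_ (hJ₁ _ _ _) hBJ₁
        (hBre _ _ _ _ _ _ hx''m) (Arc.disj_re_re hxx'' (by linarith)).symm (hdisj _ _ _ _ _ _).symm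
      refine covers_re_re hx'x (k - m) (x := x'') (y := m + 1) le_rfl hx''m.le hx''m.le le_rfl ?_ ?_
      · push_cast; linarith
      · push_cast; linarith

/-! ### Reflection -/

/-- The reflection `z ↦ -conj z` of `S`. -/
def refl (z : S) : S := mk (-re z) (im z) (by
  rcases (im_nonneg z).eq_or_lt with h | h
  · exact Or.inl h.symm
  · obtain ⟨m, hm⟩ := exists_re_eq_of_im_pos h
    exact Or.inr ⟨⟨-m, by simp [hm]⟩, im_nonneg z, im_le_one z⟩)

@[simp] theorem re_refl (z : S) : re (refl z) = -re z := rfl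
@[simp] theorem im_refl (z : S) : im (refl z) = im z := rfl
@[simp] theorem refl_refl (z : S) : refl (refl z) = z := ext_re_im (by simp) (by simp)
@[simp] theorem refl_real (x : ℝ) : refl (real x) = real (-x) := ext_re_im (by simp) (by simp)
@[simp] theorem refl_br (t : ℝ) : refl (br t) = br t := ext_re_im (by simp) (by simp)

theorem refl_translate (k : ℤ) (z : S) : refl (translate k z) = translate (-k) (refl z) :=
  ext_re_im (by simp; ring) (by simp)

theorem continuous_refl : Continuous refl :=
  continuous_mk continuous_re.neg continuous_im _

/-- The conjugate of a map by the reflection. -/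
def reflect (F : S → S) (z : S) : S := refl (F (refl z))

@[simp] theorem reflect_real (F : S → S) (x : ℝ) : reflect F (real x) = refl (F (real (-x))) := by
  simp [reflect]

@[simp] theorem reflect_br (F : S → S) (t : ℝ) : reflect F (br t) = refl (F (br t)) := by
  simp [reflect]

theorem reflect_reflect (F : S → S) : reflect (reflect F) = F := by
  funext z; simp [reflect]

theorem iterate_reflect (F : S → S) (n : ℕ) (z : S) : (reflect F)^[n] z = refl (F^[n] (refl z)) := by
  induction n generalizing z with
  | zero => simp
  | succ n ih => rw [Function.iterate_succ_apply, ih, Function.iterate_succ_apply]; simp [reflect]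

theorem IsLifting.reflect (hF : IsLifting 1 F) : IsLifting 1 (reflect F) := by
  refine ⟨continuous_refl.comp (hF.1.comp continuous_refl), fun z => ?_⟩
  simp only [SigmaMap.reflect, refl_translate, hF.apply_translate, neg_neg]

theorem Per_reflect_subset (F : S → S) : Per (reflect F) ⊆ Per F := by
  rintro n ⟨z, h⟩
  refine ⟨refl z, ?_⟩
  have : {i : ℕ | 0 < i ∧ ∃ k : ℤ, F^[i] (refl z) = translate k (refl z)} =
      {i : ℕ | 0 < i ∧ ∃ k : ℤ, (reflect F)^[i] z = translate k z} := by
    ext i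
    simp only [Set.mem_ofPred_eq, iterate_reflect]
    refine and_congr_right fun _ => ⟨?_, ?_⟩
    · rintro ⟨k, hk⟩
      exact ⟨-k, by rw [hk, refl_translate, refl_refl]⟩
    · rintro ⟨k, hk⟩
      refine ⟨-k, ?_⟩
      rw [← refl_refl (F^[i] (refl z)), hk, refl_translate]
  unfold HasPeriodMod1
  rw [this]
  exact h

theorem Per_reflect (F : S → S) : Per (reflect F) = Per F :=
  (Per_reflect_subset F).antisymm (by
    have := Per_reflect_subset (reflect F)
    rwa [reflect_reflect] at this)

/-! ### Unbounded orbits -/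

/-- Some real point has an orbit whose real parts are unbounded above. -/
def Up (F : S → S) : Prop := ∃ x : ℝ, ∀ C : ℝ, ∃ n : ℕ, C < re (F^[n] (real x))

/-- The periods that all the maps under consideration have: all periods except possibly `1`, or all
periods except possibly `2`. -/
def ManyPeriods (F : S → S) : Prop :=
  (∀ n, 2 ≤ n → n ∈ Per F) ∨ (1 ∈ Per F ∧ ∀ n, 3 ≤ n → n ∈ Per F)

theorem manyPeriods_reflect : ManyPeriods (reflect F) ↔ ManyPeriods F := by
  simp only [ManyPeriods, Per_reflect]

/-- An orbit that is unbounded above leaves every set that is bounded above and contains a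
translate of its starting point. -/
theorem Up.exists_exit (hF : IsLifting 1 F) (h : Up F) {Z : Set S} {C : ℝ} (hC : ∀ z ∈ Z, re z ≤ C)
    (hZ : ∀ x : ℝ, ∃ k : ℤ, real (x + k) ∈ Z) : ∃ z ∈ Z, F z ∉ Z := by
  obtain ⟨x, hx⟩ := h
  obtain ⟨k, hk⟩ := hZ x
  by_contra! hcon
  have hall : ∀ n, F^[n] (real (x + k)) ∈ Z := by
    intro n
    induction n with
    | zero => exact hk
    | succ n ih => rw [Function.iterate_succ_apply']; exact hcon _ ih
  obtain ⟨n, hn⟩ := hx (C - k)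
  have := hC _ (hall n)
  rw [← translate_real, hF.iterate_translate, re_translate] at this
  linarith

theorem continuous_re_br (hF : IsLifting 1 F) : Continuous fun t => re (F (br t)) :=
  continuous_re.comp (hF.1.comp continuous_br)

theorem continuous_re_real (hF : IsLifting 1 F) : Continuous fun x => re (F (real x)) :=
  continuous_re.comp (hF.1.comp continuous_real)

theorem exists_height_re_lt (hF : IsLifting 1 F) {c b : ℝ} (h : re (F (real 0)) < c) (hb : 0 < b) :
    ∃ t, 0 < t ∧ t < b ∧ re (F (br t)) < c := by
  have h0 : re (F (br 0)) < c := by rwa [br_zero]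
  have h1 : ∀ᶠ t in 𝓝[>] (0 : ℝ), re (F (br t)) < c :=
    ((continuous_re_br hF).continuousAt.eventually_lt continuousAt_const h0).filter_mono
      nhdsWithin_le_nhds
  obtain ⟨t, ht, ht'⟩ := (h1.and (Ioo_mem_nhdsGT hb)).exists
  exact ⟨t, ht'.1, ht'.2, ht⟩

/-- The first height at which the branch over `0` is mapped to the right of a point `c` of
`(0, 1]`. -/
theorem exists_first_height (hF : IsLifting 1 F) {c : ℝ} (hc : 0 < c) (hc' : c ≤ 1)
    (h0 : re (F (real 0)) < c) (h : ∃ t, 0 ≤ t ∧ t ≤ 1 ∧ c ≤ re (F (br t))) :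
    ∃ b, 0 < b ∧ b ≤ 1 ∧ F (br b) = real c ∧ ∀ t, 0 ≤ t → t < b → re (F (br t)) < c := by
  have hcont : Continuous fun t => kap 0 (F (br t)) :=
    (continuous_kap 0).comp (hF.1.comp continuous_br)
  have hc0 : ((0 : ℤ) : ℝ) < c := by simpa using hc
  have hiff : ∀ z, c ≤ kap 0 z ↔ c ≤ re z := fun z =>
    ⟨fun h => not_lt.1 fun h' => by
      rcases (im_nonneg z).eq_or_lt with hz | hz
      · rw [kap_of_im 0 hz.symm] at h; linarith
      · obtain ⟨j, hj⟩ := exists_re_eq_of_im_pos hz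
        have : (j : ℝ) < 1 := by linarith
        have : j < 1 := by exact_mod_cast this
        have h1 : (j : ℝ) ≤ 0 := by exact_mod_cast (by omega : j ≤ 0)
        rw [kap_of_le hj (by omega)] at h
        linarith, le_kap_of_le_re hc0⟩
  obtain ⟨t₁, ht₁, ht₁', hct⟩ := h
  obtain ⟨b, ⟨hb, hbc⟩, hmin⟩ := (isCompact_Icc.inter_right
    (isClosed_Ici.preimage hcont : IsClosed ((fun t => kap 0 (F (br t))) ⁻¹' Set.Ici c))).exists_isLeast
    (⟨t₁, ⟨ht₁, ht₁'⟩, (hiff _).2 hct⟩ : (Set.Icc (0 : ℝ) 1 ∩ _).Nonempty)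
  simp only [Set.mem_preimage, Set.mem_Ici] at hbc
  have h0' : kap 0 (F (br 0)) < c := by
    rw [br_zero]
    by_contra! h
    exact absurd ((hiff _).1 h) (not_le.2 h0)
  have hb0 : 0 < b := by
    refine lt_of_le_of_ne hb.1 fun h => ?_
    rw [← h] at hbc; linarith
  have heq : kap 0 (F (br b)) = c := by
    obtain ⟨s, hs, e⟩ := intermediate_value_Icc hb.1 hcont.continuousOn (⟨h0'.le, hbc⟩ :
      c ∈ Set.Icc (kap 0 (F (br 0))) (kap 0 (F (br b))))
    have := hmin ⟨⟨hs.1, hs.2.trans hb.2⟩, e.ge⟩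
    rw [← le_antisymm hs.2 this]; exact e
  refine ⟨b, hb0, hb.2, ?_, fun t ht htb => ?_⟩
  · rw [← heq, eq_real_kap (m := 0)] <;> rw [heq] <;> push_cast <;> linarith
  · by_contra! h
    have := hmin ⟨⟨ht, htb.le.trans hb.2⟩, (hiff _).2 h⟩
    linarith

/-- The case in which all real points are moved to the left. -/
theorem manyPeriods_of_forall_lt (hF : IsLifting 1 F) (hU : Up F)
    (h : ∀ x, re (F (real x)) < x) : ManyPeriods F := by
  by_cases hex : ∃ t, 0 ≤ t ∧ t ≤ 1 ∧ 1 ≤ re (F (br t))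
  · obtain ⟨b, hb0, hb1, hFb, hlt⟩ := exists_first_height hF one_pos le_rfl
      ((h 0).trans one_pos) hex
    have hmem : ∀ x : ℝ, ∃ k : ℤ, real (x + k) ∈ {z : S | re z < 1 ∧ im z < b} := fun x =>
      ⟨-⌊x⌋, by
        have := Int.lt_floor_add_one x
        simp only [Set.mem_ofPred_eq, re_real, im_real]
        push_cast
        exact ⟨by linarith, hb0⟩⟩
    obtain ⟨z, ⟨hz, hzb⟩, hFz⟩ := hU.exists_exit hF (fun z hz => hz.1.le) hmem
    rcases (im_nonneg z).eq_or_lt with hi | hi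
    · have hzr := eq_real hi.symm
      have h1 := h (re z)
      rw [← hzr] at h1
      have h2 : b ≤ im (F (real (re z))) := by
        rw [← hzr]
        by_contra! h2
        exact hFz ⟨h1.trans hz, h2⟩
      obtain ⟨t, ht, htb, hFt⟩ := exists_height_re_lt hF (h 0) hb0
      exact Or.inl fun n hn => mem_Per_of_wrap hF hb1 h2 (c := 0) ht htb.le hb0 le_rfl
        (by simpa using hFt.le) (by simp [hFb]) hn
    · obtain ⟨k, hk⟩ := exists_re_eq_of_im_pos hi
      have hzk := eq_translate_br hk
      have hk0 : k ≤ 0 := by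
        have : (k : ℝ) < 1 := by rw [← hk]; exact hz
        have : k < 1 := by exact_mod_cast this
        omega
      have h1 := hlt (im z) hi.le hzb
      have h2 : b ≤ im (F (br (im z))) := by
        by_contra! h2
        apply hFz
        rw [hzk, hF.apply_translate]
        refine ⟨?_, by simpa using h2⟩
        have : (k : ℝ) ≤ 0 := by exact_mod_cast hk0
        rw [re_translate]
        linarith
      obtain ⟨j, hj⟩ := exists_re_eq_of_im_pos (lt_of_lt_of_le hb0 h2)
      have hj0 : j ≤ 0 := by
        have : (j : ℝ) < 1 := by rw [← hj]; exact h1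
        have : j < 1 := by exact_mod_cast this
        omega
      have hj0' : (j : ℝ) ≤ 0 := by exact_mod_cast hj0
      have h3 : b ≤ eta j (F (br (im z))) := by rwa [eta_of_re hj]
      have h4 : eta j (F (br b)) < 0 := eta_neg_of_re_ne (by rw [hFb, re_real]; linarith)
      rcases le_or_gt (eta j (F (br 0))) 0 with h5 | h5
      · exact Or.inl fun n hn => mem_Per_of_climb hF hi.le hzb hb1 h3 h4.le h5 hn
      · have h6 : re (F (real 0)) = j := by rw [← br_zero]; exact re_of_eta_nonneg h5.le
        have h7 : re (F (real 1)) = j + 1 := by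
          have := hF.re_real_add 1 0
          simpa [h6] using this
        refine Or.inr ⟨one_mem_Per_of_climb hF hi.le hzb h3 h4.le, fun n hn =>
          mem_Per_of_climb_of_hub hF hi.le hzb hb1 h3 h4 (m := 0) (p := 0) (q := 1) (hp := by simp)
            (hpq := zero_le_one) (hq := by simp) ?_ ?_ ?_ hn⟩
        · exact covers_re_re one_pos j le_rfl zero_le_one zero_le_one le_rfl (by simp [h6])
            (by rw [h7]; linarith)
        · intro s t hs hst ht
          refine covers_re_br j (x := 1) (y := 0) zero_le_one le_rfl le_rfl zero_le_one ?_ ?_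
          · exact (eta_neg_of_re_ne (by rw [h7]; simp)).le.trans hs
          · rwa [← br_zero]
        · intro s hs hst hsj
          refine covers_br_re one_pos j (x := s) (y := b) le_rfl hst hst le_rfl ?_ ?_
          · rw [hsj]; simp
          · rw [hFb, re_real]; linarith
  · push Not at hex
    exfalso
    obtain ⟨z, hz, hFz⟩ := hU.exists_exit hF (Z := {z | re z < 1}) (C := 1) (fun z hz => le_of_lt hz)
      (fun x => ⟨-⌊x⌋, by
        have := Int.lt_floor_add_one x
        simp only [Set.mem_ofPred_eq, re_real]
        push_cast
        linarith⟩)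
    apply hFz
    simp only [Set.mem_ofPred_eq] at hz ⊢
    rcases (im_nonneg z).eq_or_lt with hi | hi
    · have h1 := h (re z)
      rw [← eq_real hi.symm] at h1
      exact h1.trans hz
    · obtain ⟨k, hk⟩ := exists_re_eq_of_im_pos hi
      have h1 := hex (im z) hi.le (im_le_one z)
      rw [eq_translate_br hk, hF.apply_translate, re_translate]
      have : (k : ℝ) < 1 := by rw [← hk]; exact hz
      have : k < 1 := by exact_mod_cast this
      have : (k : ℝ) ≤ 0 := by exact_mod_cast (by omega : k ≤ 0)
      linarith

/-! ### Frames of fixed points -/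

/-- The position of the real fixed points around the branch over `0`, for a map with such points:
`p₁ ≤ 0 ≤ p₂` are fixed points with no fixed point of the map in between, or both are `0`.  In the
interval `[p₂, p₁ + 1]`, `v` is the last point that is mapped to `p₂`, and `u` is the first point
that is mapped to `p₁ + 1`; `zp` and `zm` are the first and the last fixed point in `[v, u]`.

The fields `mid`, `lt_v` and `u_lt` say that `[v, u]` is mapped into `[p₂, p₁ + 1]`, and that there is
no horseshoe in `[p₂, v]` or `[u, p₁ + 1]`. The last four fields say in which direction the points of
`[p₁, 0]` and `[0, p₂]` are moved, according to the real part of the image of `0`. -/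
structure Frame (F : S → S) where
  /-- the fixed point on the left of `0` -/
  p₁ : ℝ
  /-- the fixed point on the right of `0` -/
  p₂ : ℝ
  /-- the last point mapped to `p₂` -/
  v : ℝ
  /-- the first point mapped to `p₁ + 1` -/
  u : ℝ
  /-- the first fixed point in `[v, u]` -/
  zp : ℝ
  /-- the last fixed point in `[v, u]` -/
  zm : ℝ
  p₁_nonpos : p₁ ≤ 0
  p₂_nonneg : 0 ≤ p₂
  p₂_le_v : p₂ ≤ v
  v_le_zp : v ≤ zp
  zp_le_zm : zp ≤ zm
  zm_le_u : zm ≤ u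
  u_le : u ≤ p₁ + 1
  deg : (p₁ < 0 ∧ 0 < p₂ ∧ F (real 0) ≠ real 0) ∨ (p₁ = 0 ∧ p₂ = 0)
  map_p₁ : F (real p₁) = real p₁
  map_p₂ : F (real p₂) = real p₂
  map_v : F (real v) = real p₂
  map_u : F (real u) = real (p₁ + 1)
  map_zp : F (real zp) = real zp
  map_zm : F (real zm) = real zm
  lt_of_zp : ∀ x, v ≤ x → x < zp → re (F (real x)) < x
  lt_of_zm : ∀ x, zm < x → x ≤ u → x < re (F (real x))
  mid : ∀ x, v ≤ x → x ≤ u →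
    im (F (real x)) = 0 ∧ p₂ ≤ re (F (real x)) ∧ re (F (real x)) ≤ p₁ + 1
  lt_v : ∀ x, p₂ ≤ x → x ≤ v → x = p₂ ∨ re (F (real x)) < v
  u_lt : ∀ x, u ≤ x → x ≤ p₁ + 1 → x = p₁ + 1 ∨ u < re (F (real x))
  left_pos : 0 ≤ re (F (real 0)) → ∀ x, p₁ ≤ x → x ≤ 0 → x ≤ re (F (real x))
  right_neg : re (F (real 0)) ≤ 0 → ∀ x, 0 ≤ x → x ≤ p₂ → re (F (real x)) ≤ x
  right_pos : 0 < re (F (real 0)) → ∀ x, 0 ≤ x → x ≤ p₂ → x ≤ re (F (real x))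
  left_neg : re (F (real 0)) < 0 → ∀ x, p₁ ≤ x → x ≤ 0 → re (F (real x)) ≤ x

theorem reflect_real_one_sub (hF : IsLifting 1 F) (x : ℝ) :
    reflect F (real (1 - x)) = translate 1 (refl (F (real x))) := by
  have h := hF.apply_real_add (-1) x
  rw [reflect_real, show -(1 - x) = x + ((-1 : ℤ) : ℝ) by push_cast; ring, h, refl_translate]
  simp

/-- The reflected frame; the interval `[p₂, p₁ + 1]` is reflected in its own cell `[0, 1]`. -/
def Frame.reflect (fr : Frame F) (hF : IsLifting 1 F) : Frame (reflect F) where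
  p₁ := -fr.p₂
  p₂ := -fr.p₁
  v := 1 - fr.u
  u := 1 - fr.v
  zp := 1 - fr.zm
  zm := 1 - fr.zp
  p₁_nonpos := by linarith [fr.p₂_nonneg]
  p₂_nonneg := by linarith [fr.p₁_nonpos]
  p₂_le_v := by linarith [fr.u_le]
  v_le_zp := by linarith [fr.zm_le_u]
  zp_le_zm := by linarith [fr.zp_le_zm]
  zm_le_u := by linarith [fr.v_le_zp]
  u_le := by linarith [fr.p₂_le_v]
  deg := by
    rcases fr.deg with ⟨h₁, h₂, h₃⟩ | ⟨h₁, h₂⟩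
    · refine Or.inl ⟨by linarith, by linarith, fun h => h₃ ?_⟩
      rw [reflect_real, neg_zero] at h
      rw [← refl_refl (F (real 0)), h]; simp
    · exact Or.inr ⟨by linarith, by linarith⟩
  map_p₁ := by simp [fr.map_p₂]
  map_p₂ := by simp [fr.map_p₁]
  map_v := by rw [reflect_real_one_sub hF, fr.map_u, refl_real, translate_real]; congr 1; simp
  map_u := by rw [reflect_real_one_sub hF, fr.map_v, refl_real, translate_real]; congr 1; simp
  map_zp := by
    rw [reflect_real_one_sub hF, fr.map_zm, refl_real, translate_real]; congr 1; push_cast; ring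
  map_zm := by
    rw [reflect_real_one_sub hF, fr.map_zp, refl_real, translate_real]; congr 1; push_cast; ring
  lt_of_zp x h h' := by
    have := fr.lt_of_zm (1 - x) (by linarith) (by linarith)
    have e := reflect_real_one_sub hF (1 - x)
    rw [sub_sub_cancel] at e
    rw [e]; simp; linarith
  lt_of_zm x h h' := by
    have := fr.lt_of_zp (1 - x) (by linarith) (by linarith)
    have e := reflect_real_one_sub hF (1 - x)
    rw [sub_sub_cancel] at e
    rw [e]; simp; linarith
  mid x h h' := by
    have := fr.mid (1 - x) (by linarith) (by linarith)
    have e := reflect_real_one_sub hF (1 - x)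
    rw [sub_sub_cancel] at e
    rw [e]; simp
    exact ⟨this.1, by linarith, by linarith⟩
  lt_v x h h' := by
    have e := reflect_real_one_sub hF (1 - x)
    rw [sub_sub_cancel] at e
    rw [e]; simp
    rcases fr.u_lt (1 - x) (by linarith) (by linarith) with h | h
    · left; linarith
    · right; linarith
  u_lt x h h' := by
    have e := reflect_real_one_sub hF (1 - x)
    rw [sub_sub_cancel] at e
    rw [e]; simp
    rcases fr.lt_v (1 - x) (by linarith) (by linarith) with h | h
    · left; linarith
    · right; linarith
  left_pos h x hx hx' := by
    simp only [reflect_real, re_refl, neg_zero] at h ⊢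
    linarith [fr.right_neg (by linarith) (-x) (by linarith) (by linarith)]
  right_neg h x hx hx' := by
    simp only [reflect_real, re_refl, neg_zero] at h ⊢
    linarith [fr.left_pos (by linarith) (-x) (by linarith) (by linarith)]
  right_pos h x hx hx' := by
    simp only [reflect_real, re_refl, neg_zero] at h ⊢
    linarith [fr.left_neg (by linarith) (-x) (by linarith) (by linarith)]
  left_neg h x hx hx' := by
    simp only [reflect_real, re_refl, neg_zero] at h ⊢
    linarith [fr.right_pos (by linarith) (-x) (by linarith) (by linarith)]

namespace Frame

theorem one_mem_Per (fr : Frame F) : 1 ∈ Per F :=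
  ⟨real fr.p₁, ⟨one_pos, 0, by simp [fr.map_p₁]⟩, fun _ h => h.1⟩

theorem many (fr : Frame F) (h : ∀ n, 3 ≤ n → n ∈ Per F) : ManyPeriods F :=
  Or.inr ⟨fr.one_mem_Per, h⟩

theorem zp_le_one (fr : Frame F) : fr.zp ≤ 1 := by
  linarith [fr.zp_le_zm, fr.zm_le_u, fr.u_le, fr.p₁_nonpos]

theorem v_lt_zp (fr : Frame F) (h : fr.p₂ < fr.v) : fr.v < fr.zp := by
  refine lt_of_le_of_ne fr.v_le_zp fun e => ?_
  have h1 := congrArg re fr.map_v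
  have h2 := congrArg re fr.map_zp
  rw [← e] at h2
  simp only [re_real] at h1 h2
  linarith

end Frame

/-! ### Loops in the presence of a frame -/

theorem covers_re_br_of_im {m : ℤ} {a b : ℝ} {h₁ : (m : ℝ) ≤ a} {h₂ : a ≤ b} {h₃ : b ≤ m + 1}
    {s t x y : ℝ} {h₄ : 0 ≤ s} {h₅ : s ≤ t} (ht : 0 < t) (hx : a ≤ x) (hx' : x ≤ b)
    (hy : a ≤ y) (hy' : y ≤ b) (hFx : im (F (real x)) = 0) (hFy : t ≤ im (F (real y))) :
    Covers F (Arc.re m a b h₁ h₂ h₃) (Arc.br s t h₄ h₅) := by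
  obtain ⟨k, hk⟩ := exists_re_eq_of_im_pos (lt_of_lt_of_le ht hFy)
  exact covers_re_br k hx hx' hy hy' ((eta_nonpos_of_im hFx).trans h₄) (by rwa [eta_of_re hk])

theorem exists_height_re_gt (hF : IsLifting 1 F) {c b : ℝ} (h : c < re (F (real 0))) (hb : 0 < b) :
    ∃ t, 0 < t ∧ t < b ∧ c < re (F (br t)) := by
  obtain ⟨t, ht, htb, hFt⟩ := exists_height_re_lt hF.reflect (c := -c) (by simpa using h) hb
  exact ⟨t, ht, htb, by simpa using hFt⟩

theorem im_pos_of_ne (h : re (F (real 0)) = 0) (h' : F (real 0) ≠ real 0) :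
    0 < im (F (real 0)) :=
  lt_of_le_of_ne (im_nonneg _) fun e => h' (by rw [eq_real e.symm, h])

/-- Near a point mapped into the interior of the branch over `0`, the image stays on it. -/
theorem exists_re_eq_zero {e : ℝ → S} (hF : IsLifting 1 F) (he : Continuous e)
    (he0 : e 0 = real 0) (h : re (F (real 0)) = 0) (h' : F (real 0) ≠ real 0) {b : ℝ} (hb : 0 < b) :
    ∃ t, 0 < t ∧ t < b ∧ re (F (e t)) = 0 := by
  have h0 : 0 < eta 0 (F (e 0)) := by
    rw [he0, eta_of_re (by simpa using h)]
    exact im_pos_of_ne h h'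
  have h1 : ∀ᶠ t in 𝓝[>] (0 : ℝ), 0 < eta 0 (F (e t)) :=
    (continuousAt_const.eventually_lt
      ((continuous_eta 0).comp (hF.1.comp he)).continuousAt h0).filter_mono nhdsWithin_le_nhds
  obtain ⟨t, ht, ht'⟩ := (h1.and (Ioo_mem_nhdsGT hb)).exists
  exact ⟨t, ht'.1, ht'.2, by simpa using re_of_eta_nonneg ht.le⟩

theorem exists_height_re_nonpos (hF : IsLifting 1 F) (h : re (F (real 0)) ≤ 0)
    (h' : F (real 0) ≠ real 0) {b : ℝ} (hb : 0 < b) :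
    ∃ t, 0 < t ∧ t < b ∧ re (F (br t)) ≤ 0 := by
  rcases h.lt_or_eq with h | h
  · obtain ⟨t, h₁, h₂, h₃⟩ := exists_height_re_lt hF h hb
    exact ⟨t, h₁, h₂, h₃.le⟩
  · obtain ⟨t, h₁, h₂, h₃⟩ := exists_re_eq_zero hF continuous_br br_zero h h' hb
    exact ⟨t, h₁, h₂, h₃.le⟩

theorem exists_height_re_nonneg (hF : IsLifting 1 F) (h : 0 ≤ re (F (real 0)))
    (h' : F (real 0) ≠ real 0) {b : ℝ} (hb : 0 < b) :
    ∃ t, 0 < t ∧ t < b ∧ 0 ≤ re (F (br t)) := by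
  rcases h.lt_or_eq with h | h
  · obtain ⟨t, h₁, h₂, h₃⟩ := exists_height_re_gt hF h hb
    exact ⟨t, h₁, h₂, h₃.le⟩
  · obtain ⟨t, h₁, h₂, h₃⟩ := exists_re_eq_zero hF continuous_br br_zero h.symm h' hb
    exact ⟨t, h₁, h₂, h₃.ge⟩

namespace Frame

variable (fr : Frame F)

theorem re_p₁ : re (F (real fr.p₁)) = fr.p₁ := by rw [fr.map_p₁, re_real]
theorem re_p₂ : re (F (real fr.p₂)) = fr.p₂ := by rw [fr.map_p₂, re_real]
theorem re_v : re (F (real fr.v)) = fr.p₂ := by rw [fr.map_v, re_real]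
theorem re_u : re (F (real fr.u)) = fr.p₁ + 1 := by rw [fr.map_u, re_real]
theorem re_zp : re (F (real fr.zp)) = fr.zp := by rw [fr.map_zp, re_real]
theorem im_p₁ : im (F (real fr.p₁)) = 0 := by rw [fr.map_p₁, im_real]
theorem im_p₂ : im (F (real fr.p₂)) = 0 := by rw [fr.map_p₂, im_real]
theorem im_v : im (F (real fr.v)) = 0 := by rw [fr.map_v, im_real]
theorem im_u : im (F (real fr.u)) = 0 := by rw [fr.map_u, im_real]

theorem neg_one_le_p₁ : -1 ≤ fr.p₁ := by
  linarith [fr.p₂_nonneg, fr.p₂_le_v, fr.v_le_zp, fr.zp_le_zm, fr.zm_le_u, fr.u_le]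

/-- A point of `[p₂, v]` that is mapped to the left of `p₂` or off the real axis is an interior point
of this interval, and `v` is not fixed. -/
theorem turn {x : ℝ} (h₁ : fr.p₂ ≤ x) (h₂ : x ≤ fr.v)
    (h : re (F (real x)) < fr.p₂ ∨ 0 < im (F (real x))) :
    fr.p₂ < x ∧ x < fr.v ∧ fr.v < fr.zp := by
  have e₁ : fr.p₂ < x := by
    refine lt_of_le_of_ne h₁ fun e => ?_
    rw [← e, fr.re_p₂, fr.im_p₂] at h
    simp at h
  have e₂ : x < fr.v := by
    refine lt_of_le_of_ne h₂ fun e => ?_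
    rw [e, fr.re_v, fr.im_v] at h
    simp at h
  exact ⟨e₁, e₂, fr.v_lt_zp (e₁.trans e₂)⟩

/-- The mirror image of the previous lemma. -/
theorem turn' (hF : IsLifting 1 F) {x : ℝ} (h₁ : fr.u ≤ x) (h₂ : x ≤ fr.p₁ + 1)
    (h : fr.p₁ + 1 < re (F (real x)) ∨ 0 < im (F (real x))) :
    fr.u < x ∧ x < fr.p₁ + 1 ∧ fr.zm < fr.u := by
  have e := reflect_real_one_sub hF x
  obtain ⟨e₁, e₂, e₃⟩ := (fr.reflect hF).turn (x := 1 - x) (by simp [reflect]; linarith)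
    (by simp [reflect]; linarith) (by
      rw [e]; simp [reflect]
      rcases h with h | h
      · left; linarith
      · exact Or.inr h)
  simp only [reflect] at e₁ e₂ e₃
  exact ⟨by linarith, by linarith, by linarith⟩

variable {fr}

/-- A point of `[p₂, v]` is mapped to a height of at least `b`, and the branch reaches `zp` at the height
`b`. For some small `t`, the arc `[t, b]` of the branch covers `[v, zp]`, which covers itself and
`[p₂, v]`, which covers `[t, b]`. -/
theorem many_of_v_branch (hF : IsLifting 1 F) {b x : ℝ} (h0 : re (F (real 0)) < fr.v) (hb : 0 < b)
    (hb1 : b ≤ 1) (hFb : F (br b) = real fr.zp) (hx : fr.p₂ ≤ x) (hx' : x ≤ fr.v)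
    (hFx : b ≤ im (F (real x))) : ManyPeriods F := by
  obtain ⟨e₁, e₂, e₃⟩ := fr.turn hx hx' (Or.inr (by linarith))
  obtain ⟨t, ht, htb, hFt⟩ := exists_height_re_lt hF h0 hb
  have := fr.p₂_nonneg
  have := fr.zp_le_one
  refine fr.many fun n hn => mem_Per_of_self hF (X := Arc.br t b ht.le htb.le)
    (Y := Arc.re 0 fr.v fr.zp (by simp; linarith) e₃.le (by simp; linarith))
    (l := [Arc.re 0 fr.p₂ fr.v (by simp; linarith) (by linarith) (by simp; linarith)])
    ?_ ?_ ⟨?_, ?_⟩ (Arc.disj_re_br ht hb1).symm (by simpa using (Arc.disj_re_br ht hb1).symm)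
    (by simpa using hn)
  · exact covers_br_re e₃ 0 (x := t) (y := b) le_rfl htb.le htb.le le_rfl (by simp; linarith)
      (by simp [hFb])
  · exact covers_re_re e₃ 0 (x := fr.v) (y := fr.zp) le_rfl e₃.le e₃.le le_rfl
      (by simp [fr.re_v]; linarith) (by simp [fr.re_zp])
  · exact covers_re_re (by linarith) 0 (x := fr.v) (y := fr.zp) le_rfl e₃.le e₃.le le_rfl
      (by simp [fr.re_v]) (by simp [fr.re_zp]; linarith)
  · exact covers_re_br_of_im hb (by linarith) le_rfl hx hx' fr.im_v hFx

/-- The mirror image of the previous lemma. -/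
theorem many_of_u_branch (hF : IsLifting 1 F) {b x : ℝ} (h0 : fr.u - 1 < re (F (real 0)))
    (hb : 0 < b) (hb1 : b ≤ 1) (hFb : F (br b) = real (fr.zm - 1)) (hx : fr.u ≤ x)
    (hx' : x ≤ fr.p₁ + 1) (hFx : b ≤ im (F (real x))) : ManyPeriods F := by
  rw [← manyPeriods_reflect]
  refine many_of_v_branch (fr := fr.reflect hF) hF.reflect (x := 1 - x) (b := b) ?_ hb hb1 ?_ ?_ ?_ ?_
  · simp [reflect]; linarith
  · simp [reflect, hFb]
  · simp [reflect]; linarith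
  · simp [reflect]; linarith
  · rw [reflect_real_one_sub hF]; simpa using hFx

theorem deg_of_lt_p₂ (h : 0 < fr.p₂) : fr.p₁ < 0 ∧ F (real 0) ≠ real 0 := by
  rcases fr.deg with h' | h'
  · exact ⟨h'.1, h'.2.2⟩
  · linarith

theorem deg_of_p₁_lt (h : fr.p₁ < 0) : 0 < fr.p₂ ∧ F (real 0) ≠ real 0 := by
  rcases fr.deg with h' | h'
  · exact h'.2
  · linarith

theorem p₂_pos_of_im {x : ℝ} (hx : 0 ≤ x) (hx' : x ≤ fr.p₂) (h : 0 < im (F (real x))) :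
    0 < fr.p₂ := by
  refine lt_of_le_of_ne fr.p₂_nonneg fun e => ?_
  have : x = fr.p₂ := by linarith
  rw [this, fr.im_p₂] at h
  exact h.false

theorem p₁_neg_of_im {x : ℝ} (hx : fr.p₁ ≤ x) (hx' : x ≤ 0) (h : 0 < im (F (real x))) :
    fr.p₁ < 0 := by
  refine lt_of_le_of_ne fr.p₁_nonpos fun e => ?_
  have : x = fr.p₁ := by linarith
  rw [this, fr.im_p₁] at h
  exact h.false

/-- A point of `[0, p₂]` is mapped to a height of at least `b`: `[0, p₂]` covers itself and the arc
`[t, b]` of the branch, which covers `[0, p₂]`. -/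
theorem many_of_right_branch (hF : IsLifting 1 F) {b x : ℝ} (h0 : re (F (real 0)) ≤ 0) (hb : 0 < b)
    (hb1 : b ≤ 1) (hFb : F (br b) = real fr.zp) (hx : 0 ≤ x) (hx' : x ≤ fr.p₂)
    (hFx : b ≤ im (F (real x))) : ManyPeriods F := by
  have hp := p₂_pos_of_im hx hx' (hb.trans_le hFx)
  obtain ⟨hp₁, hne⟩ := deg_of_lt_p₂ hp
  obtain ⟨t, ht, htb, hFt⟩ := exists_height_re_nonpos hF h0 hne hb
  have := fr.zp_le_one
  have := fr.p₂_le_v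
  have := fr.v_le_zp
  refine Or.inl fun n hn => mem_Per_of_self hF (X := Arc.br t b ht.le htb.le)
    (Y := Arc.re 0 0 fr.p₂ (by simp) hp.le (by simp; linarith)) (l := [])
    ?_ ?_ ?_ (Arc.disj_re_br ht hb1).symm (by simp) (by simpa using hn)
  · exact covers_br_re hp 0 (x := t) (y := b) le_rfl htb.le htb.le le_rfl (by simpa using hFt)
      (by simp [hFb]; linarith)
  · exact covers_re_re hp 0 (x := 0) (y := fr.p₂) le_rfl hp.le hp.le le_rfl
      (by simpa using h0) (by simp [fr.re_p₂])
  · exact covers_re_br_of_im hb hp.le le_rfl hx hx' fr.im_p₂ hFx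

/-- The mirror image of the previous lemma. -/
theorem many_of_left_branch (hF : IsLifting 1 F) {b x : ℝ} (h0 : 0 ≤ re (F (real 0))) (hb : 0 < b)
    (hb1 : b ≤ 1) (hFb : F (br b) = real (fr.zm - 1)) (hx : fr.p₁ ≤ x) (hx' : x ≤ 0)
    (hFx : b ≤ im (F (real x))) : ManyPeriods F := by
  rw [← manyPeriods_reflect]
  refine many_of_right_branch (fr := fr.reflect hF) hF.reflect (x := -x) (b := b) ?_ hb hb1 ?_ ?_ ?_ ?_
  · simpa using h0
  · simp [reflect, hFb]
  · linarith
  · simp [reflect]; linarith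
  · simpa using hFx

theorem covers_self_v {v₁ : ℝ} (h₁ : fr.p₂ < v₁) (h₂ : v₁ < fr.v) (h₃ : fr.v < fr.zp) {g g' g''} :
    Covers F (Arc.re 0 v₁ fr.zp g g' g'') (Arc.re 0 v₁ fr.zp g g' g'') :=
  covers_re_re (by linarith) 0 (x := fr.v) (y := fr.zp) h₂.le h₃.le (by linarith) le_rfl
    (by simp [fr.re_v]; linarith) (by simp [fr.re_zp])

/-- `[p₁, 0]` covers itself and `[p₂, v₁]`, which covers `[p₁, 0]` because `v₁` is mapped far to the
left. -/
theorem many_of_left_reach_of_turn_re (hF : IsLifting 1 F) {v₁ x : ℝ} (h₁ : fr.p₂ < v₁) (h₂ : v₁ < fr.v)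
    (h₃ : fr.v < fr.zp) (hv : re (F (real v₁)) ≤ fr.zm - 1) (hx : fr.p₁ ≤ x) (hx' : x ≤ 0)
    (hFx : v₁ ≤ re (F (real x))) : ManyPeriods F := by
  have := fr.zp_le_one
  have := fr.p₂_nonneg
  have := fr.zm_le_u
  have := fr.u_le
  have := fr.neg_one_le_p₁
  have hp : fr.p₁ < 0 := by
    refine lt_of_le_of_ne fr.p₁_nonpos fun e => ?_
    have e : x = fr.p₁ := by linarith
    rw [e, fr.re_p₁] at hFx
    linarith
  have hp₂ := (deg_of_p₁_lt hp).1
  refine Or.inl fun n hn => mem_Per_of_self hF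
    (X := Arc.re 0 fr.p₂ v₁ (by simpa using hp₂.le) h₁.le (by simp; linarith))
    (Y := Arc.re (-1) fr.p₁ 0 (by simpa using fr.neg_one_le_p₁) hp.le (by simp)) (l := [])
    ?_ ?_ ?_ (Arc.disj_re_re hp₂ ?_).symm (by simp) (by simpa using hn)
  · exact covers_re_re hp 0 (x := v₁) (y := fr.p₂) h₁.le le_rfl le_rfl h₁.le
      (by simp; linarith) (by simp [fr.re_p₂]; linarith)
  · exact covers_re_re hp 0 (x := fr.p₁) (y := x) le_rfl hp.le hx hx'
      (by simp [fr.re_p₁]) (by simp; linarith)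
  · exact covers_re_re h₁ 0 (x := fr.p₁) (y := x) le_rfl hp.le hx hx'
      (by simp [fr.re_p₁]; linarith) (by simp; linarith)
  · linarith [fr.zp_le_zm]

/-- The variant in which `v₁` is mapped to a branch: `[p₂, v₁]` covers the arc `[t, b]` of the branch,
which covers `[p₁, 0]`. -/
theorem many_of_left_reach_of_turn_im (hF : IsLifting 1 F) {v₁ x b : ℝ} (h0 : 0 ≤ re (F (real 0)))
    (h₁ : fr.p₂ < v₁) (h₂ : v₁ < fr.v)
    (h₃ : fr.v < fr.zp) (hb : 0 < b) (hb1 : b ≤ 1) (hFb : F (br b) = real (fr.zm - 1))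
    (hv : b ≤ im (F (real v₁))) (hx : fr.p₁ ≤ x) (hx' : x ≤ 0)
    (hFx : v₁ ≤ re (F (real x))) : ManyPeriods F := by
  have := fr.zp_le_one
  have := fr.p₂_nonneg
  have := fr.zm_le_u
  have := fr.u_le
  have := fr.neg_one_le_p₁
  have hp : fr.p₁ < 0 := by
    refine lt_of_le_of_ne fr.p₁_nonpos fun e => ?_
    have e : x = fr.p₁ := by linarith
    rw [e, fr.re_p₁] at hFx
    linarith
  obtain ⟨hp₂, hne⟩ := deg_of_p₁_lt hp
  obtain ⟨t, ht, htb, hFt⟩ := exists_height_re_nonneg hF h0 hne hb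
  refine fr.many fun n hn => mem_Per_of_self hF (X := Arc.br t b ht.le htb.le)
    (Y := Arc.re (-1) fr.p₁ 0 (by simpa using fr.neg_one_le_p₁) hp.le (by simp))
    (l := [Arc.re 0 fr.p₂ v₁ (by simpa using hp₂.le) h₁.le (by simp; linarith)])
    ?_ ?_ ⟨?_, ?_⟩ (Arc.disj_re_br ht hb1).symm (by simpa using (Arc.disj_re_br ht hb1).symm)
    (by simpa using hn)
  · exact covers_br_re hp 0 (x := b) (y := t) htb.le le_rfl le_rfl htb.le
      (by simp [hFb]; linarith) (by simpa using hFt)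
  · exact covers_re_re hp 0 (x := fr.p₁) (y := x) le_rfl hp.le hx hx'
      (by simp [fr.re_p₁]) (by simp; linarith)
  · exact covers_re_re h₁ 0 (x := fr.p₁) (y := x) le_rfl hp.le hx hx'
      (by simp [fr.re_p₁]; linarith) (by simp; linarith)
  · exact covers_re_br_of_im hb le_rfl h₁.le h₁.le le_rfl fr.im_p₂ hv

/-- `[v₁, zp]` covers itself and `[u, u₁]`, which covers `[v₁, zp]`. -/
theorem many_of_turns_re (hF : IsLifting 1 F) {v₁ u₁ : ℝ} (h₁ : fr.p₂ < v₁) (h₂ : v₁ < fr.v)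
    (h₃ : fr.v < fr.zp) (hv : re (F (real v₁)) ≤ fr.zm - 1) (h₄ : fr.u < u₁) (h₅ : u₁ < fr.p₁ + 1)
    (h₆ : fr.zm < fr.u) (hu : fr.zp + 1 ≤ re (F (real u₁))) : ManyPeriods F := by
  have := fr.zp_le_one
  have := fr.zp_le_zm
  have := fr.p₂_nonneg
  have := fr.p₁_nonpos
  refine Or.inl fun n hn => mem_Per_of_self hF
    (X := Arc.re 0 fr.u u₁ (by simp; linarith) h₄.le (by simp; linarith))
    (Y := Arc.re 0 v₁ fr.zp (by simp; linarith) (by linarith) (by simp; linarith)) (l := [])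
    ?_ (covers_self_v h₁ h₂ h₃) ?_ (Arc.disj_re_re (by linarith) (by linarith)).symm (by simp)
    (by simpa using hn)
  · exact covers_re_re (by linarith) 1 (x := fr.u) (y := u₁) le_rfl h₄.le h₄.le le_rfl
      (by simp [fr.re_u]; linarith) (by simpa using hu)
  · exact covers_re_re h₄ (-1) (x := v₁) (y := fr.v) le_rfl (by linarith) h₂.le h₃.le
      (by push_cast; linarith) (by push_cast; linarith [fr.re_v])

/-- The variant in which `v₁` is mapped to a branch: `[v₁, zp]` covers the arc `[t, b]` of the branch,
which covers `[u, u₁]`. -/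
theorem many_of_turns_im (hF : IsLifting 1 F) {v₁ u₁ b : ℝ} (h0 : 0 ≤ re (F (real 0)))
    (h₁ : fr.p₂ < v₁) (h₂ : v₁ < fr.v)
    (h₃ : fr.v < fr.zp) (hb : 0 < b) (hb1 : b ≤ 1) (hFb : F (br b) = real (fr.zm - 1))
    (hv : b ≤ im (F (real v₁))) (h₄ : fr.u < u₁) (h₅ : u₁ < fr.p₁ + 1)
    (h₆ : fr.zm < fr.u) (hu : fr.zp + 1 ≤ re (F (real u₁))) : ManyPeriods F := by
  have := fr.zp_le_one
  have := fr.zp_le_zm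
  have := fr.p₂_nonneg
  have := fr.p₁_nonpos
  obtain ⟨t, ht, htb, hFt⟩ := exists_height_re_gt hF (c := u₁ - 1) (by linarith) hb
  refine fr.many fun n hn => mem_Per_of_self_append hF (X := Arc.br t b ht.le htb.le) (l' := [])
    (Z := Arc.re 0 fr.u u₁ (by simp; linarith) h₄.le (by simp; linarith))
    (Y := Arc.re 0 v₁ fr.zp (by simp; linarith) (by linarith) (by simp; linarith)) (l := [])
    ?_ ?_ (covers_self_v h₁ h₂ h₃) ?_ (Arc.disj_re_br ht hb1).symm (by simp)
    (Arc.disj_re_br ht hb1).symm (by simp) (by simpa using hn)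
  · exact covers_br_re h₄ (-1) (x := b) (y := t) htb.le le_rfl le_rfl htb.le
      (by simp [hFb]; linarith) (by push_cast; linarith)
  · exact covers_re_re (by linarith) 1 (x := fr.u) (y := u₁) le_rfl h₄.le h₄.le le_rfl
      (by simp [fr.re_u]; linarith) (by simpa using hu)
  · exact covers_re_br_of_im hb h₂.le h₃.le le_rfl (by linarith) fr.im_v hv

/-- `[v₁, zp]` covers itself and `[x, p₂]`, which covers `[v₁, zp]`. -/
theorem many_of_right_reach (hF : IsLifting 1 F) {v₁ x : ℝ} (h₁ : fr.p₂ < v₁) (h₂ : v₁ < fr.v)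
    (h₃ : fr.v < fr.zp) (hv : re (F (real v₁)) ≤ 0) (hx : 0 ≤ x) (hx' : x ≤ fr.p₂)
    (hFx : fr.zp ≤ re (F (real x))) : ManyPeriods F := by
  have := fr.zp_le_one
  have := fr.p₂_nonneg
  have hx'' : x < fr.p₂ := by
    refine lt_of_le_of_ne hx' fun e => ?_
    rw [e, fr.re_p₂] at hFx
    linarith
  have hp₁ := (deg_of_lt_p₂ (fr := fr) (by linarith)).1
  refine Or.inl fun n hn => mem_Per_of_self hF
    (X := Arc.re 0 x fr.p₂ (by simpa using hx) hx' (by simp; linarith))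
    (Y := Arc.re 0 v₁ fr.zp (by simp; linarith) (by linarith) (by simp; linarith)) (l := [])
    ?_ (covers_self_v h₁ h₂ h₃) ?_ (Arc.disj_re_re (by linarith) ?_) (by simp)
    (by simpa using hn)
  · exact covers_re_re (by linarith) 0 (x := fr.p₂) (y := x) hx' le_rfl le_rfl hx'
      (by simp [fr.re_p₂]; linarith) (by simpa using hFx)
  · exact covers_re_re hx'' 0 (x := v₁) (y := fr.v) le_rfl (by linarith) h₂.le h₃.le
      (by push_cast; linarith) (by push_cast; linarith [fr.re_v])
  · linarith [fr.zp_le_zm, fr.zm_le_u, fr.u_le]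

/-- The arc `[t, b]` of the branch covers `[v₁, zp]`, which covers itself and `[u, u₁]`, which covers
`[t, b]`. -/
theorem many_of_u_branch_of_turn (hF : IsLifting 1 F) {v₁ u₁ b : ℝ} (h₁ : fr.p₂ < v₁) (h₂ : v₁ < fr.v)
    (h₃ : fr.v < fr.zp) (h0 : re (F (real 0)) < v₁) (hv : re (F (real v₁)) ≤ fr.zm - 1)
    (hb : 0 < b) (hb1 : b ≤ 1) (hFb : F (br b) = real fr.zp) (h₄ : fr.u < u₁) (h₅ : u₁ < fr.p₁ + 1)
    (hu : b ≤ im (F (real u₁))) : ManyPeriods F := by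
  have := fr.zp_le_one
  have := fr.zp_le_zm
  have := fr.zm_le_u
  have := fr.p₂_nonneg
  have := fr.p₁_nonpos
  obtain ⟨t, ht, htb, hFt⟩ := exists_height_re_lt hF h0 hb
  refine fr.many fun n hn => mem_Per_of_self hF (X := Arc.br t b ht.le htb.le)
    (Y := Arc.re 0 v₁ fr.zp (by simp; linarith) (by linarith) (by simp; linarith))
    (l := [Arc.re 0 fr.u u₁ (by simp; linarith) h₄.le (by simp; linarith)])
    ?_ (covers_self_v h₁ h₂ h₃) ⟨?_, ?_⟩ (Arc.disj_re_br ht hb1).symm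
    (by simpa using (Arc.disj_re_br ht hb1).symm) (by simpa using hn)
  · exact covers_br_re (by linarith) 0 (x := t) (y := b) le_rfl htb.le htb.le le_rfl
      (by simpa using hFt.le) (by simp [hFb])
  · exact covers_re_re h₄ (-1) (x := v₁) (y := fr.v) le_rfl (by linarith) h₂.le h₃.le
      (by push_cast; linarith) (by push_cast; linarith [fr.re_v])
  · exact covers_re_br_of_im hb le_rfl h₄.le h₄.le le_rfl fr.im_u hu

/-- The arc `[t, b]` of the branch covers `[v₁, v]`, which covers `[p₁, 0]`, which covers itself and
`[t, b]`. -/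
theorem many_of_left_branch_of_turn (hF : IsLifting 1 F) {v₁ x b : ℝ} (h₂ : v₁ < fr.v)
    (h₃ : fr.v < fr.zp) (h0 : 0 ≤ re (F (real 0))) (h0' : re (F (real 0)) < v₁)
    (hv : re (F (real v₁)) ≤ fr.zm - 1)
    (hb : 0 < b) (hb1 : b ≤ 1) (hFb : F (br b) = real fr.zp) (hx : fr.p₁ ≤ x) (hx' : x ≤ 0)
    (hFx : b ≤ im (F (real x))) : ManyPeriods F := by
  have := fr.zp_le_one
  have := fr.zp_le_zm
  have := fr.zm_le_u
  have := fr.u_le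
  have := fr.p₂_nonneg
  have hp := p₁_neg_of_im hx hx' (hb.trans_le hFx)
  obtain ⟨t, ht, htb, hFt⟩ := exists_height_re_lt hF h0' hb
  refine fr.many fun n hn => mem_Per_of_self_append hF (X := Arc.br t b ht.le htb.le) (l' := [])
    (Z := Arc.re 0 v₁ fr.v (by simp; linarith) (by linarith) (by simp; linarith))
    (Y := Arc.re (-1) fr.p₁ 0 (by simpa using fr.neg_one_le_p₁) hp.le (by simp)) (l := [])
    ?_ ?_ ?_ ?_ (Arc.disj_re_br ht hb1).symm (by simp)
    (Arc.disj_re_br ht hb1).symm (by simp) (by simpa using hn)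
  · exact covers_br_re h₂ 0 (x := t) (y := b) le_rfl htb.le htb.le le_rfl
      (by simpa using hFt.le) (by simp [hFb]; linarith)
  · exact covers_re_re hp 0 (x := v₁) (y := fr.v) le_rfl h₂.le h₂.le le_rfl
      (by push_cast; linarith) (by push_cast; linarith [fr.re_v])
  · exact covers_re_re hp 0 (x := fr.p₁) (y := 0) le_rfl hp.le hp.le le_rfl
      (by simp [fr.re_p₁]) (by simpa using h0)
  · exact covers_re_br_of_im hb le_rfl hp.le hx hx' fr.im_p₁ hFx

/-- `[p₁, 0]` reaches beyond `p₂`, and `[0, p₂]` reaches beyond `p₁`. Points `r₀ > 0` close to `0` are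
mapped to the same branch as `0`, so that `0` itself can be avoided: `[r₀, r]` covers `[p₁, 0]`. -/
theorem many_of_left_right (hF : IsLifting 1 F) {x r : ℝ} (h0 : re (F (real 0)) = 0)
    (hx : fr.p₁ ≤ x) (hx' : x ≤ 0) (hFx : fr.p₂ < re (F (real x)))
    (hr : 0 ≤ r) (hr' : r ≤ fr.p₂) (hFr : re (F (real r)) < fr.p₁) : ManyPeriods F := by
  have hp : fr.p₁ < 0 := by
    refine lt_of_le_of_ne fr.p₁_nonpos fun e => ?_
    have e : x = fr.p₁ := by linarith
    rw [e, fr.re_p₁] at hFx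
    linarith [fr.p₂_nonneg]
  obtain ⟨hp₂, hne⟩ := deg_of_p₁_lt hp
  have hr0 : 0 < r := by
    refine lt_of_le_of_ne hr fun e => ?_
    rw [← e, h0] at hFr
    linarith
  have hr1 : r < fr.p₂ := by
    refine lt_of_le_of_ne hr' fun e => ?_
    rw [e, fr.re_p₂] at hFr
    linarith
  obtain ⟨r₀, h₁, h₂, h₃⟩ := exists_re_eq_zero hF continuous_real rfl h0 hne hr0
  have : fr.p₂ ≤ fr.p₁ + 1 := by
    linarith [fr.p₂_le_v, fr.v_le_zp, fr.zp_le_zm, fr.zm_le_u, fr.u_le]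
  refine Or.inl fun n hn => mem_Per_of_self hF
    (X := Arc.re 0 r₀ r (by simpa using h₁.le) h₂.le (by simp; linarith))
    (Y := Arc.re (-1) fr.p₁ 0 (by simpa using fr.neg_one_le_p₁) hp.le (by simp)) (l := [])
    ?_ ?_ ?_ (Arc.disj_re_re h₁ ?_).symm (by simp) (by simpa using hn)
  · exact covers_re_re hp 0 (x := r) (y := r₀) h₂.le le_rfl le_rfl h₂.le
      (by simpa using hFr.le) (by simp [h₃])
  · exact covers_re_re hp 0 (x := fr.p₁) (y := 0) le_rfl hp.le hp.le le_rfl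
      (by simp [fr.re_p₁]) (by simp [h0])
  · exact covers_re_re h₂ 0 (x := fr.p₁) (y := x) le_rfl hp.le hx hx'
      (by simp [fr.re_p₁]; linarith) (by simp; linarith)
  · linarith

/-- `[p₁, 0]` reaches beyond `p₂`, and `[0, p₂]` reaches the height `b`: the arc `[t, b]` of the branch
covers `[p₁, 0]`, which covers itself and `[0, p₂]`, which covers `[t, b]`. -/
theorem many_of_left_reach_right_branch (hF : IsLifting 1 F) {x r b : ℝ} (h0 : re (F (real 0)) = 0)
    (hx : fr.p₁ ≤ x) (hx' : x ≤ 0) (hFx : fr.p₂ < re (F (real x)))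
    (hb : 0 < b) (hb1 : b ≤ 1) (hFb : F (br b) = real (fr.zm - 1))
    (hr : 0 ≤ r) (hr' : r ≤ fr.p₂) (hFr : b ≤ im (F (real r))) : ManyPeriods F := by
  have hp₂ := p₂_pos_of_im hr hr' (hb.trans_le hFr)
  obtain ⟨hp, hne⟩ := deg_of_lt_p₂ hp₂
  obtain ⟨t, ht, htb, hFt⟩ := exists_height_re_nonneg hF h0.ge hne hb
  have := fr.zm_le_u
  have := fr.u_le
  have : fr.p₂ ≤ fr.p₁ + 1 := by
    linarith [fr.p₂_le_v, fr.v_le_zp, fr.zp_le_zm, fr.zm_le_u, fr.u_le]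
  refine fr.many fun n hn => mem_Per_of_self hF (X := Arc.br t b ht.le htb.le)
    (Y := Arc.re (-1) fr.p₁ 0 (by simpa using fr.neg_one_le_p₁) hp.le (by simp))
    (l := [Arc.re 0 0 fr.p₂ (by simp) hp₂.le (by simp; linarith)])
    ?_ ?_ ⟨?_, ?_⟩ (Arc.disj_re_br ht hb1).symm (by simpa using (Arc.disj_re_br ht hb1).symm)
    (by simpa using hn)
  · exact covers_br_re hp 0 (x := b) (y := t) htb.le le_rfl le_rfl htb.le
      (by simp [hFb]; linarith) (by simpa using hFt)
  · exact covers_re_re hp 0 (x := fr.p₁) (y := 0) le_rfl hp.le hp.le le_rfl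
      (by simp [fr.re_p₁]) (by simp [h0])
  · exact covers_re_re hp₂ 0 (x := fr.p₁) (y := x) le_rfl hp.le hx hx'
      (by simp [fr.re_p₁]; linarith) (by simp; linarith)
  · exact covers_re_br_of_im hb hp₂.le le_rfl hr hr' fr.im_p₂ hFr

end Frame

namespace Frame

variable {fr : Frame F}

/-! ### Orbits escaping from a frame -/

/-- An orbit that is unbounded above leaves the region that consists of the real points to the left of
`zp` or not to the right of `p₂`, of the points of height less than `b` on the branch over `0`, and of
the points of height less than `b₂` on the branches further left. The alternatives are the ways of
leaving it: from a real point to the right, from a real point to a branch, or along the branches. -/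
theorem exit (hF : IsLifting 1 F) (hU : Up F) (hzp : 0 < fr.zp) {b b₂ : ℝ} (hb : 0 < b)
    (hbb : b ≤ b₂) (hlt : ∀ t, 0 ≤ t → t < b → t ≤ 1 → re (F (br t)) < fr.zp)
    (hlt₂ : ∀ t, 0 ≤ t → t < b₂ → t ≤ 1 → re (F (br t)) < 1) :
    (∃ x, fr.u ≤ x ∧ x ≤ fr.p₁ + 1 ∧ fr.zp + 1 ≤ re (F (real x))) ∨
    (∃ x, fr.p₁ ≤ x ∧ x ≤ fr.p₂ ∧ fr.zp ≤ re (F (real x)) ∧ fr.p₂ < re (F (real x))) ∨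
    (∃ x, fr.p₁ ≤ x ∧ x ≤ fr.p₁ + 1 ∧ b ≤ im (F (real x)) ∧
      (b₂ ≤ im (F (real x)) ∨
        0 ≤ re (F (real x)) ∧ (fr.u ≤ x → 1 ≤ re (F (real x))))) ∨
    (∃ β b₁, (β = b ∨ β = b₂) ∧ 0 ≤ b₁ ∧ b₁ < β ∧ b₁ ≤ 1 ∧ re (F (br b₁)) < 1 ∧
      β ≤ im (F (br b₁))) := by
  have hz1 := fr.zp_le_one
  have hzm := fr.zp_le_zm
  have hmu := fr.zm_le_u
  have hu := fr.u_le
  have hpv := fr.p₂_le_v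
  have hvz := fr.v_le_zp
  have hp1 := fr.p₁_nonpos
  have hp2 := fr.p₂_nonneg
  have hZb : ∀ z : S, (re z < fr.zp ∨ re z ≤ fr.p₂) → re z ≤ 1 := by
    rintro z (h | h) <;> linarith
  obtain ⟨z, ⟨hz, hz0, hz2⟩, hFz⟩ := hU.exists_exit hF
    (Z := {z | (re z < fr.zp ∨ re z ≤ fr.p₂) ∧ (re z = 0 → im z < b) ∧ im z < b₂})
    (C := 1) (fun z hz => hZb z hz.1) (fun x => ⟨-⌊x⌋ - 1, by
      have := Int.lt_floor_add_one x
      simp only [Set.mem_ofPred_eq, re_real, im_real]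
      push_cast
      exact ⟨Or.inl (by linarith), fun _ => hb, by linarith⟩⟩)
  simp only [Set.mem_ofPred_eq, not_and_or] at hFz
  have hint : ∀ w : S, (re w < fr.zp ∨ re w ≤ fr.p₂) → ∀ m : ℤ, re w = m → m ≤ 0 := by
    intro w hw m hm
    have hp2' : fr.p₂ < 1 := by
      rcases fr.deg with h | h <;> linarith
    have : (m : ℝ) < 1 := by rw [← hm]; rcases hw with h | h <;> linarith
    have : m < 1 := by exact_mod_cast this
    omega
  -- the case distinction for the image: it lies too far to the right, or too high
  have hcase : (fr.zp ≤ re (F z) ∧ fr.p₂ < re (F z)) ∨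
      ((re (F z) < fr.zp ∨ re (F z) ≤ fr.p₂) ∧ ((re (F z) = 0 ∧ b ≤ im (F z)) ∨ b₂ ≤ im (F z))) := by
    by_cases h : re (F z) < fr.zp ∨ re (F z) ≤ fr.p₂
    · refine Or.inr ⟨h, ?_⟩
      rcases hFz with h' | h' | h'
      · exact absurd h h'
      · push Not at h'; exact Or.inl h'
      · exact Or.inr (not_lt.1 h')
    · push Not at h; exact Or.inl h
  rcases (im_nonneg z).eq_or_lt with hi | hi
  · -- a real point
    have hzr := eq_real hi.symm
    obtain ⟨k, x, hxk, hx1, hx2⟩ : ∃ k : ℤ, ∃ x, re z = x - k ∧ fr.p₁ < x ∧ x ≤ fr.p₁ + 1 := by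
      refine ⟨-⌈re z - fr.p₁ - 1⌉, re z - ⌈re z - fr.p₁ - 1⌉, by push_cast; ring, ?_, ?_⟩
      · linarith [Int.ceil_lt_add_one (re z - fr.p₁ - 1)]
      · linarith [Int.le_ceil (re z - fr.p₁ - 1)]
    have hFx : F z = translate (-k) (F (real x)) := by
      rw [← hF.apply_translate, translate_real, hzr, hxk]; congr 2; push_cast; ring
    have hre : re (F z) = re (F (real x)) - k := by rw [hFx]; simp; ring
    have him : im (F z) = im (F (real x)) := by rw [hFx]; simp
    have hk0 : 0 ≤ k := by
      have : (-1 : ℝ) < k := by rcases hz with h | h <;> linarith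
      have : -1 < k := by exact_mod_cast this
      omega
    have hk0' : (0 : ℝ) ≤ k := by exact_mod_cast hk0
    have hk1 : k = 0 ∨ (1 : ℝ) ≤ k := by
      rcases hk0.eq_or_lt with h | h
      · exact Or.inl h.symm
      · right; exact_mod_cast h
    have hx0 : k = 0 → x < fr.zp ∨ x ≤ fr.p₂ := by
      rintro rfl
      simpa [hxk] using hz
    have hxv : fr.u ≤ x → k = 0 → x = fr.p₂ := by
      intro h h'
      rcases hx0 h' with h | h <;> linarith
    rcases hcase with ⟨c1, c2⟩ | ⟨c1, c2⟩
    · rw [hre] at c1 c2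
      rcases le_or_gt x fr.p₂ with hxp | hxp
      · exact Or.inr (Or.inl ⟨x, hx1.le, hxp, by linarith, by linarith⟩)
      rcases le_or_gt x fr.v with hxv' | hxv'
      · exfalso
        rcases fr.lt_v x hxp.le hxv' with h | h <;> linarith
      rcases le_or_gt x fr.u with hxu | hxu
      · exfalso
        have h1 := (fr.mid x hxv'.le hxu).2.2
        rcases hk1 with h | h
        · rcases hx0 h with h' | h'
          · have := fr.lt_of_zp x hxv'.le h'
            linarith
          · linarith
        · linarith
      · refine Or.inl ⟨x, hxu.le, hx2, ?_⟩
        rcases hk1 with h | h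
        · linarith [hxv hxu.le h]
        · linarith
    · refine Or.inr (Or.inr (Or.inl ⟨x, hx1.le, hx2, ?_, ?_⟩))
      · rw [← him]
        rcases c2 with c2 | c2
        · exact c2.2
        · linarith
      · rw [← him]
        rcases c2 with c2 | c2
        · right
          rw [hre] at c2
          refine ⟨by linarith, fun hux => ?_⟩
          rcases hk1 with h | h
          · have e := hxv hux h
            rw [him, e, fr.im_p₂] at c2
            linarith [c2.2]
          · linarith
        · exact Or.inl c2
  · -- a point of a branch
    obtain ⟨k, hk⟩ := exists_re_eq_of_im_pos hi
    have hk0 := hint z hz k hk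
    have hk0' : (k : ℝ) ≤ 0 := by exact_mod_cast hk0
    have hzk := eq_translate_br hk
    have hF' : F z = translate k (F (br (im z))) := by
      conv_lhs => rw [hzk]
      exact hF.apply_translate _ _
    have hre : re (F z) = re (F (br (im z))) + k := by rw [hF']; simp
    have him : im (F z) = im (F (br (im z))) := by rw [hF']; simp
    have ht1 := im_le_one z
    have h2 := hlt₂ _ hi.le hz2 ht1
    have hk1 : k = 0 ∨ (k : ℝ) ≤ -1 := by
      rcases hk0.eq_or_lt with h | h
      · exact Or.inl h
      · right; exact_mod_cast (by omega : k ≤ -1)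
    have h0 : k = 0 → re (F (br (im z))) < fr.zp ∧ im z < b := fun h => by
      have := hz0 (by simp [hk, h])
      exact ⟨hlt _ hi.le this ht1, this⟩
    rcases hcase with ⟨c1, c2⟩ | ⟨c1, c2⟩
    · exfalso
      rcases hk1 with h | h
      · have := (h0 h).1
        rw [hre, h] at c1
        simp at c1
        linarith
      · linarith
    · refine Or.inr (Or.inr (Or.inr ?_))
      rcases c2 with c2 | c2
      · refine ⟨b, im z, Or.inl rfl, hi.le, ?_, ht1, h2, him ▸ c2.2⟩
        rcases hk1 with h | h
        · exact (h0 h).2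
        · linarith
      · exact ⟨b₂, im z, Or.inr rfl, hi.le, hz2, ht1, h2, him ▸ c2⟩

/-- A point of the branch that is mapped at least as high as a larger height `β` yields many periods if
the branch reaches a point to the right of `p₂` at the height `β`. If `0` is mapped to the interior of
a branch, then `[0, p₂]` plays the part of the real arc that covers itself. -/
theorem many_of_climb (hF : IsLifting 1 F) {β b₁ c : ℝ} (hβ1 : β ≤ 1) (h₀ : 0 ≤ b₁) (h₁ : b₁ < β)
    (h : re (F (br b₁)) < 1) (him : β ≤ im (F (br b₁))) (hc : 0 < c) (hcp : fr.p₂ ≤ c)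
    (hFβ : F (br β) = real c) : ManyPeriods F := by
  obtain ⟨j, hj⟩ := exists_re_eq_of_im_pos (lt_of_lt_of_le (lt_of_le_of_lt h₀ h₁) him)
  have hj0 : j ≤ 0 := by
    have : (j : ℝ) < 1 := by rw [← hj]; exact h
    have : j < 1 := by exact_mod_cast this
    omega
  have hj0' : (j : ℝ) ≤ 0 := by exact_mod_cast hj0
  have h3 : β ≤ eta j (F (br b₁)) := by rwa [eta_of_re hj]
  have h4 : eta j (F (br β)) < 0 := eta_neg_of_re_ne (by rw [hFβ, re_real]; linarith)
  rcases le_or_gt (eta j (F (br 0))) 0 with h5 | h5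
  · exact Or.inl fun n hn => mem_Per_of_climb hF h₀ h₁ hβ1 h3 h4.le h5 hn
  rw [br_zero] at h5
  have h6 := re_of_eta_nonneg h5.le
  have hne : F (real 0) ≠ real 0 := by
    intro h
    rw [h] at h5
    exact absurd h5 (not_lt.2 (eta_nonpos_of_im (by simp)))
  have hp2 : 0 < fr.p₂ := by
    rcases fr.deg with h | h
    · exact h.2.1
    · have := fr.map_p₁
      rw [h.1] at this
      exact absurd this hne
  have hp21 : fr.p₂ ≤ 1 := by linarith [fr.p₂_le_v, fr.v_le_zp, fr.zp_le_one]
  refine fr.many fun n hn =>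
    mem_Per_of_climb_of_hub hF h₀ h₁ hβ1 h3 h4 (m := 0) (p := 0) (q := fr.p₂) (hp := by simp)
      (hpq := hp2.le) (hq := by simpa using hp21) ?_ ?_ ?_ hn
  · exact covers_re_re hp2 0 (x := 0) (y := fr.p₂) le_rfl hp2.le hp2.le le_rfl
      (by simp [h6]; exact hj0) (by simp [fr.re_p₂])
  · intro s t hs hst ht
    refine covers_re_br j (x := fr.p₂) (y := 0) hp2.le le_rfl le_rfl hp2.le ?_ ?_
    · exact (eta_nonpos_of_im fr.im_p₂).trans hs
    · rwa [← br_zero]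
  · intro s hs hst hsj
    refine covers_br_re hp2 0 (x := s) (y := β) le_rfl hst hst le_rfl ?_ ?_
    · rw [hsj]; simpa using hj0'
    · rw [hFβ, re_real]; simpa using hcp

/-- The ways of leaving the region, with the same height `b` on all branches: the first height at which
the branch over `0` reaches `zp`. -/
theorem exit_of_lt_zp (hF : IsLifting 1 F) (hU : Up F) (hzp : 0 < fr.zp)
    (h0 : re (F (real 0)) < fr.zp) : ManyPeriods F ∨
    (∃ x, fr.u ≤ x ∧ x ≤ fr.p₁ + 1 ∧ fr.zp + 1 ≤ re (F (real x))) ∨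
    (∃ x, fr.p₁ ≤ x ∧ x ≤ fr.p₂ ∧ fr.zp ≤ re (F (real x)) ∧ fr.p₂ < re (F (real x))) ∨
    (∃ b, 0 < b ∧ b ≤ 1 ∧ F (br b) = real fr.zp ∧
      ∃ x, fr.p₁ ≤ x ∧ x ≤ fr.p₁ + 1 ∧ b ≤ im (F (real x))) := by
  have hz1 := fr.zp_le_one
  by_cases hex : ∃ t, 0 ≤ t ∧ t ≤ 1 ∧ fr.zp ≤ re (F (br t))
  · obtain ⟨b, hb, hb1, hFb, hlt⟩ := exists_first_height hF hzp hz1 h0 hex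
    rcases exit hF hU hzp hb le_rfl (fun t h h' _ => hlt t h h')
      (fun t h h' _ => (hlt t h h').trans_le hz1) with h | h | ⟨x, h1, h2, h3, -⟩ |
        ⟨β, b₁, h1, h2, h3, h4, h5, h6⟩
    · exact Or.inr (Or.inl h)
    · exact Or.inr (Or.inr (Or.inl h))
    · exact Or.inr (Or.inr (Or.inr ⟨b, hb, hb1, hFb, x, h1, h2, h3⟩))
    · obtain rfl : β = b := by tauto
      exact Or.inl (many_of_climb (fr := fr) hF hb1 h2 h3 h5 h6 hzp
        (fr.p₂_le_v.trans fr.v_le_zp) hFb)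
  · push Not at hex
    rcases exit hF hU hzp two_pos le_rfl (fun t h _ h' => hex t h h')
      (fun t h _ h' => (hex t h h').trans_le hz1) with h | h | ⟨x, h1, h2, h3, -⟩ |
        ⟨β, b₁, h1, h2, h3, h4, h5, h6⟩
    · exact Or.inr (Or.inl h)
    · exact Or.inr (Or.inr (Or.inl h))
    · linarith [im_le_one (F (real x))]
    · obtain rfl : β = 2 := by tauto
      linarith [im_le_one (F (br b₁))]

/-- The ways of leaving the region for a map that moves `0` to the left. On the branches further left,
only the first height `b₂` at which the branch over `0` reaches `1` matters; if a real point is mapped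
as high as that, `mem_Per_of_wrap` applies. -/
theorem exit_of_neg (hF : IsLifting 1 F) (hU : Up F) (hzp : 0 < fr.zp)
    (h0 : re (F (real 0)) < 0) : ManyPeriods F ∨
    (∃ x, fr.u ≤ x ∧ x ≤ fr.p₁ + 1 ∧ fr.zp + 1 ≤ re (F (real x))) ∨
    (∃ b, 0 < b ∧ b ≤ 1 ∧ F (br b) = real fr.zp ∧
      ∃ x, fr.u ≤ x ∧ x ≤ fr.p₁ + 1 ∧ b ≤ im (F (real x)) ∧ 1 ≤ re (F (real x))) := by
  have hz1 := fr.zp_le_one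
  by_cases hex : ∃ t, 0 ≤ t ∧ t ≤ 1 ∧ fr.zp ≤ re (F (br t))
  · obtain ⟨b, hb, hb1, hFb, hlt⟩ := exists_first_height hF hzp hz1 (h0.trans hzp) hex
    -- if the branch over `0` does not reach `1`, then any `b₂ > 1` will do
    obtain ⟨b₂, hb₂, hlt₂, hF₂⟩ : ∃ b₂, b ≤ b₂ ∧
        (∀ t, 0 ≤ t → t < b₂ → t ≤ 1 → re (F (br t)) < 1) ∧ (b₂ ≤ 1 → F (br b₂) = real 1) := by
      by_cases hex₂ : ∃ t, 0 ≤ t ∧ t ≤ 1 ∧ 1 ≤ re (F (br t))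
      · obtain ⟨b₂, h1, h2, h3, h4⟩ := exists_first_height hF one_pos le_rfl (h0.trans one_pos) hex₂
        refine ⟨b₂, ?_, fun t h h' _ => h4 t h h', fun _ => h3⟩
        by_contra! h
        have := hlt b₂ h1.le h
        rw [h3, re_real] at this
        linarith
      · push Not at hex₂
        exact ⟨2, by linarith, fun t h _ h' => hex₂ t h h', fun h => by norm_num at h⟩
    rcases exit hF hU hzp hb hb₂ (fun t h h' _ => hlt t h h') hlt₂ with h | ⟨x, h1, h2, h3, h4⟩ |
        ⟨x, h1, h2, h3, h4⟩ | ⟨β, b₁, h1, h2, h3, h4, h5, h6⟩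
    · exact Or.inr (Or.inl h)
    · exfalso
      rcases le_total x 0 with hx | hx
      · linarith [fr.left_neg h0 x h1 hx, fr.p₂_nonneg]
      · linarith [fr.right_neg h0.le x hx h2]
    · rcases h4 with h4 | ⟨h4, h5⟩
      · have hb₂1 : b₂ ≤ 1 := h4.trans (im_le_one _)
        have hFb₂ := hF₂ hb₂1
        obtain ⟨t, ht, htb, hFt⟩ := exists_height_re_lt hF h0 (hb.trans_le hb₂)
        exact Or.inl (Or.inl fun n hn => mem_Per_of_wrap hF hb₂1 h4 (c := 0) ht htb.le
          (hb.trans_le hb₂) le_rfl (by simpa using hFt.le) (by simp [hFb₂]) hn)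
      rcases le_or_gt fr.u x with hu | hu
      · exact Or.inr (Or.inr ⟨b, hb, hb1, hFb, x, hu, h2, h3, h5 hu⟩)
      rcases le_or_gt fr.v x with hv | hv
      · have := (fr.mid x hv hu.le).1
        linarith
      rcases le_or_gt fr.p₂ x with hp | hp
      · exact Or.inl (many_of_v_branch hF (by linarith [fr.p₂_nonneg, fr.p₂_le_v]) hb hb1 hFb hp
          hv.le h3)
      rcases le_or_gt 0 x with hx | hx
      · exact Or.inl (many_of_right_branch hF h0.le hb hb1 hFb hx hp.le h3)
      · linarith [fr.left_neg h0 x h1 hx.le]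
    · have hβ1 : β ≤ 1 := h6.trans (im_le_one _)
      rcases h1 with rfl | rfl
      · exact Or.inl (many_of_climb (fr := fr) hF hβ1 h2 h3 h5 h6 hzp
          (fr.p₂_le_v.trans fr.v_le_zp) hFb)
      · exact Or.inl (many_of_climb (fr := fr) hF hβ1 h2 h3 h5 h6 one_pos
          (fr.p₂_le_v.trans (fr.v_le_zp.trans hz1)) (hF₂ hβ1))
  · push Not at hex
    rcases exit hF hU hzp two_pos le_rfl (fun t h _ h' => hex t h h')
      (fun t h _ h' => (hex t h h').trans_le hz1) with h | ⟨x, h1, h2, h3, h4⟩ |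
        ⟨x, h1, h2, h3, -⟩ | ⟨β, b₁, h1, h2, h3, h4, h5, h6⟩
    · exact Or.inr (Or.inl h)
    · exfalso
      rcases le_total x 0 with hx | hx
      · linarith [fr.left_neg h0 x h1 hx, fr.p₂_nonneg]
      · linarith [fr.right_neg h0.le x hx h2]
    · linarith [im_le_one (F (real x))]
    · obtain rfl : β = 2 := by tauto
      linarith [im_le_one (F (br b₁))]

end Frame

namespace Frame

variable {fr : Frame F}

/-! ### Combining the two directions of escape -/

/-- For a map that does not move `0` to the left, a point `v₁` of `[p₂, v]` that is mapped to the left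
of `zm - 1`, or at least as high as a height at which the branch reaches `zm - 1`, can be combined
with every way of escaping to the right. -/
theorem many_of_turn (hF : IsLifting 1 F) (hU : Up F) (h0 : 0 ≤ re (F (real 0))) {v₁ : ℝ}
    (hzm : fr.zm < 1) (hv : fr.p₂ ≤ v₁) (hv' : v₁ ≤ fr.v)
    (h : re (F (real v₁)) ≤ fr.zm - 1 ∨ ∃ b, 0 < b ∧ b ≤ 1 ∧ F (br b) = real (fr.zm - 1) ∧
      b ≤ im (F (real v₁)) ∧ (0 < re (F (real 0)) → re (F (real v₁)) ≤ 0)) : ManyPeriods F := by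
  have hp2 := fr.p₂_nonneg
  obtain ⟨e₁, e₂, e₃⟩ := fr.turn hv hv' (by
    rcases h with h | ⟨b, hb, -, -, h, -⟩
    · left; linarith
    · right; linarith)
  have hz1 := fr.zp_le_one
  have hzz := fr.zp_le_zm
  have hzu := fr.zm_le_u
  have hu := fr.u_le
  have hp1 := fr.p₁_nonpos
  have hleft : ∀ x, fr.p₁ ≤ x → x ≤ 0 → v₁ ≤ re (F (real x)) → ManyPeriods F := by
    intro x hx hx' hFx
    rcases h with h | ⟨b, hb, hb1, hFb, h, -⟩
    · exact many_of_left_reach_of_turn_re hF e₁ e₂ e₃ h hx hx' hFx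
    · exact many_of_left_reach_of_turn_im hF h0 e₁ e₂ e₃ hb hb1 hFb h hx hx' hFx
  rcases le_or_gt v₁ (re (F (real 0))) with hf | hf
  · exact hleft 0 hp1 le_rfl hf
  have hright : 0 < re (F (real 0)) → ∀ x, 0 ≤ x → x ≤ fr.p₂ → fr.zp ≤ re (F (real x)) →
      ManyPeriods F := by
    intro h0 x hx hx' hFx
    refine many_of_right_reach hF e₁ e₂ e₃ ?_ hx hx' hFx
    rcases h with h | ⟨b, hb, hb1, hFb, h, h'⟩
    · linarith
    · exact h' h0
  rcases exit_of_lt_zp (fr := fr) hF hU (by linarith) (by linarith) with h' | ⟨x, h1, h2, h3⟩ |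
    ⟨x, h1, h2, h3, h4⟩ | ⟨β, hβ, hβ1, hFβ, x, h1, h2, h3⟩
  · exact h'
  · obtain ⟨g₁, g₂, g₃⟩ := fr.turn' hF h1 h2 (Or.inl (by linarith))
    rcases h with h | ⟨b, hb, hb1, hFb, h, -⟩
    · exact many_of_turns_re hF e₁ e₂ e₃ h g₁ g₂ g₃ h3
    · exact many_of_turns_im hF h0 e₁ e₂ e₃ hb hb1 hFb h g₁ g₂ g₃ h3
  · rcases le_total x 0 with hx | hx
    · exact hleft x h1 hx (by linarith)
    · rcases h0.eq_or_lt with h0 | h0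
      · linarith [fr.right_neg h0.ge x hx h2]
      · exact hright h0 x hx h2 h3
  · -- a point that is mapped to the larger of two heights is also mapped to the smaller one
    have hcomp : ∀ b, b ≤ im (F (real v₁)) → β ≤ b → ManyPeriods F := fun b h h' =>
      many_of_v_branch hF (by linarith) hβ hβ1 hFβ hv hv' (h'.trans h)
    rcases le_or_gt fr.u x with hux | hux
    · obtain ⟨g₁, g₂, g₃⟩ := fr.turn' hF hux h2 (Or.inr (by linarith))
      rcases h with h | ⟨b, hb, hb1, hFb, h, -⟩
      · exact many_of_u_branch_of_turn hF e₁ e₂ e₃ hf h hβ hβ1 hFβ g₁ g₂ h3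
      · rcases le_total β b with hbb | hbb
        · exact hcomp b h hbb
        · exact many_of_u_branch hF (by linarith) hb hb1 hFb hux h2 (hbb.trans h3)
    rcases le_or_gt fr.v x with hvx | hvx
    · have := (fr.mid x hvx hux.le).1
      linarith
    rcases le_or_gt fr.p₂ x with hpx | hpx
    · exact many_of_v_branch hF (by linarith) hβ hβ1 hFβ hpx hvx.le h3
    rcases le_or_gt 0 x with hx | hx
    · rcases h0.eq_or_lt with h0 | h0
      · exact many_of_right_branch hF h0.ge hβ hβ1 hFβ hx hpx.le h3
      · refine hright h0 x hx hpx.le ?_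
        obtain ⟨j, hj⟩ := exists_re_eq_of_im_pos (hβ.trans_le h3)
        have h5 := fr.right_pos h0 x hx hpx.le
        have h6 : re (F (real x)) ≠ 0 := by
          intro h6
          obtain rfl : x = 0 := by linarith
          linarith
        have h7 : (0 : ℝ) < j := by
          rw [← hj]; exact lt_of_le_of_ne (hx.trans h5) (Ne.symm h6)
        have h7 : 0 < j := by exact_mod_cast h7
        have h7 : (1 : ℝ) ≤ j := by exact_mod_cast h7
        linarith
    · rcases h with h | ⟨b, hb, hb1, hFb, h, -⟩
      · exact many_of_left_branch_of_turn hF e₂ e₃ h0 hf h hβ hβ1 hFβ h1 hx.le h3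
      · rcases le_total β b with hbb | hbb
        · exact hcomp b h hbb
        · exact many_of_left_branch hF h0 hb hb1 hFb h1 hx.le (hbb.trans h3)

/-- The mirror image, for a map that fixes `0` or moves it vertically. -/
theorem many_of_turn_reflect (hF : IsLifting 1 F) (hD : Up (SigmaMap.reflect F)) (h0 : re (F (real 0)) = 0)
    {u₁ : ℝ} (hzp : 0 < fr.zp) (hu : fr.u ≤ u₁) (hu' : u₁ ≤ fr.p₁ + 1)
    (h : fr.zp + 1 ≤ re (F (real u₁)) ∨ ∃ b, 0 < b ∧ b ≤ 1 ∧ F (br b) = real fr.zp ∧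
      b ≤ im (F (real u₁))) : ManyPeriods F := by
  rw [← manyPeriods_reflect]
  have e := reflect_real_one_sub hF u₁
  refine many_of_turn (fr := fr.reflect hF) hF.reflect hD (by simp [h0]) (v₁ := 1 - u₁) ?_ ?_ ?_ ?_
  · simpa [reflect] using hzp
  · simp [reflect]; linarith
  · simp [reflect]; linarith
  · rw [e]
    simp only [reflect, re_translate, im_translate, re_refl, im_refl]
    rcases h with h | ⟨b, hb, hb1, hFb, h⟩
    · left; push_cast; linarith
    · exact Or.inr ⟨b, hb, hb1, by simp [hFb], h, by simp [h0]⟩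

/-- If `0` is moved to the right, then escaping to the left requires a point `v₁` as in
`many_of_turn`. -/
theorem many_of_pos (fr : Frame F) (hF : IsLifting 1 F) (hU : Up F) (hD : Up (SigmaMap.reflect F))
    (h0 : 0 < re (F (real 0))) : ManyPeriods F := by
  have hzm : fr.zm < 1 := by
    rcases fr.deg with h | h
    · linarith [fr.zm_le_u, fr.u_le]
    · have := fr.re_p₁
      rw [h.1] at this
      linarith
  rcases exit_of_neg (fr := fr.reflect hF) hF.reflect hD (by simpa [reflect] using hzm)
    (by simpa using h0) with h | ⟨x, h1, h2, h3⟩ | ⟨b, hb, hb1, hFb, x, h1, h2, h3, h4⟩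
  · exact manyPeriods_reflect.1 h
  all_goals
    have e := reflect_real_one_sub hF (1 - x)
    rw [sub_sub_cancel] at e
    simp only [reflect] at h1 h2
  · rw [e] at h3
    simp [reflect] at h3
    exact many_of_turn hF hU h0.le hzm (v₁ := 1 - x) (by linarith) (by linarith)
      (Or.inl (by linarith))
  · rw [e] at h3 h4
    simp at h3 h4
    refine many_of_turn hF hU h0.le hzm (v₁ := 1 - x) (by linarith) (by linarith)
      (Or.inr ⟨b, hb, hb1, ?_, h3, fun _ => by linarith⟩)
    have := congrArg refl hFb
    simpa [reflect] using this

/-- If `0` is fixed or mapped to the branch over `0`, then an orbit can also escape to the left from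
`[0, p₂]`. -/
theorem many_of_eq_zero (fr : Frame F) (hF : IsLifting 1 F) (hU : Up F) (hD : Up (SigmaMap.reflect F))
    (h0 : re (F (real 0)) = 0) (hzm : fr.zm < 1) : ManyPeriods F := by
  have hp1 := fr.p₁_nonpos
  have hp2 := fr.p₂_nonneg
  have hpv := fr.p₂_le_v
  have hvz := fr.v_le_zp
  have hzz := fr.zp_le_zm
  have hz1 := fr.zp_le_one
  have hzu := fr.zm_le_u
  have hu := fr.u_le
  -- with a point of `[0, p₂]` at hand the two sides of the branch interact
  have key : ∀ r, 0 ≤ r → r ≤ fr.p₂ → (re (F (real r)) < fr.p₁ ∨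
      ∃ b, 0 < b ∧ b ≤ 1 ∧ F (br b) = real (fr.zm - 1) ∧ b ≤ im (F (real r))) →
      ManyPeriods F := by
    intro r hr hr' h
    have hp2 : 0 < fr.p₂ := by
      refine lt_of_le_of_ne hp2 fun e => ?_
      have : r = fr.p₂ := by linarith
      rw [this, fr.re_p₂, fr.im_p₂] at h
      rcases h with h | ⟨b, hb, -, -, h⟩ <;> linarith
    rcases exit_of_lt_zp (fr := fr) hF hU (by linarith) (by linarith) with h' | ⟨x, h1, h2, h3⟩ |
      ⟨x, h1, h2, h3, h4⟩ | ⟨β, hβ, hβ1, hFβ, x, h1, h2, h3⟩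
    · exact h'
    · exact many_of_turn_reflect hF hD h0 (by linarith) h1 h2 (Or.inl h3)
    · rcases le_total x 0 with hx | hx
      · rcases h with h | ⟨b, hb, hb1, hFb, h⟩
        · exact many_of_left_right hF h0 h1 hx h4 hr hr' h
        · exact many_of_left_reach_right_branch hF h0 h1 hx h4 hb hb1 hFb hr hr' h
      · linarith [fr.right_neg h0.le x hx h2]
    · rcases le_or_gt fr.u x with hux | hux
      · exact many_of_turn_reflect hF hD h0 (by linarith) hux h2 (Or.inr ⟨β, hβ, hβ1, hFβ, h3⟩)
      rcases le_or_gt fr.v x with hvx | hvx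
      · have := (fr.mid x hvx hux.le).1
        linarith
      rcases le_or_gt fr.p₂ x with hpx | hpx
      · exact many_of_v_branch hF (by linarith) hβ hβ1 hFβ hpx hvx.le h3
      rcases le_or_gt 0 x with hx | hx
      · exact many_of_right_branch hF h0.le hβ hβ1 hFβ hx hpx.le h3
      rcases h with h | ⟨b, hb, hb1, hFb, h⟩
      · rw [← manyPeriods_reflect]
        refine many_of_left_reach_right_branch (fr := fr.reflect hF) hF.reflect (x := -r) (r := -x)
          (b := β) (by simp [h0]) ?_ (by linarith) ?_ hβ hβ1 ?_ (by linarith) ?_ ?_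
        · simp [reflect]; linarith
        · simp [reflect]; linarith
        · simp [reflect, hFβ]
        · simp [reflect]; linarith
        · simpa using h3
      · rcases le_total β b with hbb | hbb
        · exact many_of_right_branch hF h0.le hβ hβ1 hFβ hr hr' (hbb.trans h)
        · exact many_of_left_branch hF h0.ge hb hb1 hFb h1 hx.le (hbb.trans h3)
  rcases exit_of_lt_zp (fr := fr.reflect hF) hF.reflect hD (by simpa [reflect] using hzm)
    (by simp [h0, reflect]; linarith) with h' | ⟨x, h1, h2, h3⟩ |
      ⟨x, h1, h2, h3, h4⟩ | ⟨b, hb, hb1, hFb, x, h1, h2, h3⟩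
  · exact manyPeriods_reflect.1 h'
  · have e := reflect_real_one_sub hF (1 - x)
    rw [sub_sub_cancel] at e
    simp only [reflect] at h1 h2
    rw [e] at h3
    simp [reflect] at h3
    exact many_of_turn hF hU h0.ge hzm (v₁ := 1 - x) (by linarith) (by linarith)
      (Or.inl (by linarith))
  · simp [reflect] at h1 h2 h4
    rcases le_total 0 (-x) with hx | hx
    · exact key (-x) hx (by linarith) (Or.inl (by linarith))
    · linarith [fr.left_pos h0.ge (-x) (by linarith) hx]
  · have hFb' : F (br b) = real (fr.zm - 1) := by
      have := congrArg refl hFb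
      simpa [reflect] using this
    simp [reflect] at h1 h2 h3
    rcases le_or_gt 0 (-x) with hx | hx
    · exact key (-x) hx (by linarith) (Or.inr ⟨b, hb, hb1, hFb', h3⟩)
    rcases le_or_gt fr.p₁ (-x) with hpx | hpx
    · exact many_of_left_branch hF h0.ge hb hb1 hFb' hpx hx.le h3
    have h3' : b ≤ im (F (real (1 - x))) := by
      have := hF.im_real_add 1 (-x)
      rw [Int.cast_one, neg_add_eq_sub] at this
      rwa [this]
    rcases le_or_gt (1 - x) fr.v with hvx | hvx
    · exact many_of_turn hF hU h0.ge hzm (v₁ := 1 - x) (by linarith) hvx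
        (Or.inr ⟨b, hb, hb1, hFb', h3', fun h => by linarith⟩)
    rcases le_or_gt fr.u (1 - x) with hux | hux
    · obtain ⟨g₁, g₂, -⟩ := fr.turn' hF hux (by linarith) (Or.inr (by linarith))
      exact many_of_u_branch hF (by linarith) hb hb1 hFb' hux (by linarith) h3'
    · have := (fr.mid (1 - x) hvx.le hux.le).1
      linarith

/-- A map with a frame and with unbounded orbits in both directions has many periods, provided that it
does not move `0` to the left. -/
theorem many_of_nonneg (hF : IsLifting 1 F) (hU : Up F) (hD : Up (SigmaMap.reflect F))
    (fr : Frame F) (h0 : 0 ≤ re (F (real 0))) : ManyPeriods F := by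
  rcases h0.lt_or_eq with h0 | h0
  · exact many_of_pos (fr := fr) hF hU hD h0
  have hp1 := fr.p₁_nonpos
  have hzz := fr.zp_le_zm
  have hzu := fr.zm_le_u
  have hu := fr.u_le
  have hpv := fr.p₂_le_v
  have hvz := fr.v_le_zp
  have hp2 := fr.p₂_nonneg
  rcases lt_or_ge fr.zm 1 with hzm | hzm
  · exact many_of_eq_zero (fr := fr) hF hU hD h0.symm hzm
  rcases lt_or_ge 0 fr.zp with hzp | hzp
  · rw [← manyPeriods_reflect]
    refine many_of_eq_zero (fr := fr.reflect hF) hF.reflect hD (by rwa [reflect_reflect])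
      (by simp [← h0]) (by simpa [reflect] using hzp)
  -- all real cells are invariant, and no orbit can escape
  exfalso
  obtain ⟨z, ⟨hz, hzr⟩, hFz⟩ := hU.exists_exit hF (Z := {z | im z = 0 ∧ re z ≤ 0}) (C := 0)
    (fun z hz => hz.2) (fun x => ⟨-⌈x⌉, by
      have := Int.le_ceil x
      simp only [Set.mem_ofPred_eq, re_real, im_real]
      push_cast
      exact ⟨trivial, by linarith⟩⟩)
  apply hFz
  have h1 := Int.ceil_lt_add_one (re z)
  have h2 := Int.le_ceil (re z)
  have h3 := fr.mid (re z - ⌈re z⌉ + 1) (by linarith) (by linarith)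
  have h4 : z = translate (⌈re z⌉ - 1) (real (re z - ⌈re z⌉ + 1)) :=
    ext_re_im (by simp) (by simp [hz])
  have h5 : (⌈re z⌉ : ℝ) ≤ 0 := by exact_mod_cast Int.ceil_le.2 (by simpa using hzr)
  rw [h4, hF.apply_translate]
  simp only [Set.mem_ofPred_eq, re_translate, im_translate]
  refine ⟨h3.1, ?_⟩
  push_cast
  linarith

end Frame

/-! ### Existence of frames -/

theorem nonneg_of_no_zero {g : ℝ → ℝ} (hg : Continuous g) {a b y : ℝ}
    (h : ∀ x, a < x → x < b → g x ≠ 0) (ha : a ≤ y) (hb : y ≤ b) (hy : 0 < g y) {x : ℝ}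
    (hx : a ≤ x) (hx' : x ≤ b) : 0 ≤ g x := by
  by_contra! hlt
  obtain ⟨z, hz, e⟩ := intermediate_value_uIcc (a := x) (b := y) hg.continuousOn
    (Set.Icc_subset_uIcc (⟨hlt.le, hy.le⟩ : (0 : ℝ) ∈ Set.Icc (g x) (g y)))
  have hzx : z ≠ x := by rintro rfl; linarith
  have hzy : z ≠ y := by rintro rfl; linarith
  rcases le_total x y with hxy | hxy
  · rw [Set.uIcc_of_le hxy] at hz
    exact h z (hx.trans_lt (lt_of_le_of_ne hz.1 hzx.symm)) (lt_of_lt_of_le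
      (lt_of_le_of_ne hz.2 hzy) hb) e
  · rw [Set.uIcc_of_ge hxy] at hz
    exact h z (ha.trans_lt (lt_of_le_of_ne hz.1 hzy.symm)) (lt_of_lt_of_le
      (lt_of_le_of_ne hz.2 hzx) hx') e

theorem isClosed_map_eq (hF : IsLifting 1 F) {g : ℝ → S} (hg : Continuous g) :
    IsClosed {x : ℝ | F (real x) = g x} :=
  isClosed_eq (hF.1.comp continuous_real) hg

/-- Two fixed points around the branch over `0`, with the appropriate signs of the displacement in
between, belong to a frame, unless a horseshoe on the real axis yields all periods. -/
theorem exists_frame (hF : IsLifting 1 F) {p₁ p₂ : ℝ} (hp₁ : p₁ ≤ 0) (hp₂ : 0 ≤ p₂)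
    (hpp : p₂ ≤ p₁ + 1)
    (deg : (p₁ < 0 ∧ 0 < p₂ ∧ F (real 0) ≠ real 0) ∨ (p₁ = 0 ∧ p₂ = 0))
    (map_p₁ : F (real p₁) = real p₁) (map_p₂ : F (real p₂) = real p₂)
    (left_pos : 0 ≤ re (F (real 0)) → ∀ x, p₁ ≤ x → x ≤ 0 → x ≤ re (F (real x)))
    (right_neg : re (F (real 0)) ≤ 0 → ∀ x, 0 ≤ x → x ≤ p₂ → re (F (real x)) ≤ x)
    (right_pos : 0 < re (F (real 0)) → ∀ x, 0 ≤ x → x ≤ p₂ → x ≤ re (F (real x)))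
    (left_neg : re (F (real 0)) < 0 → ∀ x, p₁ ≤ x → x ≤ 0 → re (F (real x)) ≤ x) :
    (∀ n, 2 ≤ n → n ∈ Per F) ∨ Nonempty (Frame F) := by
  have map_q : F (real (p₁ + 1)) = real (p₁ + 1) := by
    have := hF.apply_real_add 1 p₁
    rw [map_p₁, translate_real] at this
    simpa using this
  have hc := continuous_re_real hF
  have hk : Continuous fun x => kap 0 (F (real x)) :=
    (continuous_kap 0).comp (hF.1.comp continuous_real)
  obtain ⟨v, ⟨⟨hv, hv'⟩, map_v⟩, hvmax⟩ := (isCompact_Icc.inter_right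
    (isClosed_map_eq hF (continuous_const (y := real p₂)))).exists_isGreatest
    (⟨p₂, ⟨le_rfl, hpp⟩, map_p₂⟩ : (Set.Icc p₂ (p₁ + 1) ∩ _).Nonempty)
  obtain ⟨u, ⟨⟨hu, hu'⟩, map_u⟩, humin⟩ := (isCompact_Icc.inter_right
    (isClosed_map_eq hF (continuous_const (y := real (p₁ + 1))))).exists_isLeast
    (⟨p₁ + 1, ⟨hpp, le_rfl⟩, map_q⟩ : (Set.Icc p₂ (p₁ + 1) ∩ _).Nonempty)
  have map_v : F (real v) = real p₂ := map_v
  have map_u : F (real u) = real (p₁ + 1) := map_u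
  have re_p₂ : re (F (real p₂)) = p₂ := by rw [map_p₂, re_real]
  have re_q : re (F (real (p₁ + 1))) = p₁ + 1 := by rw [map_q, re_real]
  have re_v : re (F (real v)) = p₂ := by rw [map_v, re_real]
  have re_u : re (F (real u)) = p₁ + 1 := by rw [map_u, re_real]
  by_cases hV : ∀ x, p₂ ≤ x → x ≤ v → x = p₂ ∨ re (F (real x)) < v
  swap
  · left
    push Not at hV
    obtain ⟨w, h1, h2, h3, h4⟩ := hV
    have hpw : p₂ < w := lt_of_le_of_ne h1 (Ne.symm h3)
    have hwv : w < v := by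
      refine lt_of_le_of_ne h2 fun e => ?_
      rw [e, re_v] at h4
      linarith
    obtain ⟨d, hd, e⟩ := intermediate_value_Icc' h2 hc.continuousOn
      (⟨by rw [re_v]; exact h1, by linarith⟩ :
        w ∈ Set.Icc (re (F (real v))) (re (F (real w))))
    simp only at e
    have hwd : w < d := by
      refine lt_of_le_of_ne hd.1 fun e' => ?_
      rw [← e'] at e
      linarith
    have hdv : d < v := by
      refine lt_of_le_of_ne hd.2 fun e' => ?_
      rw [e', re_v] at e
      linarith
    have hvp : v < p₁ + 1 := by
      refine lt_of_le_of_ne hv' fun e' => ?_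
      rw [e', re_q] at re_v
      linarith
    intro n hn
    refine mem_Per_of_self hF (X := Arc.re 0 d v (by simp; linarith) hdv.le (by simp; linarith))
      (Y := Arc.re 0 p₂ w (by simpa using hp₂) h1 (by simp; linarith)) (l := [])
      ?_ ?_ ?_ (Arc.disj_re_re hwd (by linarith)).symm (by simp) (by simpa using hn)
    · exact covers_re_re hpw 0 (x := v) (y := d) hdv.le le_rfl le_rfl hdv.le (by simp [re_v])
        (by simp [e])
    · exact covers_re_re hpw 0 (x := p₂) (y := w) le_rfl h1 h1 le_rfl (by simp [re_p₂])
        (by simp; linarith)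
    · exact covers_re_re hdv 0 (x := p₂) (y := w) le_rfl h1 h1 le_rfl (by simp [re_p₂]; linarith)
        (by simp; linarith)
  by_cases hU : ∀ x, u ≤ x → x ≤ p₁ + 1 → x = p₁ + 1 ∨ u < re (F (real x))
  swap
  · left
    push Not at hU
    obtain ⟨w, h1, h2, h3, h4⟩ := hU
    have hwp : w < p₁ + 1 := lt_of_le_of_ne h2 h3
    have huw : u < w := by
      refine lt_of_le_of_ne h1 fun e => ?_
      rw [← e, re_u] at h4
      linarith
    obtain ⟨d, hd, e⟩ := intermediate_value_Icc' h1 hc.continuousOn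
      (⟨by linarith, by rw [re_u]; exact h2⟩ :
        w ∈ Set.Icc (re (F (real w))) (re (F (real u))))
    simp only at e
    have hdw : d < w := by
      refine lt_of_le_of_ne hd.2 fun e' => ?_
      rw [e'] at e
      linarith
    have hud : u < d := by
      refine lt_of_le_of_ne hd.1 fun e' => ?_
      rw [← e', re_u] at e
      linarith
    have hpu : p₂ < u := by
      refine lt_of_le_of_ne hu fun e' => ?_
      rw [← e', re_p₂] at re_u
      linarith
    intro n hn
    refine mem_Per_of_self hF (X := Arc.re 0 u d (by simp; linarith) hud.le (by simp; linarith))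
      (Y := Arc.re 0 w (p₁ + 1) (by simp; linarith) h2 (by simp; linarith)) (l := [])
      ?_ ?_ ?_ (Arc.disj_re_re hdw (by linarith)) (by simp) (by simpa using hn)
    · exact covers_re_re hwp 0 (x := d) (y := u) hud.le le_rfl le_rfl hud.le (by simp [e])
        (by simp [re_u])
    · exact covers_re_re hwp 0 (x := w) (y := p₁ + 1) le_rfl h2 h2 le_rfl (by simp; linarith)
        (by simp [re_q])
    · exact covers_re_re hud 0 (x := w) (y := p₁ + 1) le_rfl h2 h2 le_rfl (by simp; linarith)
        (by simp [re_q]; linarith)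
  right
  have hvu : v ≤ u := by
    by_contra! h
    rcases hV u hu h.le with h' | h'
    · rw [h', re_p₂] at re_u
      linarith
    · linarith
  have hreal : ∀ x, p₂ ≤ kap 0 (F (real x)) → kap 0 (F (real x)) ≤ p₁ + 1 →
      real (kap 0 (F (real x))) = F (real x) := fun x h h' =>
    eq_real_kap (m := 0) (by simp; linarith) (by simp; linarith)
  have mid : ∀ x, v ≤ x → x ≤ u →
      im (F (real x)) = 0 ∧ p₂ ≤ re (F (real x)) ∧ re (F (real x)) ≤ p₁ + 1 := by
    intro x h1 h2
    have h3 : p₂ ≤ kap 0 (F (real x)) := by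
      by_contra! h
      obtain ⟨y, hy, e⟩ := intermediate_value_Icc (h2.trans hu') hk.continuousOn
        (⟨h.le, by simpa only [map_q, kap_real] using hpp⟩ :
          p₂ ∈ Set.Icc (kap 0 (F (real x))) (kap 0 (F (real (p₁ + 1)))))
      simp only at e
      have hyv : y ≤ v := hvmax ⟨⟨by linarith [hy.1], hy.2⟩, by
        show F (real y) = real p₂
        rw [← hreal y e.ge (e.le.trans hpp), e]⟩
      have hxy : x = y := by linarith [hy.1]
      rw [← hxy] at e
      linarith
    have h4 : kap 0 (F (real x)) ≤ p₁ + 1 := by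
      by_contra! h
      obtain ⟨y, hy, e⟩ := intermediate_value_Icc (hv.trans h1) hk.continuousOn
        (⟨by simpa only [map_p₂, kap_real] using hpp, h.le⟩ :
          p₁ + 1 ∈ Set.Icc (kap 0 (F (real p₂))) (kap 0 (F (real x))))
      simp only at e
      have hyu : u ≤ y := humin ⟨⟨hy.1, by linarith [hy.2]⟩, by
        show F (real y) = real (p₁ + 1)
        rw [← hreal y (hpp.trans e.ge) e.le, e]⟩
      have hxy : x = y := by linarith [hy.2]
      rw [← hxy] at e
      linarith
    have h5 := hreal x h3 h4
    refine ⟨by rw [← h5, im_real], ?_, ?_⟩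
    · rw [← h5, re_real]; exact h3
    · rw [← h5, re_real]; exact h4
  have hg : Continuous fun x => re (F (real x)) - x := hc.sub continuous_id
  have hclosed : IsClosed {x : ℝ | re (F (real x)) - x = 0} := isClosed_eq hg continuous_const
  have hgv : re (F (real v)) - v ≤ 0 := by linarith
  have hgu : 0 ≤ re (F (real u)) - u := by linarith
  obtain ⟨z, hz, hz0⟩ := intermediate_value_Icc hvu hg.continuousOn 
    (⟨hgv, hgu⟩ : (0 : ℝ) ∈ Set.Icc (re (F (real v)) - v) (re (F (real u)) - u))
  have hne : (Set.Icc v u ∩ {x : ℝ | re (F (real x)) - x = 0}).Nonempty := ⟨z, hz, hz0⟩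
  obtain ⟨zp, ⟨hzp, hzp0⟩, hzpmin⟩ := (isCompact_Icc.inter_right hclosed).exists_isLeast hne
  obtain ⟨zm, ⟨hzm, hzm0⟩, hzmmax⟩ := (isCompact_Icc.inter_right hclosed).exists_isGreatest hne
  have hfix : ∀ x, v ≤ x → x ≤ u → re (F (real x)) - x = 0 → F (real x) = real x := by
    intro x h1 h2 h3
    rw [eq_real (mid x h1 h2).1, sub_eq_zero.1 h3]
  refine ⟨⟨p₁, p₂, v, u, zp, zm, hp₁, hp₂, hv, hzp.1, hzpmin ⟨hzm, hzm0⟩, hzm.2, hu', deg, map_p₁,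
    map_p₂, map_v, map_u, hfix zp hzp.1 hzp.2 hzp0, hfix zm hzm.1 hzm.2 hzm0, ?_, ?_, mid, hV, hU,
    left_pos, right_neg, right_pos, left_neg⟩⟩
  · intro x h1 h2
    by_contra! h
    obtain ⟨y, hy, e⟩ := intermediate_value_Icc h1 hg.continuousOn
      (⟨hgv, by linarith⟩ : (0 : ℝ) ∈ Set.Icc (re (F (real v)) - v) (re (F (real x)) - x))
    have := hzpmin ⟨⟨hy.1, by linarith [hy.2, hzp.2]⟩, e⟩
    linarith [hy.2]
  · intro x h1 h2
    by_contra! h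
    obtain ⟨y, hy, e⟩ := intermediate_value_Icc h2 hg.continuousOn
      (⟨by linarith, hgu⟩ : (0 : ℝ) ∈ Set.Icc (re (F (real x)) - x) (re (F (real u)) - u))
    have := hzmmax ⟨⟨by linarith [hy.1, hzm.1], hy.2⟩, e⟩
    linarith [hy.1]

/-- A map whose real points are not all moved in the same direction has a frame, or all periods
except possibly `1`. -/
theorem exists_frame_of_re_eq (hF : IsLifting 1 F) {x₀ : ℝ} (hx₀ : re (F (real x₀)) = x₀) :
    (∀ n, 2 ≤ n → n ∈ Per F) ∨ Nonempty (Frame F) := by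
  by_cases h0 : F (real 0) = real 0
  · have h00 : re (F (real 0)) = 0 := by rw [h0, re_real]
    refine exists_frame hF le_rfl le_rfl (by norm_num) (Or.inr ⟨rfl, rfl⟩) h0 h0 ?_ ?_ ?_ ?_
    · intro _ x h h'
      obtain rfl := le_antisymm h' h
      exact h00.ge
    · intro _ x h h'
      obtain rfl := le_antisymm h' h
      exact h00.le
    · intro h
      linarith
    · intro h
      linarith
  have hc := continuous_re_real hF
  have hg : Continuous fun x => re (F (real x)) - x := hc.sub continuous_id
  have hg' : Continuous fun x => -(re (F (real x)) - x) := hg.neg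
  -- points close to `0` on either side
  have hnear : re (F (real 0)) = 0 → ∀ c, 0 < c → (∃ t, 0 < t ∧ t < c ∧ re (F (real t)) = 0) ∧
      ∃ t, 0 < t ∧ t < c ∧ re (F (real (-t))) = 0 := fun h c hc =>
    ⟨exists_re_eq_zero hF continuous_real rfl h h0 hc,
      exists_re_eq_zero hF (e := fun t => real (-t)) (by fun_prop) (by simp) h h0 hc⟩
  have hfix : ∀ (m : ℤ) (x : ℝ), m < x → x < m + 1 → re (F (real x)) = x → F (real x) = real x := by
    intro m x h1 h2 h3
    rw [eq_real (im_eq_zero_of_re (m := m) (z := F (real x)) (by rwa [h3]) (by rwa [h3])), h3]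
  obtain ⟨q, hq0, hq1, hq⟩ : ∃ q, 0 < q ∧ q < 1 ∧ re (F (real q)) = q := by
    have h1 := Int.floor_le x₀
    have h2 := Int.lt_floor_add_one x₀
    have h3 : re (F (real (x₀ - ⌊x₀⌋))) = x₀ - ⌊x₀⌋ := by
      have := hF.re_real_add (-⌊x₀⌋) x₀
      push_cast at this
      rw [← sub_eq_add_neg, ← sub_eq_add_neg] at this
      rw [this, hx₀]
    rcases h1.eq_or_lt with h | h
    · rw [h, sub_self] at h3
      obtain ⟨⟨s, hs, hs', hs0⟩, ⟨t, ht, ht', ht0⟩⟩ := hnear h3 (1 / 2) (by norm_num)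
      have ht1 : re (F (real (1 - t))) = 1 := by
        have := hF.re_real_add 1 (-t)
        rw [Int.cast_one, neg_add_eq_sub, ht0, zero_add] at this
        exact this
      obtain ⟨q, hq, e⟩ := intermediate_value_Icc (by linarith : s ≤ 1 - t) hg.continuousOn
        (⟨by rw [hs0]; linarith, by rw [ht1]; linarith⟩ :
          (0 : ℝ) ∈ Set.Icc (re (F (real s)) - s) (re (F (real (1 - t))) - (1 - t)))
      exact ⟨q, by linarith [hq.1], by linarith [hq.2], sub_eq_zero.1 e⟩
    · exact ⟨x₀ - ⌊x₀⌋, by linarith, by linarith, h3⟩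
  have hq := hfix 0 q (by simpa using hq0) (by simpa using hq1) hq
  have hq' : F (real (q - 1)) = real (q - 1) := by
    have := hF.apply_real_add (-1) q
    rw [hq, translate_real] at this
    simpa [← sub_eq_add_neg] using this
  have hcl := isClosed_map_eq hF continuous_real
  obtain ⟨p₂, ⟨⟨hp₂, hp₂'⟩, map_p₂⟩, hmin⟩ := (isCompact_Icc.inter_right hcl).exists_isLeast
    (⟨q, ⟨hq0.le, hq1.le⟩, hq⟩ : (Set.Icc 0 1 ∩ {x : ℝ | F (real x) = real x}).Nonempty)
  obtain ⟨p₁, ⟨⟨hp₁, hp₁'⟩, map_p₁⟩, hmax⟩ := (isCompact_Icc.inter_right hcl).exists_isGreatest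
    (⟨q - 1, ⟨by linarith, by linarith⟩, hq'⟩ :
      (Set.Icc (-1) 0 ∩ {x : ℝ | F (real x) = real x}).Nonempty)
  have map_p₁ : F (real p₁) = real p₁ := map_p₁
  have map_p₂ : F (real p₂) = real p₂ := map_p₂
  have h₁ : p₁ < 0 := lt_of_le_of_ne hp₁' fun e => h0 (by rw [e] at map_p₁; exact map_p₁)
  have h₂ : 0 < p₂ := lt_of_le_of_ne hp₂ fun e => h0 (by rw [← e] at map_p₂; exact map_p₂)
  have hpp : p₂ ≤ p₁ + 1 := by
    refine hmin ⟨⟨by linarith, by linarith⟩, ?_⟩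
    have := hF.apply_real_add 1 p₁
    rw [map_p₁, translate_real] at this
    simpa using this
  have hl : ∀ x, p₁ < x → x < 0 → re (F (real x)) - x ≠ 0 := fun x h h' e => by
    have := hmax ⟨⟨by linarith, h'.le⟩, hfix (-1) x (by push_cast; linarith) (by push_cast; linarith)
      (sub_eq_zero.1 e)⟩
    linarith
  have hr : ∀ x, 0 < x → x < p₂ → re (F (real x)) - x ≠ 0 := fun x h h' e => by
    have := hmin ⟨⟨h.le, by linarith⟩, hfix 0 x (by simpa using h) (by simp; linarith)
      (sub_eq_zero.1 e)⟩
    linarith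
  have hl' : ∀ x, p₁ < x → x < 0 → -(re (F (real x)) - x) ≠ 0 := fun x h h' =>
    neg_ne_zero.2 (hl x h h')
  have hr' : ∀ x, 0 < x → x < p₂ → -(re (F (real x)) - x) ≠ 0 := fun x h h' =>
    neg_ne_zero.2 (hr x h h')
  refine exists_frame hF hp₁' hp₂ hpp (Or.inl ⟨h₁, h₂, h0⟩) map_p₁ map_p₂ ?_ ?_ ?_ ?_
  · intro h x hx hx'
    rcases h.lt_or_eq with h | h
    · have := nonneg_of_no_zero hg hl (y := 0) h₁.le le_rfl (by simpa using h) hx hx'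
      linarith
    · obtain ⟨-, t, ht, ht', e⟩ := hnear h.symm (-p₁) (by linarith)
      have := nonneg_of_no_zero hg hl (y := -t) (by linarith) (by linarith) (by rw [e]; linarith)
        hx hx'
      linarith
  · intro h x hx hx'
    rcases h.lt_or_eq with h | h
    · have := nonneg_of_no_zero hg' hr' (y := 0) le_rfl h₂.le (by simpa using h) hx hx'
      linarith
    · obtain ⟨⟨t, ht, ht', e⟩, -⟩ := hnear h p₂ h₂
      have := nonneg_of_no_zero hg' hr' (y := t) (by linarith) (by linarith) (by rw [e]; linarith)
        hx hx'
      linarith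
  · intro h x hx hx'
    have := nonneg_of_no_zero hg hr (y := 0) le_rfl h₂.le (by simpa using h) hx hx'
    linarith
  · intro h x hx hx'
    have := nonneg_of_no_zero hg' hl' (y := 0) h₁.le le_rfl (by simpa using h) hx hx'
    linarith

/-- A map with real orbits that are unbounded in both directions has many periods. -/
theorem manyPeriods_of_up_of_down (hF : IsLifting 1 F) (hU : Up F) (hD : Up (reflect F)) :
    ManyPeriods F := by
  by_cases h1 : ∀ x, re (F (real x)) < x
  · exact manyPeriods_of_forall_lt hF hU h1
  by_cases h2 : ∀ x, x < re (F (real x))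
  · refine manyPeriods_reflect.1 (manyPeriods_of_forall_lt hF.reflect hD fun x => ?_)
    rw [reflect_real, re_refl]
    linarith [h2 (-x)]
  push Not at h1 h2
  obtain ⟨a, ha⟩ := h1
  obtain ⟨b, hb⟩ := h2
  have hg : Continuous fun x => re (F (real x)) - x := (continuous_re_real hF).sub continuous_id
  obtain ⟨x, -, e⟩ := intermediate_value_uIcc (a := b) (b := a) hg.continuousOn
    (Set.Icc_subset_uIcc (⟨by linarith, by linarith⟩ :
      (0 : ℝ) ∈ Set.Icc (re (F (real b)) - b) (re (F (real a)) - a)))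
  rcases exists_frame_of_re_eq hF (sub_eq_zero.1 e) with h | ⟨⟨fr⟩⟩
  · exact Or.inl h
  rcases le_total 0 (re (F (real 0))) with h0 | h0
  · exact Frame.many_of_nonneg hF hU hD fr h0
  · exact manyPeriods_reflect.1 (Frame.many_of_nonneg hF.reflect hD (by rwa [reflect_reflect])
      (fr.reflect hF) (by simpa using h0))

/-! ### From rotation numbers to unbounded orbits -/

/-- The map `F - m`. -/
def shift (m : ℤ) (F : S → S) (z : S) : S := translate (-m) (F z)

theorem IsLifting.shift (hF : IsLifting 1 F) (m : ℤ) : IsLifting 1 (shift m F) := by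
  refine ⟨(continuous_translate _).comp hF.1, fun z => ?_⟩
  simp only [SigmaMap.shift, hF.apply_translate, translate_translate, add_comm]

theorem iterate_shift (hF : IsLifting 1 F) (m : ℤ) (n : ℕ) (z : S) :
    (shift m F)^[n] z = translate (-(n * m)) (F^[n] z) := by
  induction n generalizing z with
  | zero => simp
  | succ n ih =>
    rw [Function.iterate_succ_apply, ih, Function.iterate_succ_apply, shift, hF.iterate_translate,
      translate_translate]
    congr 1
    push_cast
    ring

theorem Per_shift (hF : IsLifting 1 F) (m : ℤ) : Per (shift m F) = Per F := by
  ext n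
  refine exists_congr fun z => ?_
  have : {i : ℕ | 0 < i ∧ ∃ k : ℤ, (shift m F)^[i] z = translate k z} =
      {i : ℕ | 0 < i ∧ ∃ k : ℤ, F^[i] z = translate k z} := by
    ext i
    simp only [Set.mem_ofPred_eq, iterate_shift hF]
    refine and_congr_right fun _ => ⟨?_, ?_⟩
    · rintro ⟨k, hk⟩
      refine ⟨k + i * m, ?_⟩
      rw [eq_translate_neg hk.symm, translate_translate, neg_neg]
    · rintro ⟨k, hk⟩
      exact ⟨k + -(i * m), by rw [hk, translate_translate]⟩
  unfold HasPeriodMod1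
  rw [this]

theorem HasRotationNumber.exists_lt {z : S} {α c : ℝ} (h : HasRotationNumber F z α) (hα : c < α)
    (C : ℝ) : ∃ n : ℕ, C + n * c < re (F^[n] z) := by
  obtain ⟨c', hc, hc'⟩ := exists_between hα
  have h1 : ∀ᶠ n : ℕ in atTop, c' < (re (F^[n] z) - re z) / n := h.eventually_const_lt hc'
  obtain ⟨N, hN⟩ := exists_nat_gt ((C - re z) / (c' - c))
  obtain ⟨n, ⟨hn, hn'⟩, hn0⟩ := ((h1.and (eventually_ge_atTop N)).and (eventually_gt_atTop 0)).exists
  refine ⟨n, ?_⟩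
  have hn0' : (0 : ℝ) < n := by exact_mod_cast hn0
  rw [lt_div_iff₀ hn0'] at hn
  have hN' : (C - re z) / (c' - c) < n := hN.trans_le (by exact_mod_cast hn')
  rw [div_lt_iff₀ (by linarith)] at hN'
  nlinarith

theorem HasRotationNumber.exists_gt {z : S} {α c : ℝ} (h : HasRotationNumber F z α) (hα : α < c)
    (C : ℝ) : ∃ n : ℕ, re (F^[n] z) < C + n * c := by
  have h' : HasRotationNumber (reflect F) (refl z) (-α) := by
    have := h.neg
    refine this.congr fun n => ?_
    have e : (((reflect F)^[n] (refl z) : S) : ℂ).re = -((F^[n] z : S) : ℂ).re := by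
      rw [iterate_reflect, refl_refl]; rfl
    have e' : ((refl z : S) : ℂ).re = -(z : ℂ).re := rfl
    rw [e, e']
    ring
  obtain ⟨n, hn⟩ := h'.exists_lt (c := -c) (by linarith) (-C)
  refine ⟨n, ?_⟩
  rw [iterate_reflect, refl_refl, re_refl] at hn
  linarith

theorem manyPeriods_of_mem_interior (hF : IsLifting 1 F) {m : ℤ} (hm : (m : ℝ) ∈ interior (rotR F)) :
    ManyPeriods F := by
  obtain ⟨ε, hε, hball⟩ := Metric.isOpen_iff.1 isOpen_interior _ hm
  have hsub := hball.trans interior_subset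
  obtain ⟨z, hz, hrot⟩ := hsub (a := m + ε / 2) (by
    rw [Metric.mem_ball, Real.dist_eq, add_sub_cancel_left, abs_of_pos (by linarith)]; linarith)
  obtain ⟨w, hw, hrot'⟩ := hsub (a := m - ε / 2) (by
    rw [Metric.mem_ball, Real.dist_eq, sub_sub_cancel_left, abs_neg, abs_of_pos (by linarith)]
    linarith)
  have hzr : real (re z) = z := (eq_real hz).symm
  have hwr : real (re w) = w := (eq_real hw).symm
  have hmany : ManyPeriods (shift m F) := by
    refine manyPeriods_of_up_of_down (hF.shift m) ⟨re z, fun C => ?_⟩ ⟨-re w, fun C => ?_⟩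
    · obtain ⟨n, hn⟩ := hrot.exists_lt (c := m) (by linarith) C
      refine ⟨n, ?_⟩
      rw [hzr, iterate_shift hF, re_translate]
      push_cast
      linarith
    · obtain ⟨n, hn⟩ := hrot'.exists_gt (c := m) (by linarith) (-C)
      refine ⟨n, ?_⟩
      rw [iterate_reflect, refl_real, neg_neg, hwr, iterate_shift hF, re_refl, re_translate]
      push_cast
      linarith
  simpa only [ManyPeriods, Per_shift hF] using hmany

theorem Per_subset_posNat (F : S → S) : Per F ⊆ posNat := fun _ ⟨_, h⟩ => h.1.1

theorem ManyPeriods.trichotomy (h : ManyPeriods F) :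
    (1 ∈ Per F ∧ 2 ∈ Per F ∧ Per F = posNat) ∨ (1 ∉ Per F ∧ Per F = posNat \ {1}) ∨
      (2 ∉ Per F ∧ Per F = posNat \ {2}) := by
  have h3 : ∀ n, 3 ≤ n → n ∈ Per F := by
    rcases h with h | h
    · exact fun n hn => h n (by omega)
    · exact h.2
  have hsub := Per_subset_posNat F
  have h12 : 1 ∈ Per F ∨ 2 ∈ Per F := by
    rcases h with h | h
    · exact Or.inr (h 2 le_rfl)
    · exact Or.inl h.1
  have hext : ∀ T : Set ℕ, (∀ n, 0 < n → (n ∈ Per F ↔ n ∈ T)) → T ⊆ posNat → Per F = T :=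
    fun T hT hTp => Set.ext fun n => ⟨fun hn => (hT n (hsub hn)).1 hn, fun hn =>
      (hT n (hTp hn)).2 hn⟩
  by_cases h1 : 1 ∈ Per F
  · by_cases h2 : 2 ∈ Per F
    · refine Or.inl ⟨h1, h2, hsub.antisymm fun n hn => ?_⟩
      have hn : 0 < n := hn
      obtain rfl | rfl | hn : n = 1 ∨ n = 2 ∨ 3 ≤ n := by omega
      exacts [h1, h2, h3 n hn]
    · refine Or.inr (Or.inr ⟨h2, hext _ (fun n hn => ?_) Set.sdiff_subset⟩)
      obtain rfl | rfl | hn' : n = 1 ∨ n = 2 ∨ 3 ≤ n := by omega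
      · simp [h1, posNat]
      · simp [h2]
      · simp only [h3 n hn', true_iff]
        exact ⟨hn, by simp; omega⟩
  · have h2 : 2 ∈ Per F := by tauto
    refine Or.inr (Or.inl ⟨h1, hext _ (fun n hn => ?_) Set.sdiff_subset⟩)
    obtain rfl | rfl | hn' : n = 1 ∨ n = 2 ∨ 3 ≤ n := by omega
    · simp [h1]
    · simp [h2, posNat]
    · simp only [h3 n hn', true_iff]
      exact ⟨hn, by simp; omega⟩

/-! ### Rotation intervals -/

theorem IsLifting.iterate (hF : IsLifting 1 F) (q : ℕ) : IsLifting 1 (F^[q]) :=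
  ⟨hF.1.iterate q, fun z => hF.iterate_translate q 1 z⟩

/-- If a real arc `[a, b]` covers its translates by `-1`, `0` and `1` under `G`, then all sequences
of translates with steps in `{-1, 0, 1}` are followed by some orbit. -/
theorem exists_itinerary {G : S → S} (hG : IsLifting 1 G) {m : ℤ} {a b x y : ℝ} (ha : m ≤ a)
    (hab : a < b) (hb : b ≤ m + 1) (hx : x ∈ Set.Icc a b) (hy : y ∈ Set.Icc a b)
    (hGx : re (G (real x)) ≤ a - 1) (hGy : b + 1 ≤ re (G (real y))) {s : ℕ → ℤ} (hs0 : s 0 = 0)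
    (hs : ∀ n, |s (n + 1) - s n| ≤ 1) :
    ∃ z ∈ Set.Icc a b, ∀ n, ∃ w ∈ Set.Icc a b, G^[n] (real z) = translate (s n) (real w) := by
  -- finite itineraries are built by taking preimages
  have hfin : ∀ (n : ℕ) (s : ℕ → ℤ), s 0 = 0 → (∀ i, |s (i + 1) - s i| ≤ 1) →
      ∃ z ∈ Set.Icc a b, ∀ i ≤ n, ∃ w ∈ Set.Icc a b, G^[i] (real z) = translate (s i) (real w) := by
    intro n
    induction n with
    | zero =>
      intro s hs0 _
      refine ⟨x, hx, fun i hi => ⟨x, hx, ?_⟩⟩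
      obtain rfl := Nat.le_zero.1 hi
      simp [hs0]
    | succ n ih =>
      intro s hs0 hs
      obtain ⟨z', hz', h⟩ := ih (fun i => s (i + 1) - s 1) (by simp) (fun i => by
        simpa using hs (i + 1))
      have hs1 : |s 1| ≤ 1 := by simpa [hs0] using hs 0
      have hs1' : |(s 1 : ℝ)| ≤ 1 := by exact_mod_cast hs1
      obtain ⟨l1, l2⟩ := abs_le.1 hs1'
      have hcont : Continuous fun t => kap m (translate (-s 1) (G (real t))) :=
        (continuous_kap m).comp ((continuous_translate _).comp (hG.1.comp continuous_real))
      have k1 : kap m (translate (-s 1) (G (real x))) ≤ a :=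
        kap_le_of_re_le (by linarith) (by rw [re_translate]; push_cast; linarith)
      have k2 : b ≤ kap m (translate (-s 1) (G (real y))) :=
        le_kap_of_le_re (by linarith) (by rw [re_translate]; push_cast; linarith)
      obtain ⟨z, hz, e⟩ := intermediate_value_uIcc (a := x) (b := y) hcont.continuousOn
        (Set.Icc_subset_uIcc (⟨k1.trans hz'.1, hz'.2.trans k2⟩ : z' ∈ Set.Icc _ _))
      have e' : G (real z) = translate (s 1) (real z') := by
        have h1 : m ≤ kap m (translate (-s 1) (G (real z))) := by
          simp only at e; rw [e]; exact ha.trans hz'.1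
        have h2 : kap m (translate (-s 1) (G (real z))) ≤ m + 1 := by
          simp only at e; rw [e]; exact hz'.2.trans hb
        have h3 := eq_real_kap h1 h2
        simp only at e
        rw [e] at h3
        rw [h3]
        simp
      refine ⟨z, Set.uIcc_subset_Icc hx hy hz, fun i hi => ?_⟩
      cases i with
      | zero => exact ⟨z, Set.uIcc_subset_Icc hx hy hz, by simp [hs0]⟩
      | succ i =>
        obtain ⟨w, hw, hw'⟩ := h i (by omega)
        refine ⟨w, hw, ?_⟩
        rw [Function.iterate_succ_apply, e', hG.iterate_translate, hw', translate_translate]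
        congr 1
        ring
  -- infinite itineraries exist by compactness
  let K : ℕ → Set ℝ := fun n => Set.Icc a b ∩ ⋂ i ≤ n,
    (fun t => G^[i] (real t)) ⁻¹' ((fun w => translate (s i) (real w)) '' Set.Icc a b)
  have hKc : ∀ n, IsClosed (K n) := fun n => isClosed_Icc.inter
    (isClosed_biInter fun i _ => IsClosed.preimage ((hG.1.iterate i).comp continuous_real)
      (isCompact_Icc.image ((continuous_translate _).comp continuous_real)).isClosed)
  obtain ⟨z, hz⟩ := IsCompact.nonempty_iInter_of_sequence_nonempty_isCompact_isClosed K
    (fun n t ht => ⟨ht.1, Set.mem_iInter₂.2 fun i hi => Set.mem_iInter₂.1 ht.2 i (by omega)⟩)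
    (fun n => by
      obtain ⟨z, hz, h⟩ := hfin n s hs0 hs
      exact ⟨z, hz, Set.mem_iInter₂.2 fun i hi => by
        obtain ⟨w, hw, e⟩ := h i hi
        exact ⟨w, hw, e.symm⟩⟩)
    (isCompact_Icc.of_isClosed_subset (hKc 0) Set.inter_subset_left) hKc
  rw [Set.mem_iInter] at hz
  refine ⟨z, (hz 0).1, fun n => ?_⟩
  obtain ⟨w, hw, e⟩ := Set.mem_iInter₂.1 (hz n).2 n le_rfl
  exact ⟨w, hw, e.symm⟩

theorem exists_displacement_bound (hF : IsLifting 1 F) : ∃ C, ∀ z, |re (F z) - re z| ≤ C := by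
  obtain ⟨C₁, h₁⟩ := (isCompact_Icc (a := (0 : ℝ)) (b := 1)).exists_bound_of_continuousOn
    ((continuous_re_real hF).sub continuous_id).continuousOn
  obtain ⟨C₂, h₂⟩ := (isCompact_Icc (a := (0 : ℝ)) (b := 1)).exists_bound_of_continuousOn
    (continuous_re_br hF).continuousOn
  refine ⟨max C₁ C₂, fun z => ?_⟩
  rcases (im_nonneg z).eq_or_lt with h | h
  · have e := hF.re_real_add ⌊re z⌋ (Int.fract (re z))
    rw [Int.fract_add_floor, ← eq_real h.symm] at e
    refine le_max_of_le_left ?_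
    have := h₁ (Int.fract (re z)) ⟨Int.fract_nonneg _, (Int.fract_lt_one _).le⟩
    rw [Real.norm_eq_abs] at this
    refine le_of_eq_of_le (congrArg _ ?_) this
    rw [e]
    simp only [Pi.sub_apply, id, Int.fract]
    ring
  · obtain ⟨k, hk⟩ := exists_re_eq_of_im_pos h
    refine le_max_of_le_right ?_
    have := h₂ (im z) ⟨h.le, im_le_one z⟩
    rw [Real.norm_eq_abs] at this
    refine le_of_eq_of_le (congrArg _ ?_) this
    rw [hk]
    rw [sub_eq_iff_eq_add]
    conv_lhs => rw [eq_translate_br hk]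
    rw [hF.apply_translate, re_translate]

theorem hasRotationNumber_of_bounded {z : S} {α D : ℝ}
    (h : ∀ n : ℕ, |re (F^[n] z) - re z - n * α| ≤ D) : HasRotationNumber F z α := by
  have h1 : Tendsto (fun n : ℕ => D / (n : ℝ)) atTop (𝓝 0) :=
    tendsto_const_div_atTop_nhds_zero_nat D
  have h2 : Tendsto (fun n : ℕ => (re (F^[n] z) - re z) / n - α) atTop (𝓝 0) := by
    refine squeeze_zero_norm' ?_ h1
    filter_upwards [eventually_gt_atTop 0] with n hn
    have hn : (0 : ℝ) < n := by exact_mod_cast hn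
    have : (re (F^[n] z) - re z) / n - α = (re (F^[n] z) - re z - n * α) / n := by field_simp
    rw [this, norm_div, Real.norm_eq_abs, Real.norm_eq_abs, abs_of_pos hn]
    gcongr
    exact h n
  have h3 := h2.add_const α
  simp only [sub_add_cancel, zero_add] at h3
  exact h3

/-- If a real arc covers its translates by `-1`, `0` and `1` under an iterate of `F`, then `0` is an
interior point of the rotation set: the Sturmian sequences `⌊n α⌋` are itineraries. -/
theorem zero_mem_interior_rotR (hF : IsLifting 1 F) {q : ℕ} (hq : 0 < q) {m : ℤ} {a b x y : ℝ}
    (ha : m ≤ a) (hab : a < b) (hb : b ≤ m + 1) (hx : x ∈ Set.Icc a b) (hy : y ∈ Set.Icc a b)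
    (hFx : re (F^[q] (real x)) ≤ a - 1) (hFy : b + 1 ≤ re (F^[q] (real y))) :
    (0 : ℝ) ∈ interior (rotR F) := by
  have hq' : (0 : ℝ) < q := by exact_mod_cast hq
  refine mem_interior.2 ⟨Set.Ioo (-(1 / q)) (1 / q), ?_, isOpen_Ioo, by simp [hq']⟩
  rintro β ⟨hβ, hβ'⟩
  obtain ⟨α, hα⟩ : ∃ α, α = β * q := ⟨_, rfl⟩
  have hα1 : α < 1 := by rw [hα]; exact (lt_div_iff₀ hq').1 hβ'
  have hα2 : -1 < α := by
    rw [← neg_div, div_lt_iff₀ hq'] at hβ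
    rw [hα]; exact hβ
  obtain ⟨z, hz, h⟩ := exists_itinerary (hF.iterate q) (s := fun n => ⌊n * α⌋) ha hab hb hx hy hFx
    hFy (by simp) (fun n => by
      have e : ((n + 1 : ℕ) : ℝ) * α = n * α + α := by push_cast; ring
      rw [e]
      have l1 : ⌊n * α + α⌋ < ⌊n * α⌋ + 2 := by
        rw [Int.floor_lt]; push_cast
        linarith [Int.lt_floor_add_one ((n : ℝ) * α)]
      have l2 : ⌊n * α⌋ - 1 ≤ ⌊n * α + α⌋ := by
        rw [Int.le_floor]; push_cast
        linarith [Int.floor_le ((n : ℝ) * α)]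
      rw [abs_le]
      constructor <;> omega)
  obtain ⟨C, hC⟩ := exists_displacement_bound hF
  have hC0 : 0 ≤ C := (abs_nonneg _).trans (hC (real 0))
  have hdisp : ∀ (r : ℕ) (w : S), |re (F^[r] w) - re w| ≤ r * C := by
    intro r w
    induction r with
    | zero => simp
    | succ r ih =>
      rw [Function.iterate_succ_apply']
      have := abs_add_le (re (F (F^[r] w)) - re (F^[r] w)) (re (F^[r] w) - re w)
      rw [sub_add_sub_cancel] at this
      push_cast
      linarith [hC (F^[r] w)]
  refine ⟨real z, rfl, hasRotationNumber_of_bounded (D := q * C + 3) fun n => ?_⟩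
  have hdiv := Nat.mod_add_div n q
  obtain ⟨w, hw, e⟩ := h (n / q)
  have e1 : F^[n] (real z) = F^[n % q] (translate ⌊((n / q : ℕ) : ℝ) * α⌋ (real w)) := by
    rw [← e, ← Function.iterate_mul, ← Function.iterate_add_apply, hdiv]
  have h1 := hdisp (n % q) (translate ⌊((n / q : ℕ) : ℝ) * α⌋ (real w))
  rw [← e1] at h1
  have hmod : (n % q : ℕ) ≤ q := (Nat.mod_lt n hq).le
  have hmod' : ((n % q : ℕ) : ℝ) ≤ q := by exact_mod_cast hmod
  have hdiv' : (n : ℝ) = (n % q : ℕ) + q * (n / q : ℕ) := by exact_mod_cast hdiv.symm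
  have hr : ((n % q : ℕ) : ℝ) * C ≤ q * C := mul_le_mul_of_nonneg_right hmod' hC0
  have hnβ : (n : ℝ) * β = (n % q : ℕ) * β + (n / q : ℕ) * α := by rw [hα, hdiv']; ring
  have hrβ : |((n % q : ℕ) : ℝ) * β| ≤ 1 := by
    rw [abs_mul, abs_of_nonneg (Nat.cast_nonneg _)]
    have : |β| ≤ 1 / q := abs_le.2 ⟨hβ.le, hβ'.le⟩
    calc ((n % q : ℕ) : ℝ) * |β| ≤ q * (1 / q) := by gcongr
      _ = 1 := by field_simp
  rw [re_translate, re_real] at h1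
  have f1 := Int.floor_le (((n / q : ℕ) : ℝ) * α)
  have f2 := Int.lt_floor_add_one (((n / q : ℕ) : ℝ) * α)
  rw [re_real, hnβ]
  have g1 := abs_le.1 h1
  have g2 := abs_le.1 hrβ
  have g3 : b - a ≤ 1 := by linarith
  rw [abs_le]
  constructor
  · linarith [g1.1, g2.2, hw.1, hw.2, hz.1, hz.2]
  · linarith [g1.2, g2.1, hw.1, hw.2, hz.1, hz.2]

/-! ### Examples -/

/-- The lifting that maps a real point of fractional part `s` and integer part `k` to the point
`k + g s + i h s`, and that maps the branches into the real axis with constant slope `c`. -/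
noncomputable def fold (g h : ℝ → ℝ) (c : ℝ) (h₀ : h 0 = 0)
    (hh : ∀ s, h s = 0 ∨ (∃ m : ℤ, g s = m) ∧ h s ∈ Set.Icc (0 : ℝ) 1) (z : S) : S :=
  mk (re z + (g (Int.fract (re z)) - Int.fract (re z)) + c * im z) (h (Int.fract (re z))) (by
    rcases hh (Int.fract (re z)) with h' | ⟨⟨m, hm⟩, h'⟩
    · exact Or.inl h'
    rcases (im_nonneg z).eq_or_lt with hz | hz
    · refine Or.inr ⟨⟨⌊re z⌋ + m, ?_⟩, h'⟩
      rw [hm, ← hz, Int.fract]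
      push_cast
      ring
    · obtain ⟨k, hk⟩ := exists_re_eq_of_im_pos hz
      left
      rw [hk, Int.fract_intCast, h₀])

section Fold

variable {g h : ℝ → ℝ} {c : ℝ} {h₀ : h 0 = 0}
  {hh : ∀ s, h s = 0 ∨ (∃ m : ℤ, g s = m) ∧ h s ∈ Set.Icc (0 : ℝ) 1}

theorem isLifting_fold (hg : Continuous g) (hg1 : g 1 = g 0 + 1) (hc : Continuous h) (h1 : h 1 = 0) :
    IsLifting 1 (fold g h c h₀ hh) := by
  constructor
  · have e1 : Continuous fun x : ℝ => g (Int.fract x) - Int.fract x :=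
      ContinuousOn.comp_fract'' (f := fun x => g x - x) (by fun_prop) (by simp [hg1])
    have e2 : Continuous fun x : ℝ => h (Int.fract x) :=
      ContinuousOn.comp_fract'' (f := h) (by fun_prop) (by rw [h₀, h1])
    exact continuous_mk ((continuous_re.add (e1.comp continuous_re)).add
      (continuous_const.mul continuous_im)) (e2.comp continuous_re) _
  · intro z
    refine ext_re_im ?_ ?_
    · simp [fold, mk, re, im, translate]
      ring
    · simp [fold, mk, re, im, translate]

theorem re_fold_real {x : ℝ} (hx : 0 ≤ x) (hx' : x < 1) : re (fold g h c h₀ hh (real x)) = g x := by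
  have : Int.fract x = x := Int.fract_eq_self.2 ⟨hx, hx'⟩
  show re (real x) + (g (Int.fract (re (real x))) - Int.fract (re (real x))) + c * im (real x) = g x
  rw [re_real, im_real, this]; ring

theorem im_fold_real {x : ℝ} (hx : 0 ≤ x) (hx' : x < 1) : im (fold g h c h₀ hh (real x)) = h x := by
  have : Int.fract x = x := Int.fract_eq_self.2 ⟨hx, hx'⟩
  show h (Int.fract (re (real x))) = h x
  rw [re_real, this]

theorem fold_br {t : ℝ} (ht : 0 ≤ t) (ht' : t ≤ 1) :
    fold g h c h₀ hh (br t) = real (g 0 + c * t) := by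
  refine ext_re_im ?_ ?_
  · show re (br t) + (g (Int.fract (re (br t))) - Int.fract (re (br t))) + c * im (br t) = _
    rw [im_br ht ht']; simp
  · show h (Int.fract (re (br t))) = 0
    simp [h₀]

theorem fold_real {x y : ℝ} (hx : 0 ≤ x) (hx' : x < 1) (hy : g x = y) (h' : h x = 0) :
    fold g h c h₀ hh (real x) = real y :=
  ext_re_im (by rw [re_fold_real hx hx', hy, re_real]) (by rw [im_fold_real hx hx', h', im_real])

end Fold

/-- Every point of `S` is a translate of a point of the branch over `0` off the real axis, or of a
point of `[0, 1)`. -/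
theorem exists_translate (z : S) : ∃ k : ℤ, (∃ t, 0 < t ∧ t ≤ 1 ∧ z = translate k (br t)) ∨
    ∃ x, 0 ≤ x ∧ x < 1 ∧ z = translate k (real x) := by
  rcases (im_nonneg z).eq_or_lt with h | h
  · exact ⟨⌊re z⌋, Or.inr ⟨Int.fract (re z), Int.fract_nonneg _, Int.fract_lt_one _,
      ext_re_im (by simp) (by simp [← h])⟩⟩
  · obtain ⟨k, hk⟩ := exists_re_eq_of_im_pos h
    exact ⟨k, Or.inl ⟨im z, h, im_le_one z, eq_translate_br hk⟩⟩

/-- To exclude a period it is enough to consider the points of a fundamental domain. -/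
theorem not_mem_Per {F : S → S} (hF : IsLifting 1 F) {n : ℕ}
    (h₁ : ∀ t, 0 < t → t ≤ 1 → ∀ k : ℤ, F^[n] (br t) ≠ translate k (br t))
    (h₂ : ∀ x, 0 ≤ x → x < 1 → ∀ k : ℤ, F^[n] (real x) = translate k (real x) →
      1 < n ∧ ∃ l : ℤ, F (real x) = translate l (real x)) : n ∉ Per F := by
  rintro ⟨z, ⟨hn, k, hk⟩, hmin⟩
  obtain ⟨j, ⟨t, ht, ht', rfl⟩ | ⟨x, hx, hx', rfl⟩⟩ := exists_translate z
  · rw [hF.iterate_translate, translate_translate, add_comm, ← translate_translate] at hk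
    exact h₁ t ht ht' k (translate_injective j hk)
  · rw [hF.iterate_translate, translate_translate, add_comm, ← translate_translate] at hk
    obtain ⟨h1, l, hl⟩ := h₂ x hx hx' k (translate_injective j hk)
    have := hmin (a := 1) ⟨one_pos, l, by
      rw [Function.iterate_one, hF.apply_translate, hl, translate_translate, translate_translate,
        add_comm]⟩
    omega

/-- A map that displaces the real axis by a sine wave. -/
noncomputable def wave (z : S) : S := real (re z + 2 * Real.sin (2 * Real.pi * re z))

theorem isLifting_wave : IsLifting 1 wave := by
  constructor
  · unfold wave
    fun_prop
  · intro z
    refine ext_re_im ?_ ?_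
    · simp only [wave, re_real, re_translate, Int.cast_one]
      rw [mul_add, mul_one, Real.sin_add_two_pi]
      ring
    · simp [wave]

theorem wave_real (x : ℝ) : wave (real x) = real (x + 2 * Real.sin (2 * Real.pi * x)) := rfl

theorem zero_mem_interior_rotR_wave : (0 : ℝ) ∈ interior (rotR wave) := by
  refine zero_mem_interior_rotR isLifting_wave one_pos (m := 0) (a := 0) (b := 1) (x := 3 / 4)
    (y := 1 / 4) (by simp) one_pos (by simp) ⟨by norm_num, by norm_num⟩ ⟨by norm_num, by norm_num⟩
    ?_ ?_
  · have : Real.sin (2 * Real.pi * (3 / 4)) = -1 := by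
      rw [show 2 * Real.pi * (3 / 4) = Real.pi / 2 + Real.pi by ring, Real.sin_add_pi,
        Real.sin_pi_div_two]
    rw [Function.iterate_one, wave_real, re_real, this]
    norm_num
  · have : Real.sin (2 * Real.pi * (1 / 4)) = 1 := by
      rw [show 2 * Real.pi * (1 / 4) = Real.pi / 2 by ring, Real.sin_pi_div_two]
    rw [Function.iterate_one, wave_real, re_real, this]
    norm_num

theorem one_mem_Per_wave : 1 ∈ Per wave :=
  ⟨real 0, ⟨one_pos, 0, by simp [wave_real]⟩, fun _ h => h.1⟩

theorem two_mem_Per_wave : 2 ∈ Per wave := by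
  -- the point is displaced by `1 / 2`, and its image by `-1 / 2`
  obtain ⟨x, hx⟩ : ∃ x : ℝ, Real.sin (2 * Real.pi * x) = 1 / 4 := by
    refine ⟨Real.arcsin (1 / 4) / (2 * Real.pi), ?_⟩
    rw [mul_div_cancel₀ _ (by positivity), Real.sin_arcsin] <;> norm_num
  have h1 : wave (real x) = real (x + 1 / 2) := by rw [wave_real, hx]; norm_num
  have h2 : wave (real (x + 1 / 2)) = real x := by
    rw [wave_real, show 2 * Real.pi * (x + 1 / 2) = 2 * Real.pi * x + Real.pi by ring,
      Real.sin_add_pi, hx]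
    congr 1
    ring
  refine ⟨real x, ⟨two_pos, 0, by
    rw [Function.iterate_succ_apply, Function.iterate_one, h1, h2, translate_zero]⟩, ?_⟩
  rintro i ⟨hi, k, hk⟩
  by_contra! hlt
  obtain rfl : i = 1 := by omega
  rw [Function.iterate_one, h1] at hk
  have := congrArg re hk
  simp only [re_real, re_translate, add_right_inj] at this
  have h3 : ((2 * k : ℤ) : ℝ) = (1 : ℤ) := by push_cast; linarith
  have h3 : 2 * k = 1 := by exact_mod_cast h3
  omega

theorem Per_wave : Per wave = posNat := by
  have h := (manyPeriods_of_mem_interior isLifting_wave (m := 0)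
    (by simpa using zero_mem_interior_rotR_wave)).trichotomy
  rcases h with h | h | h
  · exact h.2.2
  · exact absurd one_mem_Per_wave h.1
  · exact absurd two_mem_Per_wave h.1

/-- The hat function of height `1` with support `[c - 1/8, c + 1/8]`. -/
noncomputable def hat (c s : ℝ) : ℝ := max 0 (1 - 8 * |s - c|)

theorem continuous_hat (c : ℝ) : Continuous (hat c) := by unfold hat; fun_prop

theorem hat_le_one (c s : ℝ) : hat c s ≤ 1 :=
  max_le zero_le_one (by linarith [abs_nonneg (s - c)])

theorem hat_nonneg (c s : ℝ) : 0 ≤ hat c s := le_max_left _ _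

theorem hat_eq_zero {c s : ℝ} (h : s ≤ c - 1 / 8 ∨ c + 1 / 8 ≤ s) : hat c s = 0 := by
  refine max_eq_left ?_
  rcases h with h | h
  · linarith [neg_le_abs (s - c)]
  · linarith [le_abs_self (s - c)]

theorem hat_pos {c s : ℝ} (h : c - 1 / 8 < s) (h' : s < c + 1 / 8) : 0 < hat c s := by
  refine lt_max_of_lt_right ?_
  have : |s - c| < 1 / 8 := abs_lt.2 ⟨by linarith, by linarith⟩
  linarith

@[simp] theorem hat_self (c : ℝ) : hat c c = 1 := by simp [hat]

/-- The real part of the map without fixed points: its slopes on `[0, 1/8]`, `[1/8, 3/8]` and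
`[3/8, 1]` are `4`, `0` and `4/5`. -/
noncomputable def skipOneRe (s : ℝ) : ℝ :=
  1 / 2 + 4 * s - 4 * max 0 (s - 1 / 8) + 4 / 5 * max 0 (s - 3 / 8)

theorem skipOneRe_left {s : ℝ} (h : s ≤ 1 / 8) : skipOneRe s = 1 / 2 + 4 * s := by
  rw [skipOneRe, max_eq_left (by linarith), max_eq_left (by linarith)]; ring

theorem skipOneRe_mid {s : ℝ} (h : 1 / 8 ≤ s) (h' : s ≤ 3 / 8) : skipOneRe s = 1 := by
  rw [skipOneRe, max_eq_right (by linarith), max_eq_left (by linarith)]; ring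

theorem skipOneRe_right {s : ℝ} (h : 3 / 8 ≤ s) : skipOneRe s = 1 + 4 / 5 * (s - 3 / 8) := by
  rw [skipOneRe, max_eq_right (by linarith), max_eq_right (by linarith)]; ring

/-- A map that has no fixed point modulo `1`. -/
noncomputable def skipOne : S → S :=
  fold skipOneRe (hat (1 / 4)) (-(11 / 2)) (hat_eq_zero (by norm_num)) fun s => by
    by_cases h : s ≤ 1 / 8
    · exact Or.inl (hat_eq_zero (by left; linarith))
    by_cases h' : 3 / 8 ≤ s
    · exact Or.inl (hat_eq_zero (by right; linarith))
    · exact Or.inr ⟨⟨1, by rw [skipOneRe_mid (by linarith) (by linarith)]; simp⟩, hat_nonneg _ _,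
        hat_le_one _ _⟩

theorem isLifting_skipOne : IsLifting 1 skipOne :=
  isLifting_fold (by unfold skipOneRe; fun_prop)
    (by rw [skipOneRe_right (by norm_num), skipOneRe_left (by norm_num)]; norm_num)
    (continuous_hat _) (hat_eq_zero (by norm_num))

theorem skipOne_br {t : ℝ} (ht : 0 ≤ t) (ht' : t ≤ 1) : skipOne (br t) = real (1 / 2 - 11 / 2 * t) := by
  rw [skipOne, fold_br ht ht', skipOneRe_left (by norm_num)]
  congr 1
  ring

theorem zero_mem_interior_rotR_skipOne : (0 : ℝ) ∈ interior (rotR skipOne) := by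
  refine zero_mem_interior_rotR isLifting_skipOne (q := 2) (by norm_num) (m := 0) (a := 1 / 4) (b := 3 / 8)
    (x := 1 / 4) (y := 3 / 8) (by simp) (by norm_num) (by norm_num) ⟨by norm_num, by norm_num⟩
    ⟨by norm_num, by norm_num⟩ ?_ ?_
  · have h1 : skipOne (real (1 / 4)) = translate 1 (br 1) := by
      refine ext_re_im ?_ ?_
      · rw [skipOne, re_fold_real (by norm_num) (by norm_num), skipOneRe_mid (by norm_num) (by norm_num)]
        simp
      · rw [skipOne, im_fold_real (by norm_num) (by norm_num), hat_self, im_translate,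
          im_br zero_le_one le_rfl]
    rw [Function.iterate_succ_apply, Function.iterate_one, h1, isLifting_skipOne.apply_translate,
      skipOne_br zero_le_one le_rfl, re_translate, re_real]
    norm_num
  · have h1 : skipOne (real (3 / 8)) = translate 1 (br 0) := by
      rw [br_zero, translate_real, skipOne, fold_real (y := 1) (by norm_num) (by norm_num)
        (skipOneRe_mid (by norm_num) le_rfl) (hat_eq_zero (by norm_num))]
      norm_num
    rw [Function.iterate_succ_apply, Function.iterate_one, h1, isLifting_skipOne.apply_translate,
      skipOne_br le_rfl zero_le_one, re_translate, re_real]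
    norm_num

theorem not_intCast_eq {x : ℝ} (k n : ℤ) (h : (n : ℝ) < x) (h' : x < n + 1) : x ≠ k := by
  rintro rfl
  have h1 : n < k := by exact_mod_cast h
  have h2 : k < n + 1 := by exact_mod_cast h'
  omega

theorem one_notMem_Per_skipOne : 1 ∉ Per skipOne := by
  refine not_mem_Per isLifting_skipOne (fun t ht ht' k h => ?_) fun x hx hx' k h => ?_
  · rw [Function.iterate_one, skipOne_br ht.le ht'] at h
    have := congrArg im h
    rw [im_real, im_translate, im_br ht.le ht'] at this
    linarith
  · exfalso
    rw [Function.iterate_one] at h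
    have h1 := congrArg re h
    have h2 := congrArg im h
    rw [skipOne, re_fold_real hx hx', re_translate, re_real] at h1
    rw [skipOne, im_fold_real hx hx', im_translate, im_real] at h2
    rcases le_or_gt x (1 / 8) with h3 | h3
    · rw [skipOneRe_left h3] at h1
      exact not_intCast_eq (x := 1 / 2 + 3 * x) k 0 (by push_cast; linarith) (by push_cast; linarith)
        (by linarith)
    rcases lt_or_ge x (3 / 8) with h4 | h4
    · exact (hat_pos (c := 1 / 4) (by linarith) (by linarith)).ne' h2
    · rw [skipOneRe_right h4] at h1
      exact not_intCast_eq (x := 7 / 10 - x / 5) k 0 (by push_cast; linarith)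
        (by push_cast; linarith) (by linarith)

theorem Per_skipOne : Per skipOne = posNat \ {1} := by
  have h := (manyPeriods_of_mem_interior isLifting_skipOne (m := 0)
    (by simpa using zero_mem_interior_rotR_skipOne)).trichotomy
  rcases h with h | h | h
  · exact absurd h.1 one_notMem_Per_skipOne
  · exact h.2
  · rw [h.2]
    exact absurd (h.2 ▸ ⟨show 0 < 1 from one_pos, by simp⟩ : 1 ∈ Per skipOne) one_notMem_Per_skipOne

/-- The real part of the map without points of period `2`: its slopes on `[0, 1/8]`, `[1/8, 1/4]`,
`[1/4, 1/2]`, `[1/2, 3/4]` and `[3/4, 1]` are `-4`, `4`, `1`, `3` and `0`. -/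
noncomputable def skipTwoRe (s : ℝ) : ℝ :=
  -4 * s + 8 * max 0 (s - 1 / 8) - 3 * max 0 (s - 1 / 4) + 2 * max 0 (s - 1 / 2)
    - 3 * max 0 (s - 3 / 4)

theorem skipTwoRe_zero : skipTwoRe 0 = 0 := by norm_num [skipTwoRe]

theorem skipTwoRe_of_le {s : ℝ} (h : s ≤ 1 / 8) : skipTwoRe s = -4 * s := by
  rw [skipTwoRe, max_eq_left (by linarith), max_eq_left (by linarith), max_eq_left (by linarith),
    max_eq_left (by linarith)]
  ring

theorem skipTwoRe_eighth {s : ℝ} (h : 1 / 8 ≤ s) (h' : s ≤ 1 / 4) : skipTwoRe s = 4 * s - 1 := by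
  rw [skipTwoRe, max_eq_right (by linarith), max_eq_left (by linarith), max_eq_left (by linarith),
    max_eq_left (by linarith)]
  ring

theorem skipTwoRe_quarter {s : ℝ} (h : 1 / 4 ≤ s) (h' : s ≤ 1 / 2) : skipTwoRe s = s - 1 / 4 := by
  rw [skipTwoRe, max_eq_right (by linarith), max_eq_right (by linarith), max_eq_left (by linarith),
    max_eq_left (by linarith)]
  ring

theorem skipTwoRe_half {s : ℝ} (h : 1 / 2 ≤ s) (h' : s ≤ 3 / 4) : skipTwoRe s = 3 * s - 5 / 4 := by
  rw [skipTwoRe, max_eq_right (by linarith), max_eq_right (by linarith), max_eq_right (by linarith),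
    max_eq_left (by linarith)]
  ring

theorem skipTwoRe_three_quarters {s : ℝ} (h : 3 / 4 ≤ s) : skipTwoRe s = 1 := by
  rw [skipTwoRe, max_eq_right (by linarith), max_eq_right (by linarith), max_eq_right (by linarith),
    max_eq_right (by linarith)]
  ring

/-- A map that has no point of period `2` modulo `1`. -/
noncomputable def skipTwo : S → S :=
  fold skipTwoRe (hat (7 / 8)) (3 / 4) (hat_eq_zero (by norm_num)) fun s => by
    by_cases h : s ≤ 3 / 4
    · exact Or.inl (hat_eq_zero (by left; linarith))
    · exact Or.inr ⟨⟨1, by rw [skipTwoRe_three_quarters (by linarith)]; simp⟩, hat_nonneg _ _, hat_le_one _ _⟩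

theorem isLifting_skipTwo : IsLifting 1 skipTwo :=
  isLifting_fold (by unfold skipTwoRe; fun_prop)
    (by rw [skipTwoRe_three_quarters (by norm_num), skipTwoRe_zero]; norm_num)
    (continuous_hat _) (hat_eq_zero (by norm_num))

theorem skipTwo_br {t : ℝ} (ht : 0 ≤ t) (ht' : t ≤ 1) : skipTwo (br t) = real (3 / 4 * t) := by
  rw [skipTwo, fold_br ht ht', skipTwoRe_zero, zero_add]

theorem skipTwo_real {x y : ℝ} (hx : 0 ≤ x) (hx' : x ≤ 3 / 4) (hy : skipTwoRe x = y) :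
    skipTwo (real x) = real y :=
  fold_real hx (by linarith) hy (hat_eq_zero (by left; linarith))

theorem skipTwo_real_right {x : ℝ} (hx : 3 / 4 ≤ x) (hx' : x < 1) :
    skipTwo (real x) = translate 1 (br (hat (7 / 8) x)) := by
  refine ext_re_im ?_ ?_
  · rw [skipTwo, re_fold_real (by linarith) hx', skipTwoRe_three_quarters hx]; simp
  · rw [skipTwo, im_fold_real (by linarith) hx', im_translate, im_br (hat_nonneg _ _) (hat_le_one _ _)]

theorem zero_mem_interior_rotR_skipTwo : (0 : ℝ) ∈ interior (rotR skipTwo) := by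
  refine zero_mem_interior_rotR isLifting_skipTwo (q := 3) (by norm_num) (m := 0) (a := 1 / 2) (b := 3 / 4)
    (x := 13 / 24) (y := 17 / 24) (by simp) (by norm_num) (by norm_num) ⟨by norm_num, by norm_num⟩
    ⟨by norm_num, by norm_num⟩ ?_ ?_
  · have h1 : skipTwo (real (13 / 24)) = real (3 / 8) :=
      skipTwo_real (by norm_num) (by norm_num)
        (by rw [skipTwoRe_half (by norm_num) (by norm_num)]; norm_num)
    have h2 : skipTwo (real (3 / 8)) = real (1 / 8) :=
      skipTwo_real (by norm_num) (by norm_num)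
        (by rw [skipTwoRe_quarter (by norm_num) (by norm_num)]; norm_num)
    have h3 : skipTwo (real (1 / 8)) = real (-(1 / 2)) :=
      skipTwo_real (by norm_num) (by norm_num) (by rw [skipTwoRe_of_le le_rfl]; norm_num)
    rw [Function.iterate_succ_apply, Function.iterate_succ_apply, Function.iterate_one, h1, h2, h3,
      re_real]
    norm_num
  · have h1 : skipTwo (real (17 / 24)) = real (7 / 8) :=
      skipTwo_real (by norm_num) (by norm_num)
        (by rw [skipTwoRe_half (by norm_num) (by norm_num)]; norm_num)
    have h2 : skipTwo (real (7 / 8)) = translate 1 (br 1) := by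
      rw [skipTwo_real_right (by norm_num) (by norm_num), hat_self]
    rw [Function.iterate_succ_apply, Function.iterate_succ_apply, Function.iterate_one, h1, h2,
      isLifting_skipTwo.apply_translate, skipTwo_br zero_le_one le_rfl, re_translate, re_real]
    norm_num

theorem two_notMem_Per_skipTwo : 2 ∉ Per skipTwo := by
  have hF := isLifting_skipTwo
  refine not_mem_Per hF (fun t ht ht' k h => ?_) fun x hx hx' k h => ⟨one_lt_two, ?_⟩
  · -- the branch is mapped onto `[0, 3/4]`, which is mapped into the real axis
    rw [Function.iterate_succ_apply, Function.iterate_one, skipTwo_br ht.le ht',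
      skipTwo_real (by linarith) (by linarith) rfl] at h
    have := congrArg im h
    rw [im_real, im_translate, im_br ht.le ht'] at this
    linarith
  rw [Function.iterate_succ_apply, Function.iterate_one] at h
  -- the image of a real point of period `2` is not in the interior of `[3/4, 1]` modulo `1`
  have hno : ∀ (l : ℤ) (y : ℝ), 3 / 4 < y → y < 1 → skipTwo (real x) ≠ translate l (real y) := by
    intro l y hy hy' e
    rw [e, hF.apply_translate, skipTwo_real_right hy.le hy'] at h
    have := congrArg im h
    rw [im_translate, im_translate, im_translate, im_real,
      im_br (hat_nonneg _ _) (hat_le_one _ _)] at this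
    exact (hat_pos (c := 7 / 8) (by linarith) (by linarith)).ne' this
  have hre : ∀ (l : ℤ) (y w : ℝ), 0 ≤ y → y ≤ 3 / 4 → skipTwo (real x) = translate l (real y) →
      skipTwoRe y = w → w + l - x = k := by
    intro l y w hy hy' e e'
    rw [e, hF.apply_translate, skipTwo_real hy hy' e'] at h
    have := congrArg re h
    simp only [re_translate, re_real] at this
    linarith
  rcases lt_or_ge (3 / 4) x with h5 | h5
  · exfalso
    have hp := hat_pos (c := 7 / 8) (s := x) (by linarith) (by linarith)
    rw [skipTwo_real_right h5.le hx', hF.apply_translate,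
      skipTwo_br (hat_nonneg _ _) (hat_le_one _ _)] at h
    have := congrArg re h
    simp only [re_translate, re_real] at this
    have h1 := hat_le_one (7 / 8) x
    push_cast at this
    exact not_intCast_eq (x := 3 / 4 * hat (7 / 8) x - x) (k - 1) (-1)
      (by push_cast; linarith) (by push_cast; linarith) (by push_cast; linarith)
  rcases le_or_gt (1 / 2) x with h4 | h4
  · have e := skipTwo_real hx h5 (skipTwoRe_half h4 h5)
    rcases le_or_gt (3 * x - 5 / 4) (1 / 2) with g | g
    · exfalso
      have := hre 0 _ _ (by linarith) (by linarith) (by rw [e, translate_zero])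
        (skipTwoRe_quarter (by linarith) g)
      exact not_intCast_eq k (-1) (by push_cast; linarith) (by push_cast; linarith) this
    rcases le_or_gt (3 * x - 5 / 4) (3 / 4) with g' | g'
    · have := hre 0 _ _ (by linarith) g' (by rw [e, translate_zero]) (skipTwoRe_half g.le g')
      have hk : k = 0 := by
        by_contra hk
        push_cast at this
        rcases lt_or_gt_of_ne hk with hk | hk
        · have : (k : ℝ) ≤ -1 := by exact_mod_cast (by omega : k ≤ -1)
          linarith
        · have : (1 : ℝ) ≤ k := by exact_mod_cast (by omega : 1 ≤ k)
          linarith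
      rw [hk] at this
      push_cast at this
      exact ⟨0, by rw [e, translate_zero]; congr 1; linarith⟩
    rcases lt_or_ge (3 * x - 5 / 4) 1 with g'' | g''
    · exact absurd (by rw [e, translate_zero]) (hno 0 _ g' g'')
    · exfalso
      obtain rfl : x = 3 / 4 := by linarith
      have := hre 1 0 0 le_rfl (by norm_num) (by rw [e, translate_real]; norm_num) skipTwoRe_zero
      exact not_intCast_eq k 0 (by norm_num) (by norm_num) this
  rcases le_or_gt (1 / 4) x with h3 | h3
  · exfalso
    have e := skipTwo_real hx h5 (skipTwoRe_quarter h3 h4.le)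
    rcases le_total (x - 1 / 4) (1 / 8) with g | g
    · have := hre 0 _ _ (by linarith) (by linarith) (by rw [e, translate_zero]) (skipTwoRe_of_le g)
      exact not_intCast_eq k (-1) (by push_cast; linarith) (by push_cast; linarith) this
    · have := hre 0 _ _ (by linarith) (by linarith) (by rw [e, translate_zero])
        (skipTwoRe_eighth g (by linarith))
      exact not_intCast_eq k (-1) (by push_cast; linarith) (by push_cast; linarith) this
  rcases hx.eq_or_lt with rfl | hx0
  · exact ⟨0, by rw [skipTwo_real le_rfl h5 skipTwoRe_zero, translate_zero]⟩
  exfalso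
  rcases le_total x (1 / 8) with h1 | h1
  · have e : skipTwo (real x) = translate (-1) (real (1 - 4 * x)) := by
      rw [skipTwo_real hx h5 (skipTwoRe_of_le h1), translate_real]; congr 1; push_cast; ring
    rcases lt_or_ge (3 / 4) (1 - 4 * x) with g | g
    · exact hno _ _ g (by linarith) e
    · have := hre _ _ _ (by linarith) g e (skipTwoRe_half (by linarith) g)
      exact not_intCast_eq k (-1) (by push_cast; linarith) (by push_cast; linarith) this
  · have e : skipTwo (real x) = translate (-1) (real (4 * x)) := by
      rw [skipTwo_real hx h5 (skipTwoRe_eighth h1 h3.le), translate_real]; congr 1; push_cast; ring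
    rcases lt_or_ge (3 / 4) (4 * x) with g | g
    · exact hno _ _ g (by linarith) e
    · have := hre _ _ _ (by linarith) g e (skipTwoRe_half (by linarith) g)
      exact not_intCast_eq k (-1) (by push_cast; linarith) (by push_cast; linarith) this

theorem Per_skipTwo : Per skipTwo = posNat \ {2} := by
  have h := (manyPeriods_of_mem_interior isLifting_skipTwo (m := 0)
    (by simpa using zero_mem_interior_rotR_skipTwo)).trichotomy
  rcases h with h | h | h
  · exact absurd h.2.1 two_notMem_Per_skipTwo
  · exact absurd (h.2 ▸ ⟨show 0 < 2 from two_pos, by simp⟩ : 2 ∈ Per skipTwo) two_notMem_Per_skipTwo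
  · exact h.2

end SigmaMap

theorem mainTheorem1 :
    (∀ F : SigmaMap.S → SigmaMap.S, SigmaMap.IsLifting 1 F →
      (∃ m : ℤ, (m : ℝ) ∈ interior (SigmaMap.rotR F)) →
        SigmaMap.Per F = SigmaMap.posNat ∨
        SigmaMap.Per F = SigmaMap.posNat \ {1} ∨
        SigmaMap.Per F = SigmaMap.posNat \ {2}) ∧
    ∃ F₀ F₁ F₂ : SigmaMap.S → SigmaMap.S,
      (SigmaMap.IsLifting 1 F₀ ∧ (0 : ℝ) ∈ interior (SigmaMap.rotR F₀) ∧
        SigmaMap.Per F₀ = SigmaMap.posNat) ∧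
      (SigmaMap.IsLifting 1 F₁ ∧ (0 : ℝ) ∈ interior (SigmaMap.rotR F₁) ∧
        SigmaMap.Per F₁ = SigmaMap.posNat \ {1}) ∧
      (SigmaMap.IsLifting 1 F₂ ∧ (0 : ℝ) ∈ interior (SigmaMap.rotR F₂) ∧
        SigmaMap.Per F₂ = SigmaMap.posNat \ {2}) := by
  refine ⟨fun F hF ⟨m, hm⟩ => ?_, SigmaMap.wave, SigmaMap.skipOne, SigmaMap.skipTwo,
    ⟨SigmaMap.isLifting_wave, SigmaMap.zero_mem_interior_rotR_wave, SigmaMap.Per_wave⟩,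
    ⟨SigmaMap.isLifting_skipOne, SigmaMap.zero_mem_interior_rotR_skipOne, SigmaMap.Per_skipOne⟩,
    SigmaMap.isLifting_skipTwo, SigmaMap.zero_mem_interior_rotR_skipTwo, SigmaMap.Per_skipTwo⟩
  rcases (SigmaMap.manyPeriods_of_mem_interior hF hm).trichotomy with h | h | h
  · exact Or.inl h.2.2
  · exact Or.inr (Or.inl h.2)
  · exact Or.inr (Or.inr h.2)
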